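/- Let $n\ge 1$ and let $(A_k)_{k\ge 0}$ be a sequence of real numbers. There is a constant $C>0$, depending only on $n$ and $(A_k)$, such that the following holds for every $0<\delta\le 1/2$. Let $\{\Delta_j\}$ be a family of pairwise disjoint $\delta$-balls $\Delta_j=\mathbb{S}^{n-1}\cap B_\delta(c_j)$, $c_j\in\mathbb{S}^{n-1}$, and let $\{\mathbf 1^*_{\Delta_j}\}$ be corresponding smooth bump functions: each $\mathbf 1^*_{\Delta_j}:\mathbb{S}^{n-1}\to\mathbb{R}$ is smooth, vanishes outside $\Delta_j$, equals $1$ on $\tfrac12\Delta_j=\mathbb{S}^{n-1}\cap B_{\delta/2}(c_j)$, and satisfies $|\nabla^k\mathbf 1^*_{\Delta_j}|\le A_k\,\delta^{-k}$ on $\mathbb{S}^{n-1}$ for all $k\ge 0$, where $\nabla^k$ denotes the $k$-th derivative in $\mathbb{R}^n$ of the extension $\xi\mapsto\mathbf 1^*_{\Delta_j}(\xi/|\xi|)$. For Schwartz functions $f$ on $\mathbb{R}^n$ let $$T_jf=\big(\mathbf 1^*_{\Delta_j}(\cdot/|\cdot|)\,\widehat f(\cdot)\big)^\vee$$ be the smooth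 Fourier projection of $f$ to the cone $\{\xi\in\mathbb{R}^n:\xi/|\xi|\in\Delta_j\}$. Then each $T_j$ extends (uniquely) to a bounded linear operator on $L^4(\mathbb{R}^n)$, again denoted by $T_j$, and for all $f\in L^4(\mathbb{R}^n)$ $$\Big\|\Big(\sum_j|T_jf|^2\Big)^{1/2}\Big\|_{L^4(\mathbb{R}^n)}\le C\,(\log\delta^{-1})^{1/2}\,\|f\|_{L^4(\mathbb{R}^n)}.$$ -/

import Mathlib

open MeasureTheory
open scoped FourierTransform SchwartzMap ContDiff ENNReal

noncomputable section

namespace ConeSquareFunction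

/-- The Euclidean space `ℝⁿ`. -/
abbrev Space (n : ℕ) : Type := EuclideanSpace ℝ (Fin n)

/-- The unit sphere `𝕊ⁿ⁻¹` of `ℝⁿ`, with the distance inherited from `ℝⁿ`; thus
`Metric.ball c r : Set (UnitSphere n)` is the cap `𝕊ⁿ⁻¹ ∩ B_r(c)`. -/
abbrev UnitSphere (n : ℕ) : Type := Metric.sphere (0 : Space n) 1

instance fact_one_le_four : Fact ((1 : ℝ≥0∞) ≤ 4) := ⟨by norm_num⟩

/-- The direction `ξ / |ξ|` of a nonzero vector. -/
def direction {n : ℕ} (ξ : Space n) (h : ξ ≠ 0) : UnitSphere n :=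
  ⟨‖ξ‖⁻¹ • ξ, by
    rw [mem_sphere_zero_iff_norm, norm_smul, norm_inv, norm_norm,
      inv_mul_cancel₀ (norm_ne_zero_iff.mpr h)]⟩

open Classical in
/-- The function `ξ ↦ φ (ξ / |ξ|)`, extended by `0` to the origin. -/
def radialExt {n : ℕ} (φ : UnitSphere n → ℝ) (ξ : Space n) : ℝ :=
  if h : ξ ≠ 0 then φ (direction ξ h) else 0

/-- `φ` is a smooth bump function adapted to the cap `Δ = 𝕊ⁿ⁻¹ ∩ B_δ(c)`, with constants `A k`:
it is smooth, supported in `Δ`, equal to `1` on `½ Δ`, and `|∇ᵏ φ| ≤ A k * δ⁻ᵏ` for every `k`.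
Smoothness and derivatives of a function on the sphere are those of its extension to
`ℝⁿ ∖ {0}` that is constant along rays, taken at the points of the sphere. -/
structure IsBump {n : ℕ} (A : ℕ → ℝ) (δ : ℝ) (c : UnitSphere n) (φ : UnitSphere n → ℝ) :
    Prop where
  smooth : ContDiffOn ℝ ∞ (radialExt φ) {0}ᶜ
  support_subset : Function.support φ ⊆ Metric.ball c δ
  eq_one : ∀ x ∈ Metric.ball c (δ / 2), φ x = 1
  deriv_bound : ∀ (k : ℕ) (x : UnitSphere n),
    ‖iteratedFDeriv ℝ k (radialExt φ) (x : Space n)‖ ≤ A k * (δ⁻¹) ^ k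

/-- The smooth Fourier projection `(φ(·/|·|) f̂)^∨` of a Schwartz function `f`. -/
def smoothProj {n : ℕ} (φ : UnitSphere n → ℝ) (f : 𝓢(Space n, ℂ)) : Space n → ℂ :=
  𝓕⁻ (fun ξ : Space n => (radialExt φ ξ : ℂ) * 𝓕 (f : Space n → ℂ) ξ)

/-- `T` is the bounded operator on `L⁴(ℝⁿ)` that extends `f ↦ (φ(·/|·|) f̂)^∨` from the (dense)
Schwartz functions. -/
def IsSmoothProj {n : ℕ} (φ : UnitSphere n → ℝ)
    (T : Lp ℂ 4 (volume : Measure (Space n)) →L[ℂ] Lp ℂ 4 (volume : Measure (Space n))) : Prop :=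
  ∀ f : 𝓢(Space n, ℂ), T (f.toLp 4 volume) =ᵐ[volume] smoothProj φ f

end ConeSquareFunction

end

/-! The inequality is proved in squared form: `l2` of `∑ⱼ |Tⱼ f|²` is at most a constant times `log
δ⁻¹` times `l2` of `|f|²`, and taking square roots halves the power of the logarithm. Disjointness
of the caps enters only through the separation `|cᵢ - cⱼ| ≥ δ` of the centres, which also makes the
family finite.

Each `Tⱼ` is cut into pieces `Tⱼₖ` living at frequency `|ξ| ~ Rₖ = R₀ 2ᵏ`. In `|∑ₖ Tⱼₖ f|²` the
products of `Tⱼₖ f` with much lower pieces have frequency comparable to `Rₖ`, so they are almost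
orthogonal in `L²` for different `k`, and the sum of the lower pieces is an average of `Tⱼ f`
itself. This lets `exists_scale_sum_estimate` replace the square function by `∑ₖ Uₖ`, where `Uₖ = ∑ⱼ
|Tⱼₖ f|²`.

The spectrum of `Uₖ` lies in `|ξ| ≤ 8 Rₖ`. It is split into the part `|ξ| ≲ δ Rₖ` and about `log
δ⁻¹` dyadic shells `|ξ| ~ s Rₖ`, `s = δ 2ˡ`. After summation over `k`, each of these contributes
`O(1)`, and the triangle inequality over the shells is the only loss (`exists_piece_estimate`).

For a shell, put `r = δ / s` and group the cones into caps of radius `r`. Two frequencies of one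
cone whose difference has size `s Rₖ` differ by a vector in a box of length `s Rₖ` along the axis of
the cap and width `δ Rₖ`. Boxes of different caps point in `r`-separated directions, so the shell
parts are almost orthogonal over caps and scales. Within one cap, `local_orthogonality` at the dual
box replaces the sum over the cones by an average of `|g|²`, with `g` the projection of `f` to the
cap at frequency `Rₖ`. The resulting sum of `‖g‖₄⁴` over caps and scales is bounded by interpolation
between `L²` and `L^∞` (`sum_lintegral_conv_pow_four_le`).

For the low part the box is a ball. Local orthogonality leaves averages at scale `(δ Rₖ)⁻¹` of the
Littlewood–Paley pieces of `f`; the averages are removed by the dual maximal inequality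
`l2_sum_wt_dil_lconv_le`, and `littlewoodPaley` finishes. Both tools are proved by expanding a
square, comparing kernels pair by pair, and cancelling one factor of a finite norm; Littlewood–Paley
theory comes from variances of the heat flow.

Fatou's lemma removes the truncation to finitely many scales, and density of Schwartz functions
gives the operators on `L⁴`. -/

noncomputable section

namespace ConeSquareFunction

set_option linter.unusedSectionVars false

/-! ### The `L²` norm, convolution of nonnegative functions and of Schwartz functions. -/

section LConvolution

variable {V : Type*} [NormedAddCommGroup V] [InnerProductSpace ℝ V] [FiniteDimensional ℝ V]
  [MeasurableSpace V] [BorelSpace V]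

/-- The `L²` norm of an extended nonnegative function. -/
def l2 (U : V → ℝ≥0∞) : ℝ≥0∞ := (∫⁻ x, U x ^ 2) ^ (1 / 2 : ℝ)

theorem l2_sq (U : V → ℝ≥0∞) : l2 U ^ 2 = ∫⁻ x, U x ^ 2 := by
  rw [l2, ← ENNReal.rpow_natCast, ← ENNReal.rpow_mul]
  norm_num

theorem l2_mono {U W : V → ℝ≥0∞} (h : ∀ x, U x ≤ W x) : l2 U ≤ l2 W := by
  unfold l2
  gcongr with x
  exact h x

theorem l2_eq_eLpNorm (U : V → ℝ≥0∞) : l2 U = eLpNorm U 2 volume := by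
  rw [eLpNorm_eq_lintegral_rpow_enorm_toReal (by norm_num) (by norm_num)]
  simp [l2]

theorem l2_const_mul (c : ℝ≥0∞) {U : V → ℝ≥0∞} (hU : Measurable U) :
    l2 (fun x => c * U x) = c * l2 U := by
  simp only [l2, mul_pow]
  rw [lintegral_const_mul _ (by fun_prop), ENNReal.mul_rpow_of_nonneg _ _ (by norm_num),
    ← ENNReal.rpow_natCast, ← ENNReal.rpow_mul]
  norm_num

theorem l2_add_le {U W : V → ℝ≥0∞} (hU : Measurable U) (hW : Measurable W) :
    l2 (fun x => U x + W x) ≤ l2 U + l2 W := by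
  simp only [l2_eq_eLpNorm]
  exact eLpNorm_add_le hU.aestronglyMeasurable hW.aestronglyMeasurable (by norm_num)

theorem l2_sum_le {ι : Type*} (s : Finset ι) {U : ι → V → ℝ≥0∞} (hU : ∀ i ∈ s, Measurable (U i)) :
    l2 (fun x => ∑ i ∈ s, U i x) ≤ ∑ i ∈ s, l2 (U i) := by
  have e : (fun x => ∑ i ∈ s, U i x) = ∑ i ∈ s, U i := by ext x; simp
  rw [e]
  simp only [l2_eq_eLpNorm]
  exact eLpNorm_sum_le (fun i hi => (hU i hi).aestronglyMeasurable) (by norm_num)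

theorem lintegral_mul_le_l2 {U W : V → ℝ≥0∞} (hU : Measurable U) (hW : Measurable W) :
    ∫⁻ x, U x * W x ≤ l2 U * l2 W := by
  have := ENNReal.lintegral_mul_le_Lp_mul_Lq (volume : Measure V) Real.HolderConjugate.two_two
    hU.aemeasurable hW.aemeasurable
  simpa [l2] using this

/-- Cauchy–Schwarz for the measure `U dμ`, obtained by splitting `U` into two square roots. -/
theorem lintegral_mul_sq_le {α : Type*} [MeasurableSpace α] (μ : Measure α) {U W : α → ℝ≥0∞}
    (hU : Measurable U) (hW : Measurable W) :
    (∫⁻ x, U x * W x ∂μ) ^ 2 ≤ (∫⁻ x, U x ∂μ) * ∫⁻ x, U x * W x ^ 2 ∂μ := by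
  have h := ENNReal.lintegral_mul_le_Lp_mul_Lq μ Real.HolderConjugate.two_two
    (f := fun x => U x ^ (1 / 2 : ℝ)) (g := fun x => U x ^ (1 / 2 : ℝ) * W x)
    (by fun_prop) (by fun_prop)
  have e : ∀ c : ℝ≥0∞, c ^ (1 / 2 : ℝ) * c ^ (1 / 2 : ℝ) = c := fun c => by
    rw [← ENNReal.rpow_add_of_nonneg _ _ (by norm_num) (by norm_num)]; norm_num
  have e2 : ∀ c : ℝ≥0∞, (c ^ (1 / 2 : ℝ)) ^ 2 = c := fun c => by rw [pow_two, e]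
  have e3 : ∀ c : ℝ≥0∞, (c ^ (1 / 2 : ℝ)) ^ (2 : ℝ) = c := fun c => by
    rw [ENNReal.rpow_two, e2]
  simp only [Pi.mul_apply, ← mul_assoc, e] at h
  calc _ ≤ _ := pow_le_pow_left' h 2
    _ = _ := by
      rw [mul_pow, e2, e2]
      simp only [ENNReal.mul_rpow_of_nonneg _ _ (show (0:ℝ) ≤ 2 by norm_num), e3, ENNReal.rpow_two]

theorem lconv_mono {w w' U U' : V → ℝ≥0∞} (hw : ∀ x, w x ≤ w' x) (hU : ∀ x, U x ≤ U' x) (x : V) :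
    (w ⋆ₗ U) x ≤ (w' ⋆ₗ U') x := by
  simp only [lconvolution_def]
  gcongr with y
  · exact hw y
  · exact hU _

theorem lconv_sum {ι : Type*} (s : Finset ι) {w : V → ℝ≥0∞} (hw : Measurable w)
    {U : ι → V → ℝ≥0∞} (hU : ∀ i ∈ s, Measurable (U i)) (x : V) :
    (w ⋆ₗ fun x => ∑ i ∈ s, U i x) x = ∑ i ∈ s, (w ⋆ₗ U i) x := by
  simp only [lconvolution_def, Finset.mul_sum]
  rw [lintegral_finsetSum' _ fun i hi => ?_]
  have := hU i hi
  fun_prop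

theorem lconv_const_mul (c : ℝ≥0∞) {w U : V → ℝ≥0∞} (hw : Measurable w) (hU : Measurable U) (x : V) :
    (w ⋆ₗ fun x => c * U x) x = c * (w ⋆ₗ U) x := by
  simp only [lconvolution_def]
  rw [← lintegral_const_mul _ (by fun_prop)]
  congr with y
  ring

theorem const_mul_lconv (c : ℝ≥0∞) {w U : V → ℝ≥0∞} (hw : Measurable w) (hU : Measurable U) (x : V) :
    ((fun x => c * w x) ⋆ₗ U) x = c * (w ⋆ₗ U) x := by
  simp only [lconvolution_def]
  rw [← lintegral_const_mul _ (by fun_prop)]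
  congr with y
  ring

theorem lintegral_lconv {w U : V → ℝ≥0∞} (hw : Measurable w) (hU : Measurable U) :
    ∫⁻ x, (w ⋆ₗ U) x = (∫⁻ x, w x) * ∫⁻ x, U x := by
  simp only [lconvolution_def]
  rw [lintegral_lintegral_swap (by fun_prop), ← lintegral_mul_const _ hw]
  congr with y
  rw [lintegral_const_mul _ (by fun_prop), lintegral_add_left_eq_self]

theorem lconv_sq_le {w U : V → ℝ≥0∞} (hw : Measurable w) (hU : Measurable U) (x : V) :
    (w ⋆ₗ U) x ^ 2 ≤ (∫⁻ y, w y) * (w ⋆ₗ fun x => U x ^ 2) x := by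
  simp only [lconvolution_def]
  exact lintegral_mul_sq_le _ hw (by fun_prop)

theorem l2_lconv_le {w U : V → ℝ≥0∞} (hw : Measurable w) (hU : Measurable U) :
    l2 (w ⋆ₗ U) ≤ (∫⁻ y, w y) * l2 U := by
  refine (ENNReal.pow_le_pow_left_iff (n := 2) (by norm_num)).1 ?_
  rw [l2_sq, mul_pow, l2_sq]
  calc _ ≤ ∫⁻ x, (∫⁻ y, w y) * (w ⋆ₗ fun x => U x ^ 2) x := lintegral_mono (lconv_sq_le hw hU)
    _ = _ := by
      rw [lintegral_const_mul _ (by fun_prop), lintegral_lconv hw (by fun_prop)]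
      ring

/-- Convolution with an even weight is self-adjoint; this moves an average from one factor of a
product to the other. -/
theorem lintegral_lconv_mul {w U W : V → ℝ≥0∞} (hw : Measurable w) (hU : Measurable U)
    (hW : Measurable W) (hev : ∀ x, w (-x) = w x) :
    ∫⁻ x, (w ⋆ₗ U) x * W x = ∫⁻ x, U x * (w ⋆ₗ W) x := by
  simp only [lconvolution_def]
  have h1 : ∀ x, (∫⁻ y, w y * U (-y + x)) * W x = ∫⁻ y, w (x - y) * U y * W x := fun x => by
    rw [← lintegral_mul_const _ (by fun_prop), ← lintegral_sub_left_eq_self _ x]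
    congr with y
    simp
  have h2 : ∀ y, U y * (∫⁻ x, w x * W (-x + y)) = ∫⁻ x, w (x - y) * U y * W x := fun y => by
    rw [← lintegral_const_mul _ (by fun_prop), ← lintegral_sub_left_eq_self _ y]
    congr with x
    rw [← hev (x - y)]
    simp
    ring
  simp only [h1, h2]
  rw [lintegral_lintegral_swap (by fun_prop)]

/-- If `X² ≤ X * Y` and `X` is finite, then `X ≤ Y`. -/
theorem le_of_sq_le_mul {X Y : ℝ≥0∞} (hX : X ≠ ⊤) (h : X ^ 2 ≤ X * Y) : X ≤ Y := by
  rcases eq_or_ne X 0 with h0 | h0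
  · simp [h0]
  rw [pow_two] at h
  exact (ENNReal.mul_le_mul_iff_right h0 hX).1 h

/-- Convolution of Schwartz functions. -/
def conv (K f : 𝓢(V, ℂ)) : 𝓢(V, ℂ) := SchwartzMap.convolution (ContinuousLinearMap.mul ℂ ℂ) K f

theorem fourier_conv (K f : 𝓢(V, ℂ)) (ξ : V) : 𝓕 (conv K f) ξ = 𝓕 K ξ * 𝓕 f ξ := by
  rw [conv, SchwartzMap.fourier_convolution]
  rfl

theorem conv_apply (K f : 𝓢(V, ℂ)) (x : V) : conv K f x = ∫ y, K y * f (x - y) := by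
  rw [conv, SchwartzMap.convolution_apply]
  rfl

/-- Identities between convolutions are checked on the Fourier side, where they become pointwise
algebra. -/
theorem ext_fourier {f g : 𝓢(V, ℂ)} (h : ∀ ξ, 𝓕 f ξ = 𝓕 g ξ) : f = g := by
  have : 𝓕 f = 𝓕 g := SchwartzMap.ext h
  have h2 : (𝓕⁻ (𝓕 f) : 𝓢(V, ℂ)) = 𝓕⁻ (𝓕 g) := by rw [this]
  simpa using h2

theorem conv_assoc (K M f : 𝓢(V, ℂ)) : conv (conv K M) f = conv K (conv M f) :=
  ext_fourier fun ξ => by simp only [fourier_conv]; ring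

theorem conv_left_comm (K M f : 𝓢(V, ℂ)) : conv K (conv M f) = conv M (conv K f) :=
  ext_fourier fun ξ => by simp only [fourier_conv]; ring

theorem measurable_enorm_schwartz (f : 𝓢(V, ℂ)) : Measurable fun x => ‖f x‖ₑ :=
  f.continuous.enorm.measurable

theorem enorm_conv_le (K f : 𝓢(V, ℂ)) (x : V) :
    ‖conv K f x‖ₑ ≤ ((fun x => ‖K x‖ₑ) ⋆ₗ fun x => ‖f x‖ₑ) x := by
  rw [conv_apply, lconvolution_def]
  refine (enorm_integral_le_lintegral_enorm _).trans (lintegral_mono fun y => ?_)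
  rw [enorm_mul, neg_add_eq_sub]

theorem enorm_conv_sq_le (K f : 𝓢(V, ℂ)) (x : V) :
    ‖conv K f x‖ₑ ^ 2 ≤ (∫⁻ y, ‖K y‖ₑ) * ((fun x => ‖K x‖ₑ) ⋆ₗ fun x => ‖f x‖ₑ ^ 2) x :=
  (pow_le_pow_left' (enorm_conv_le K f x) 2).trans
    (lconv_sq_le (measurable_enorm_schwartz K) (measurable_enorm_schwartz f) x)

theorem lintegral_enorm_schwartz_ne_top (f : 𝓢(V, ℂ)) : ∫⁻ y, ‖f y‖ₑ ≠ ⊤ :=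
  f.integrable.2.ne

/-- This finiteness is what permits cancelling a norm in `le_of_sq_le_mul`. -/
theorem l2_enorm_sq_schwartz_ne_top (f : 𝓢(V, ℂ)) : l2 (fun x => ‖f x‖ₑ ^ 2) ≠ ⊤ := by
  have h := (f.eLpNorm_lt_top 4 volume).ne
  rw [eLpNorm_eq_lintegral_rpow_enorm_toReal (by norm_num) (by norm_num)] at h
  rw [l2]
  simp only [← pow_mul]
  norm_num at h ⊢
  simpa using h

/-- Plancherel's theorem for Schwartz functions in terms of the Lebesgue integral. -/
theorem lintegral_enorm_fourier_sq (f : 𝓢(V, ℂ)) : ∫⁻ ξ, ‖𝓕 f ξ‖ₑ ^ 2 = ∫⁻ x, ‖f x‖ₑ ^ 2 := by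
  have h := f.integral_norm_sq_fourier
  have key : ∀ g : 𝓢(V, ℂ), ∫⁻ x, ‖g x‖ₑ ^ 2 = ENNReal.ofReal (∫ x, ‖g x‖ ^ 2) := fun g => by
    rw [ofReal_integral_eq_lintegral_ofReal]
    · congr with x
      rw [← ofReal_norm, ENNReal.ofReal_pow (norm_nonneg _)]
    · exact (memLp_two_iff_integrable_sq_norm g.continuous.aestronglyMeasurable).1 (g.memLp 2 volume)
    · exact Filter.Eventually.of_forall fun x => by positivity
  rw [key, key, h]

theorem lintegral_enorm_fourierInv_sq (f : 𝓢(V, ℂ)) :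
    ∫⁻ ξ, ‖𝓕⁻ f ξ‖ₑ ^ 2 = ∫⁻ x, ‖f x‖ₑ ^ 2 := by
  rw [← lintegral_enorm_fourier_sq (𝓕⁻ f), FourierTransform.fourier_fourierInv_eq]

/-- Plancherel comparison: a pointwise bound on Fourier transforms gives an `L²` bound. -/
theorem lintegral_sq_le_of_fourier {ι : Type*} (s : Finset ι) (u : 𝓢(V, ℂ)) (v : ι → 𝓢(V, ℂ))
    (C : ℝ≥0∞) (h : ∀ ξ, ‖𝓕 u ξ‖ₑ ^ 2 ≤ C * ∑ i ∈ s, ‖𝓕 (v i) ξ‖ₑ ^ 2) :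
    ∫⁻ x, ‖u x‖ₑ ^ 2 ≤ C * ∑ i ∈ s, ∫⁻ x, ‖v i x‖ₑ ^ 2 := by
  rw [← lintegral_enorm_fourier_sq]
  simp only [← fun i => lintegral_enorm_fourier_sq (v i)]
  rw [← lintegral_finsetSum' _ fun i _ => ((measurable_enorm_schwartz _).pow_const 2).aemeasurable,
    ← lintegral_const_mul _ (Finset.measurable_fun_sum _
      fun i _ => (measurable_enorm_schwartz _).pow_const 2)]
  exact lintegral_mono h

end LConvolution

/-! ### Polynomially decaying weights and the dual maximal inequality. -/

section Weights

variable {V : Type*} [NormedAddCommGroup V] [InnerProductSpace ℝ V] [FiniteDimensional ℝ V]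
  [MeasurableSpace V] [BorelSpace V]

/-- The polynomially decaying weight adapted to the linear equivalence `L`. -/
def wtReal (N : ℕ) (L : V ≃L[ℝ] V) (x : V) : ℝ :=
  |LinearMap.det (L : V →ₗ[ℝ] V)| * ((1 + ‖L x‖) ^ N)⁻¹

/-- The weight `wtReal` as an extended nonnegative function. -/
def wt (N : ℕ) (L : V ≃L[ℝ] V) (x : V) : ℝ≥0∞ := ENNReal.ofReal (wtReal N L x)

/-- The mass of the unit weight. -/
def wtMass (V : Type*) [NormedAddCommGroup V] [InnerProductSpace ℝ V] [FiniteDimensional ℝ V]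
    [MeasurableSpace V] [BorelSpace V] (N : ℕ) : ℝ≥0∞ :=
  ∫⁻ x : V, ENNReal.ofReal ((1 + ‖x‖) ^ N)⁻¹

theorem det_ne_zero (L : V ≃L[ℝ] V) : LinearMap.det (L : V →ₗ[ℝ] V) ≠ 0 :=
  L.toLinearEquiv.isUnit_det'.ne_zero

theorem wtReal_nonneg (N : ℕ) (L : V ≃L[ℝ] V) (x : V) : 0 ≤ wtReal N L x := by
  unfold wtReal; positivity

@[fun_prop]
theorem measurable_wt (N : ℕ) (L : V ≃L[ℝ] V) : Measurable (wt N L) := by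
  unfold wt wtReal
  have := L.continuous.measurable
  fun_prop

theorem wt_neg (N : ℕ) (L : V ≃L[ℝ] V) (x : V) : wt N L (-x) = wt N L x := by
  simp [wt, wtReal]

theorem lintegral_comp_equiv (L : V ≃L[ℝ] V) {g : V → ℝ≥0∞} (hg : Measurable g) :
    ENNReal.ofReal |LinearMap.det (L : V →ₗ[ℝ] V)| * ∫⁻ x, g (L x) = ∫⁻ x, g x := by
  have h := Measure.map_linearMap_addHaar_eq_smul_addHaar (volume : Measure V) (det_ne_zero L)
  have h2 : ∫⁻ x, g (L x) = ∫⁻ x, g x ∂(Measure.map (L : V →ₗ[ℝ] V) volume) :=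
    (lintegral_map hg L.continuous.measurable).symm
  rw [h2, h, lintegral_smul_measure, abs_inv, smul_eq_mul, ← mul_assoc,
    ← ENNReal.ofReal_mul (abs_nonneg _), mul_inv_cancel₀ (abs_ne_zero.2 (det_ne_zero L))]
  simp

theorem lintegral_wt (N : ℕ) (L : V ≃L[ℝ] V) : ∫⁻ x, wt N L x = wtMass V N := by
  unfold wt wtReal wtMass
  rw [← lintegral_comp_equiv L (g := fun x => ENNReal.ofReal ((1 + ‖x‖) ^ N)⁻¹) (by fun_prop)]
  simp only [ENNReal.ofReal_mul (abs_nonneg _)]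
  have := L.continuous.measurable
  rw [lintegral_const_mul _ (by fun_prop)]

theorem wtMass_ne_top {N : ℕ} (hN : Module.finrank ℝ V < N) : wtMass V N ≠ ⊤ := by
  have h := integrable_one_add_norm (E := V) (μ := volume) (r := N) (by exact_mod_cast hN)
  have h2 := h.lintegral_lt_top.ne
  unfold wtMass
  convert h2 using 4 with x
  rw [Real.rpow_neg (by positivity), Real.rpow_natCast]

/-- Peetre's inequality for the weights. -/
theorem wtReal_sub_le (N : ℕ) (L : V ≃L[ℝ] V) (x y : V) :
    wtReal N L (x - y) ≤ (1 + ‖L y‖) ^ N * wtReal N L x := by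
  have h1 : 1 + ‖L x‖ ≤ (1 + ‖L y‖) * (1 + ‖L (x - y)‖) := by
    have : ‖L x‖ ≤ ‖L (x - y)‖ + ‖L y‖ := by
      rw [map_sub]; simpa using norm_add_le (L x - L y) (L y)
    nlinarith [norm_nonneg (L y), norm_nonneg (L (x - y)), mul_nonneg (norm_nonneg (L y)) (norm_nonneg (L (x - y)))]
  have h2 : (1 + ‖L x‖) ^ N ≤ (1 + ‖L y‖) ^ N * (1 + ‖L (x - y)‖) ^ N := by
    rw [← mul_pow]; gcongr
  unfold wtReal
  rw [mul_left_comm]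
  gcongr
  rw [inv_le_iff_one_le_mul₀ (by positivity)]
  have h3 : 0 < (1 + ‖L x‖) ^ N := by positivity
  rw [mul_right_comm, ← div_eq_mul_inv, one_le_div h3]
  exact h2

/-- The isotropic dilation by `R`. -/
def dil (R : ℝ) (hR : R ≠ 0) : V ≃L[ℝ] V := ContinuousLinearEquiv.smulLeft (Units.mk0 R hR)

@[simp]
theorem dil_apply (R : ℝ) (hR : R ≠ 0) (x : V) : dil R hR x = R • x := rfl

theorem det_dil (R : ℝ) (hR : R ≠ 0) :
    LinearMap.det (dil R hR : V ≃L[ℝ] V).toLinearMap = R ^ Module.finrank ℝ V := by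
  have : (dil R hR : V ≃L[ℝ] V).toLinearMap = R • LinearMap.id := by ext; simp
  rw [this, LinearMap.det_smul]; simp

theorem wtReal_dil (N : ℕ) {R : ℝ} (hR : 0 < R) (x : V) :
    wtReal N (dil R hR.ne') x = R ^ Module.finrank ℝ V * ((1 + R * ‖x‖) ^ N)⁻¹ := by
  unfold wtReal
  rw [det_dil, abs_of_pos (by positivity)]
  simp [norm_smul, abs_of_pos hR]

/-- Either `|y| ≤ |x - y| + 1/R`, and then the first factor is `≲ w_R(x)`, or `|y|` is at least half
of `|x| + 1/R`, and then the second factor is: it is at most `R'^(d-N) |y|^(-N)`, which decreases in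
`R'` because `N ≥ d`. -/
theorem wtReal_dil_mul_le {N : ℕ} (hN : Module.finrank ℝ V ≤ N) {R R' : ℝ} (hR : 0 < R)
    (hRR : R ≤ R') (x y : V) :
    wtReal N (dil R hR.ne') (x - y) * wtReal N (dil R' (hR.trans_le hRR).ne') y ≤
      2 ^ N * wtReal N (dil R hR.ne') x *
        (wtReal N (dil R' (hR.trans_le hRR).ne') y + wtReal N (dil R hR.ne') (x - y)) := by
  have hR' := hR.trans_le hRR
  have key : wtReal N (dil R hR.ne') (x - y) ≤ 2 ^ N * wtReal N (dil R hR.ne') x ∨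
      wtReal N (dil R' hR'.ne') y ≤ 2 ^ N * wtReal N (dil R hR.ne') x := by
    rw [wtReal_dil N hR, wtReal_dil N hR, wtReal_dil N hR']
    have ht : R * ‖x‖ ≤ R * ‖x - y‖ + R * ‖y‖ := by
      rw [← mul_add]; gcongr; simpa using norm_add_le (x - y) y
    have px : 0 ≤ R * ‖x‖ := by positivity
    have pxy : 0 ≤ R * ‖x - y‖ := by positivity
    rcases le_total (R * ‖y‖) (1 + R * ‖x - y‖) with h | h
    · left
      rw [mul_left_comm]
      gcongr
      rw [← inv_inv (2 ^ N : ℝ), ← mul_inv]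
      apply inv_anti₀ (by positivity)
      rw [← inv_pow, ← mul_pow]
      apply pow_le_pow_left₀ (by positivity)
      linarith
    · right
      have hb : 0 < R * ‖y‖ := by linarith
      have hy : 0 < ‖y‖ := pos_of_mul_pos_right hb hR.le
      have h1 : R' ^ Module.finrank ℝ V * ((1 + R' * ‖y‖) ^ N)⁻¹ ≤
          R' ^ Module.finrank ℝ V * ((R' * ‖y‖) ^ N)⁻¹ := by
        gcongr; linarith
      have h2 : R' ^ Module.finrank ℝ V * ((R' * ‖y‖) ^ N)⁻¹ ≤
          R ^ Module.finrank ℝ V * ((R * ‖y‖) ^ N)⁻¹ := by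
        obtain ⟨d, hd⟩ := Nat.exists_eq_add_of_le hN
        have e : ∀ S : ℝ, 0 < S → S ^ Module.finrank ℝ V * ((S * ‖y‖) ^ N)⁻¹ =
            (S ^ d)⁻¹ * (‖y‖ ^ N)⁻¹ := fun S hS => by
          rw [mul_pow, hd, pow_add S]; field_simp
        rw [e _ hR', e _ hR]
        gcongr
      refine h1.trans (h2.trans ?_)
      rw [mul_left_comm]
      gcongr
      rw [← inv_inv (2 ^ N : ℝ), ← mul_inv]
      apply inv_anti₀ (by positivity)
      rw [← inv_pow, ← mul_pow]
      apply pow_le_pow_left₀ (by positivity)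
      linarith
  have p1 := wtReal_nonneg N (dil R hR.ne') (x - y)
  have p2 := wtReal_nonneg N (dil R' hR'.ne') y
  have p3 := wtReal_nonneg N (dil R hR.ne') x
  have p4 : 0 ≤ 2 ^ N * wtReal N (dil R hR.ne') x := by positivity
  rcases key with h | h
  · calc _ ≤ 2 ^ N * wtReal N (dil R hR.ne') x * wtReal N (dil R' hR'.ne') y := by gcongr
      _ ≤ _ := by gcongr; linarith
  · calc _ ≤ wtReal N (dil R hR.ne') (x - y) * (2 ^ N * wtReal N (dil R hR.ne') x) := by gcongr
      _ = (2 ^ N * wtReal N (dil R hR.ne') x) * wtReal N (dil R hR.ne') (x - y) := mul_comm _ _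
      _ ≤ _ := by gcongr; linarith

/-- An additional average at the finer scale `1/R'` does not spoil a weight at scale `1/R`:
integrate `wtReal_dil_mul_le` in `y`. -/
theorem wt_dil_lconv_le {N : ℕ} (hN : Module.finrank ℝ V ≤ N) {R R' : ℝ} (hR : 0 < R)
    (hR' : 0 < R') (hRR : R ≤ R') (x : V) :
    (wt N (dil R hR.ne') ⋆ₗ wt N (dil R' hR'.ne')) x ≤
      2 ^ (N + 1) * wtMass V N * wt N (dil R hR.ne') x := by
  rw [lconvolution_comm, lconvolution_def]
  calc _ ≤ ∫⁻ y, (2 ^ N * wt N (dil R hR.ne') x) *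
        (wt N (dil R' hR'.ne') y + wt N (dil R hR.ne') (x - y)) := by
        refine lintegral_mono fun y => ?_
        simp only [wt, neg_add_eq_sub]
        rw [← ENNReal.ofReal_mul (wtReal_nonneg _ _ _),
          ← ENNReal.ofReal_add (wtReal_nonneg _ _ _) (wtReal_nonneg _ _ _),
          show (2 : ℝ≥0∞) = ENNReal.ofReal 2 by simp, ← ENNReal.ofReal_pow (by norm_num),
          ← ENNReal.ofReal_mul (by positivity), ← ENNReal.ofReal_mul
            (mul_nonneg (by positivity) (wtReal_nonneg _ _ _)), mul_comm (wtReal _ _ y)]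
        exact ENNReal.ofReal_le_ofReal (wtReal_dil_mul_le hN hR hRR x y)
    _ = _ := by
      rw [lintegral_const_mul _ (by fun_prop), lintegral_add_left (by fun_prop),
        lintegral_sub_left_eq_self (wt N (dil R hR.ne')) x, lintegral_wt, lintegral_wt]
      ring

/-- The dual form of the `L²` bound for the Hardy–Littlewood maximal function: smoothing the
members of a family of nonnegative functions at arbitrary scales does not increase the `L²` norm of
their sum by more than a constant. -/
theorem l2_sum_wt_dil_lconv_le {N : ℕ} (hN : Module.finrank ℝ V < N) {ι : Type*} (s : Finset ι)
    {R : ι → ℝ} (hR : ∀ i, 0 < R i) {a : ι → V → ℝ≥0∞} (ha : ∀ i, Measurable (a i)) :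
    l2 (fun x => ∑ i ∈ s, (wt N (dil (R i) (hR i).ne') ⋆ₗ a i) x) ≤
      2 ^ (N + 2) * wtMass V N * l2 (fun x => ∑ i ∈ s, a i x) := by
  set w : ι → V → ℝ≥0∞ := fun i => wt N (dil (R i) (hR i).ne') with hw
  have hwm : ∀ i, Measurable (w i) := fun i => measurable_wt _ _
  set S : V → ℝ≥0∞ := fun x => ∑ i ∈ s, a i x with hS
  set X : V → ℝ≥0∞ := fun x => ∑ i ∈ s, (w i ⋆ₗ a i) x with hX
  have hSm : Measurable S := Finset.measurable_fun_sum _ fun i _ => ha i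
  have hXm : Measurable X := Finset.measurable_fun_sum _ fun i _ => measurable_lconvolution _ (hwm i) (ha i)
  set c : ℝ≥0∞ := 2 ^ (N + 1) * wtMass V N with hc
  have hM := wtMass_ne_top (V := V) hN
  have hMpos : wtMass V N ≠ 0 := by
    unfold wtMass
    rw [Ne, lintegral_eq_zero_iff (by fun_prop)]
    intro h
    obtain ⟨x, hx⟩ := h.exists
    simp only [Pi.zero_apply, ENNReal.ofReal_eq_zero] at hx
    have : 0 < ((1 + ‖x‖) ^ N)⁻¹ := by positivity
    linarith
  -- An infinite right side needs no proof; otherwise Young's inequality makes `l2 X` finite, as the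
  -- final cancellation requires.
  rcases eq_or_ne (l2 S) ⊤ with htop | htop
  · rw [htop, ENNReal.mul_top (by positivity)]
    exact le_top
  have hfin : l2 X ≠ ⊤ := by
    refine ne_top_of_le_ne_top ?_ (l2_sum_le s fun i _ => measurable_lconvolution _ (hwm i) (ha i))
    refine ENNReal.sum_ne_top.2 fun i hi => ?_
    refine ne_top_of_le_ne_top ?_ (l2_lconv_le (hwm i) (ha i))
    rw [lintegral_wt]
    refine ENNReal.mul_ne_top hM (ne_top_of_le_ne_top htop (l2_mono fun x => ?_))
    exact Finset.single_le_sum (f := fun i => a i x) (fun _ _ => zero_le) hi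
  -- The finer weight is absorbed by the coarser one: `w i ⋆ₗ w j ≲ w i`, so `w j` disappears.
  -- Summed over all pairs this gives `l2 X ^ 2 ≲ ∫ X S`, and Cauchy–Schwarz leaves a factor `l2 X`
  -- to cancel.
  have pair : ∀ i ∈ s, ∀ j ∈ s, R i ≤ R j →
      ∫⁻ x, (w i ⋆ₗ a i) x * (w j ⋆ₗ a j) x ≤ c * ∫⁻ x, (w i ⋆ₗ a i) x * a j x := by
    intro i _ j _ hij
    rw [lintegral_lconv_mul (hwm i) (ha i) (measurable_lconvolution _ (hwm j) (ha j)) (wt_neg _ _),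
      lconvolution_assoc (hwm i) (hwm j) (ha j),
      lintegral_lconv_mul (hwm i) (ha i) (ha j) (wt_neg _ _),
      ← lintegral_const_mul _ (by have := ha i; have := ha j; have := hwm i; fun_prop)]
    refine lintegral_mono fun x => ?_
    rw [mul_left_comm, ← const_mul_lconv _ (hwm i) (ha j)]
    gcongr
    exact lconv_mono (fun z => wt_dil_lconv_le hN.le (hR i) (hR j) hij z) (fun _ => le_rfl) x
  have hsq : l2 X ^ 2 ≤ l2 X * (2 * c * l2 S) := by
    have hme : ∀ i j, Measurable fun x => (w i ⋆ₗ a i) x * (w j ⋆ₗ a j) x := fun i j =>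
      (measurable_lconvolution _ (hwm i) (ha i)).mul (measurable_lconvolution _ (hwm j) (ha j))
    have hme' : ∀ i j, Measurable fun x => (w i ⋆ₗ a i) x * a j x := fun i j =>
      (measurable_lconvolution _ (hwm i) (ha i)).mul (ha j)
    have hxs : ∫⁻ x, X x * S x = ∑ i ∈ s, ∑ j ∈ s, ∫⁻ x, (w i ⋆ₗ a i) x * a j x := by
      simp only [hX, hS, Finset.sum_mul_sum]
      rw [lintegral_finsetSum _ fun i _ => Finset.measurable_fun_sum _ fun j _ => hme' i j]
      exact Finset.sum_congr rfl fun i _ => lintegral_finsetSum _ fun j _ => hme' i j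
    calc l2 X ^ 2 = ∑ i ∈ s, ∑ j ∈ s, ∫⁻ x, (w i ⋆ₗ a i) x * (w j ⋆ₗ a j) x := by
          rw [l2_sq]
          simp only [hX, pow_two, Finset.sum_mul_sum]
          rw [lintegral_finsetSum _ fun i _ => Finset.measurable_fun_sum _ fun j _ => hme i j]
          exact Finset.sum_congr rfl fun i _ => lintegral_finsetSum _ fun j _ => hme i j
      _ ≤ ∑ i ∈ s, ∑ j ∈ s, (c * (∫⁻ x, (w i ⋆ₗ a i) x * a j x) +
            c * ∫⁻ x, (w j ⋆ₗ a j) x * a i x) := by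
          refine Finset.sum_le_sum fun i hi => Finset.sum_le_sum fun j hj => ?_
          rcases le_total (R i) (R j) with h | h
          · exact (pair i hi j hj h).trans le_self_add
          · simp only [mul_comm ((w i ⋆ₗ a i) _) ((w j ⋆ₗ a j) _)]
            exact (pair j hj i hi h).trans le_add_self
      _ = 2 * c * ∫⁻ x, X x * S x := by
          simp only [Finset.sum_add_distrib]
          rw [Finset.sum_comm (f := fun i j => c * ∫⁻ x, (w j ⋆ₗ a j) x * a i x), hxs]
          simp only [← Finset.mul_sum]
          ring
      _ ≤ 2 * c * (l2 X * l2 S) := by gcongr; exact lintegral_mul_le_l2 hXm hSm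
      _ = _ := by ring
  refine (le_of_sq_le_mul hfin hsq).trans (le_of_eq ?_)
  rw [hc]; ring

end Weights

/-! ### Convolution kernels with linearly rescaled multipliers. -/

section DilatedKernels

variable {V : Type*} [NormedAddCommGroup V] [InnerProductSpace ℝ V] [FiniteDimensional ℝ V]
  [MeasurableSpace V] [BorelSpace V]

/-- `L` is self-adjoint. -/
def SelfAdj (L : V ≃L[ℝ] V) : Prop := ∀ x y, inner ℝ (L x) y = inner ℝ x (L y)

theorem selfAdj_dil {R : ℝ} (hR : R ≠ 0) : SelfAdj (dil R hR : V ≃L[ℝ] V) := fun x y => by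
  simp [inner_smul_left, inner_smul_right]

/-- The convolution kernel whose Fourier transform is `m ∘ L⁻¹`. -/
def dk (L : V ≃L[ℝ] V) (m : 𝓢(V, ℂ)) : 𝓢(V, ℂ) :=
  𝓕⁻ (SchwartzMap.compCLMOfContinuousLinearEquiv ℂ L.symm m)

theorem fourier_dk (L : V ≃L[ℝ] V) (m : 𝓢(V, ℂ)) (ξ : V) : 𝓕 (dk L m) ξ = m (L.symm ξ) := by
  rw [dk, FourierTransform.fourier_fourierInv_eq]
  simp

theorem integral_comp_equiv (L : V ≃L[ℝ] V) (g : V → ℂ) :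
    |LinearMap.det (L : V →ₗ[ℝ] V)| • ∫ x, g (L x) = ∫ x, g x := by
  have h := Measure.map_linearMap_addHaar_eq_smul_addHaar (volume : Measure V) (det_ne_zero L)
  have h2 : ∫ x, g (L x) = ∫ x, g x ∂(Measure.map (L : V →ₗ[ℝ] V) volume) :=
    ((L.toHomeomorph.measurableEmbedding).integral_map g).symm
  rw [h2, h, integral_smul_measure, abs_inv, smul_smul, ENNReal.toReal_ofReal (by positivity),
    mul_inv_cancel₀ (abs_ne_zero.2 (det_ne_zero L))]
  simp

/-- Self-adjointness lets the same map `L`, rather than its transpose, act on the space side. -/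
theorem dk_apply {L : V ≃L[ℝ] V} (hL : SelfAdj L) (m : 𝓢(V, ℂ)) (x : V) :
    dk L m x = |LinearMap.det (L : V →ₗ[ℝ] V)| • 𝓕⁻ m (L x) := by
  rw [dk, SchwartzMap.fourierInv_coe, SchwartzMap.fourierInv_coe, Real.fourierInv_eq,
    Real.fourierInv_eq, ← integral_comp_equiv L]
  congr 2 with v
  simp [hL v x]

theorem enorm_dk {L : V ≃L[ℝ] V} (hL : SelfAdj L) (m : 𝓢(V, ℂ)) (x : V) :
    ‖dk L m x‖ₑ = ENNReal.ofReal |LinearMap.det (L : V →ₗ[ℝ] V)| * ‖𝓕⁻ m (L x)‖ₑ := by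
  rw [dk_apply hL, enorm_smul, Real.enorm_eq_ofReal_abs, abs_abs]

theorem lintegral_enorm_dk {L : V ≃L[ℝ] V} (hL : SelfAdj L) (m : 𝓢(V, ℂ)) :
    ∫⁻ x, ‖dk L m x‖ₑ = ∫⁻ x, ‖𝓕⁻ m x‖ₑ := by
  simp only [enorm_dk hL]
  have h := measurable_enorm_schwartz (𝓕⁻ m)
  have h' : Measurable fun x => ‖𝓕⁻ m (L x)‖ₑ := h.comp L.continuous.measurable
  rw [lintegral_const_mul _ h']
  exact lintegral_comp_equiv L h

theorem exists_decay (f : 𝓢(V, ℂ)) (N : ℕ) : ∃ C : ℝ, 0 ≤ C ∧ ∀ x, ‖f x‖ ≤ C * ((1 + ‖x‖) ^ N)⁻¹ := by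
  have h := SchwartzMap.one_add_le_sup_seminorm_apply (𝕜 := ℝ) (m := (N, 0)) (k := N) (n := 0) le_rfl
    le_rfl f
  refine ⟨2 ^ N * ((Finset.Iic (N, 0)).sup fun m => SchwartzMap.seminorm ℝ m.1 m.2) f,
    by positivity, fun x => ?_⟩
  have := h x
  rw [norm_iteratedFDeriv_zero, mul_comm] at this
  rw [← div_eq_mul_inv, le_div_iff₀ (by positivity)]
  exact this

theorem enorm_dk_le (m : 𝓢(V, ℂ)) (N : ℕ) : ∃ C : ℝ≥0∞, C ≠ ⊤ ∧ ∀ L : V ≃L[ℝ] V, SelfAdj L →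
    ∀ x, ‖dk L m x‖ₑ ≤ C * wt N L x := by
  obtain ⟨C, hC, h⟩ := exists_decay (𝓕⁻ m) N
  refine ⟨ENNReal.ofReal C, ENNReal.ofReal_ne_top, fun L hL x => ?_⟩
  rw [dk_apply hL, wt, ← ENNReal.ofReal_mul hC, ← ofReal_norm, wtReal, norm_smul, Real.norm_eq_abs,
    abs_abs]
  apply ENNReal.ofReal_le_ofReal
  rw [mul_left_comm]
  gcongr
  exact h _

end DilatedKernels

/-! ### The heat kernel and its semigroup law. -/

section Gaussian

variable {V : Type*} [NormedAddCommGroup V] [InnerProductSpace ℝ V] [FiniteDimensional ℝ V]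
  [MeasurableSpace V] [BorelSpace V]

theorem one_add_pow_mul_exp_bounded {t : ℝ} (ht : 0 < t) (m : ℕ) :
    ∃ C : ℝ, ∀ u : ℝ, 0 ≤ u → (1 + u) ^ m * Real.exp (-t * u ^ 2) ≤ C := by
  refine ⟨2 ^ m * (1 + m.factorial / t ^ m), fun u hu => ?_⟩
  have h1 : (1 + u) ^ m ≤ 2 ^ m * (1 + (u ^ 2) ^ m) := by
    rcases le_total u 1 with h | h
    · calc (1 + u) ^ m ≤ 2 ^ m := by gcongr; linarith
        _ ≤ _ := by nlinarith [show (0:ℝ) ≤ 2 ^ m * (u ^ 2) ^ m by positivity]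
    · calc (1 + u) ^ m ≤ (2 * u ^ 2) ^ m := by gcongr; nlinarith
        _ ≤ _ := by rw [mul_pow]; gcongr; linarith
  have h2 := Real.pow_div_factorial_le_exp (t * u ^ 2) (by positivity) m
  have h3 : (u ^ 2) ^ m * Real.exp (-t * u ^ 2) ≤ m.factorial / t ^ m := by
    rw [neg_mul, Real.exp_neg, ← div_eq_mul_inv, div_le_div_iff₀ (Real.exp_pos _) (by positivity),
      ← mul_pow, mul_comm (u ^ 2)]
    rw [div_le_iff₀ (by positivity)] at h2
    linarith
  have h4 : Real.exp (-t * u ^ 2) ≤ 1 := Real.exp_le_one_iff.2 (by nlinarith [sq_nonneg u])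
  calc _ ≤ 2 ^ m * (1 + (u ^ 2) ^ m) * Real.exp (-t * u ^ 2) := by gcongr
    _ = 2 ^ m * (Real.exp (-t * u ^ 2) + (u ^ 2) ^ m * Real.exp (-t * u ^ 2)) := by ring
    _ ≤ _ := by gcongr

/-- The Gaussian `exp (-t ‖x‖²)` as a Schwartz function. -/
def gaussian (V : Type*) [NormedAddCommGroup V] [InnerProductSpace ℝ V] (t : ℝ) (ht : 0 < t) :
    𝓢(V, ℂ) where
  toFun x := (Real.exp (-t * ‖x‖ ^ 2) : ℝ)
  smooth' := by
    have : ContDiff ℝ ∞ fun x : V => Real.exp (-t * ‖x‖ ^ 2) :=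
      (contDiff_const.mul (contDiff_norm_sq ℝ)).exp
    exact Complex.ofRealCLM.contDiff.comp this
  decay' k n := by
    have hq : (fun x : V => -t * ‖x‖ ^ 2).HasTemperateGrowth := by fun_prop
    obtain ⟨a, C, hC0, hC⟩ := hq.norm_iteratedFDeriv_le_uniform n
    obtain ⟨B, hB⟩ := one_add_pow_mul_exp_bounded ht (k + a * n)
    refine ⟨n.factorial * (1 + C) ^ n * B, fun x => ?_⟩
    have h1 : ‖iteratedFDeriv ℝ n (Real.exp ∘ fun x : V => -t * ‖x‖ ^ 2) x‖ ≤
        n.factorial * Real.exp (-t * ‖x‖ ^ 2) * ((1 + C) * (1 + ‖x‖) ^ a) ^ n := by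
      refine norm_iteratedFDeriv_comp_le (N := ∞) Real.contDiff_exp (contDiff_const.mul (contDiff_norm_sq ℝ))
        (by exact_mod_cast le_top) x (fun i _ => ?_) fun i hi hin => ?_
      · rw [norm_iteratedFDeriv_eq_norm_iteratedDeriv, iteratedDeriv_eq_iterate, Real.iter_deriv_exp,
          Real.norm_eq_abs, Real.abs_exp]
      · have h1 : (1 : ℝ) ≤ (1 + C) * (1 + ‖x‖) ^ a := by
          have : (1 : ℝ) ≤ (1 + ‖x‖) ^ a := one_le_pow₀ (by linarith [norm_nonneg x])
          nlinarith
        refine (hC i hin x).trans (le_trans ?_ (le_self_pow₀ h1 (by omega)))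
        gcongr; linarith
    have h2 : ‖iteratedFDeriv ℝ n (fun x : V => ((Real.exp (-t * ‖x‖ ^ 2) : ℝ) : ℂ)) x‖ =
        ‖iteratedFDeriv ℝ n (Real.exp ∘ fun x : V => -t * ‖x‖ ^ 2) x‖ :=
      Complex.ofRealLI.norm_iteratedFDeriv_comp_left (f := fun x : V => Real.exp (-t * ‖x‖ ^ 2))
        (n := ∞) (contDiff_const.mul (contDiff_norm_sq ℝ)).exp.contDiffAt (by exact_mod_cast le_top)
    rw [h2]
    calc _ ≤ (1 + ‖x‖) ^ k * (n.factorial * Real.exp (-t * ‖x‖ ^ 2) * ((1 + C) * (1 + ‖x‖) ^ a) ^ n) := by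
          gcongr; linarith [norm_nonneg x]
      _ = n.factorial * (1 + C) ^ n * ((1 + ‖x‖) ^ (k + a * n) * Real.exp (-t * ‖x‖ ^ 2)) := by
          rw [pow_add, pow_mul, mul_pow]; ring
      _ ≤ _ := by
          gcongr
          exact hB _ (norm_nonneg x)

theorem gaussian_apply {t : ℝ} (ht : 0 < t) (x : V) :
    gaussian V t ht x = (Real.exp (-t * ‖x‖ ^ 2) : ℝ) := rfl

/-- The heat kernel: the Fourier transform of `heat t` is `exp (-t ‖ξ‖²)`. -/
def heat (V : Type*) [NormedAddCommGroup V] [InnerProductSpace ℝ V] [FiniteDimensional ℝ V]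
    [MeasurableSpace V] [BorelSpace V] (t : ℝ) (ht : 0 < t) : 𝓢(V, ℂ) :=
  𝓕⁻ (gaussian V t ht)

/-- The explicit form of the heat kernel. -/
def heatReal (t : ℝ) (x : V) : ℝ :=
  (Real.pi / t) ^ (Module.finrank ℝ V / 2 : ℝ) * Real.exp (-(Real.pi ^ 2 * ‖x‖ ^ 2 / t))

/-- The heat kernel as an extended nonnegative function. -/
def heatE (t : ℝ) (x : V) : ℝ≥0∞ := ENNReal.ofReal (heatReal t x)

theorem fourier_heat {t : ℝ} (ht : 0 < t) (ξ : V) :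
    𝓕 (heat V t ht) ξ = (Real.exp (-t * ‖ξ‖ ^ 2) : ℝ) := by
  rw [heat, FourierTransform.fourier_fourierInv_eq, gaussian_apply]

theorem heat_apply {t : ℝ} (ht : 0 < t) (x : V) : heat V t ht x = (heatReal t x : ℝ) := by
  rw [heat, SchwartzMap.fourierInv_coe, Real.fourierInv_eq_fourier_neg]
  have h := fourier_gaussian_innerProductSpace (V := V) (b := (t : ℂ)) (by simpa using ht) (-x)
  have e : (gaussian V t ht : V → ℂ) = fun v => Complex.exp (-(t : ℂ) * (‖v‖ : ℂ) ^ 2) := by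
    ext v; simp [gaussian_apply]
  rw [e, h, heatReal]
  push_cast
  rw [Complex.ofReal_cpow (by positivity)]
  push_cast
  rw [norm_neg]
  ring_nf

theorem heatReal_nonneg {t : ℝ} (ht : 0 < t) (x : V) : 0 ≤ heatReal t x := by
  unfold heatReal; positivity

theorem enorm_heat {t : ℝ} (ht : 0 < t) (x : V) : ‖heat V t ht x‖ₑ = heatE t x := by
  rw [heat_apply, ← ofReal_norm, Complex.norm_real, Real.norm_of_nonneg (heatReal_nonneg ht x), heatE]

@[fun_prop]
theorem continuous_heatReal (t : ℝ) : Continuous (heatReal t : V → ℝ) := by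
  unfold heatReal
  fun_prop

@[fun_prop]
theorem measurable_heatE (t : ℝ) : Measurable (heatE t : V → ℝ≥0∞) := by
  unfold heatE
  fun_prop

theorem heatE_neg (t : ℝ) (x : V) : heatE t (-x) = heatE t x := by simp [heatE, heatReal]

theorem integrable_heatReal {t : ℝ} (ht : 0 < t) : Integrable (heatReal t : V → ℝ) := by
  have h := (heat V t ht).integrable (μ := volume)
  have e : (heat V t ht : V → ℂ) = fun x => ((heatReal t x : ℝ) : ℂ) := by ext x; exact heat_apply ht x
  rw [e] at h
  simpa using h.re

theorem integral_heatReal {t : ℝ} (ht : 0 < t) : ∫ x : V, heatReal t x = 1 := by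
  have h := fourier_heat ht (0 : V)
  rw [SchwartzMap.fourier_coe, Real.fourier_eq] at h
  simp only [inner_zero_right, neg_zero, AddChar.map_zero_eq_one, one_smul, heat_apply] at h
  rw [integral_complex_ofReal] at h
  simpa using h

theorem lintegral_heatE {t : ℝ} (ht : 0 < t) : ∫⁻ x : V, heatE t x = 1 := by
  unfold heatE
  rw [← ofReal_integral_eq_lintegral_ofReal (integrable_heatReal ht)
    (Filter.Eventually.of_forall (heatReal_nonneg ht)), integral_heatReal ht]
  simp

theorem conv_heat_heat {s t : ℝ} (hs : 0 < s) (ht : 0 < t) :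
    conv (heat V s hs) (heat V t ht) = heat V (s + t) (add_pos hs ht) :=
  ext_fourier fun ξ => by
    rw [fourier_conv, fourier_heat, fourier_heat, fourier_heat, ← Complex.ofReal_mul, ← Real.exp_add]
    ring_nf

/-- Exponentials multiply on the Fourier side; positivity of the kernels transfers the complex
identity to the Lebesgue integral. -/
theorem heatE_lconv_heatE {s t : ℝ} (hs : 0 < s) (ht : 0 < t) :
    (heatE s ⋆ₗ heatE t : V → ℝ≥0∞) = heatE (s + t) := by
  ext x
  have h := congrArg (fun f : 𝓢(V, ℂ) => f x) (conv_heat_heat (V := V) hs ht)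
  simp only [conv_apply, heat_apply, ← Complex.ofReal_mul] at h
  rw [integral_complex_ofReal, Complex.ofReal_inj] at h
  rw [lconvolution_def, heatE, ← h, ofReal_integral_eq_lintegral_ofReal]
  · congr with y
    rw [ENNReal.ofReal_mul (heatReal_nonneg hs y), heatE, heatE, neg_add_eq_sub]
  · refine (integrable_heatReal hs).mul_bdd (c := (Real.pi / t) ^ (Module.finrank ℝ V / 2 : ℝ))
      (by fun_prop) (Filter.Eventually.of_forall fun y => ?_)
    rw [Real.norm_of_nonneg (heatReal_nonneg ht _), heatReal]
    refine mul_le_of_le_one_right (by positivity) (Real.exp_le_one_iff.2 ?_)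
    have : 0 ≤ Real.pi ^ 2 * ‖x - y‖ ^ 2 / t := by positivity
    linarith
  · exact Filter.Eventually.of_forall fun y => mul_nonneg (heatReal_nonneg hs _) (heatReal_nonneg ht _)

/-- Passing to a larger time only increases the exponential and costs at most `(t/s)^(d/2)` in the
normalization. -/
theorem heatReal_le {s t : ℝ} (hs : 0 < s) (hst : s ≤ t) {c : ℝ} (hc : t ≤ c * s) (x : V) :
    heatReal s x ≤ c ^ (Module.finrank ℝ V / 2 : ℝ) * heatReal t x := by
  have ht : 0 < t := hs.trans_le hst
  have hc0 : 0 < c := by nlinarith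
  unfold heatReal
  rw [← mul_assoc, ← Real.mul_rpow hc0.le (by positivity)]
  gcongr
  rw [← mul_div_assoc, div_le_div_iff₀ hs ht]
  nlinarith [Real.pi_pos]

theorem heatE_le {s t : ℝ} (hs : 0 < s) (hst : s ≤ t) {c : ℝ} (hc : t ≤ c * s) (x : V) :
    heatE s x ≤ ENNReal.ofReal (c ^ (Module.finrank ℝ V / 2 : ℝ)) * heatE t x := by
  have hc0 : 0 < c := by nlinarith
  rw [heatE, heatE, ← ENNReal.ofReal_mul (by positivity)]
  exact ENNReal.ofReal_le_ofReal (heatReal_le hs hst hc x)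

/-- Dilates of a fixed heat kernel are dominated by the isotropic weights. -/
theorem heatE_le_wt {a : ℝ} (ha : 0 < a) (N : ℕ) : ∃ C : ℝ≥0∞, C ≠ ⊤ ∧ ∀ R : ℝ, ∀ hR : 0 < R,
    ∀ x : V, heatE (a / R ^ 2) x ≤ C * wt N (dil R hR.ne') x := by
  obtain ⟨C, hC, h⟩ := enorm_dk_le (gaussian V a ha) N
  refine ⟨C, hC, fun R hR x => ?_⟩
  have e : dk (dil R hR.ne') (gaussian V a ha) = heat V (a / R ^ 2) (by positivity) := by
    refine ext_fourier fun ξ => ?_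
    have hs : (dil R hR.ne' : V ≃L[ℝ] V).symm ξ = R⁻¹ • ξ := by
      rw [ContinuousLinearEquiv.symm_apply_eq]; simp [hR.ne']
    rw [fourier_dk, fourier_heat, hs, gaussian_apply, norm_smul, Real.norm_of_nonneg (by positivity)]
    congr 2
    field_simp
  rw [← enorm_heat (by positivity), ← e]
  exact h _ (selfAdj_dil _) x

end Gaussian

/-! ### The energy estimate for the heat semigroup. -/

section LittlewoodPaley

variable {V : Type*} [NormedAddCommGroup V] [InnerProductSpace ℝ V] [FiniteDimensional ℝ V]
  [MeasurableSpace V] [BorelSpace V]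

/-- The variance of `u` with respect to the heat kernel centred at `x`. -/
def hvar {t : ℝ} (ht : 0 < t) (u : 𝓢(V, ℂ)) (x : V) : ℝ≥0∞ :=
  ∫⁻ y, heatE t y * ‖u (x - y) - conv (heat V t ht) u x‖ₑ ^ 2

theorem measurable_hvar {t : ℝ} (ht : 0 < t) (u : 𝓢(V, ℂ)) : Measurable (hvar ht u) := by
  unfold hvar
  have h1 : Measurable fun p : V × V => ‖u (p.1 - p.2) - conv (heat V t ht) u p.1‖ₑ :=
    (Continuous.enorm (by have := u.continuous; have := (conv (heat V t ht) u).continuous; fun_prop)).measurable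
  apply Measurable.lintegral_prod_right'
    (f := fun p : V × V => heatE t p.2 * ‖u (p.1 - p.2) - conv (heat V t ht) u p.1‖ₑ ^ 2)
  fun_prop

theorem integrable_heatReal_mul {t : ℝ} (ht : 0 < t) {g : V → ℝ} (hg : Continuous g) {C : ℝ}
    (hC : ∀ y, ‖g y‖ ≤ C) : Integrable fun y => heatReal t y * g y :=
  (integrable_heatReal ht).mul_bdd (c := C) hg.aestronglyMeasurable
    (Filter.Eventually.of_forall hC)

theorem ofReal_integral_heatReal_mul {t : ℝ} (ht : 0 < t) {g : V → ℂ} (hg : Continuous g) {C : ℝ}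
    (hC : ∀ y, ‖g y‖ ≤ C) :
    ENNReal.ofReal (∫ y, heatReal t y * ‖g y‖ ^ 2) = ∫⁻ y, heatE t y * ‖g y‖ₑ ^ 2 := by
  rw [ofReal_integral_eq_lintegral_ofReal]
  · congr with y
    rw [ENNReal.ofReal_mul (heatReal_nonneg ht y), ENNReal.ofReal_pow (norm_nonneg _), ofReal_norm,
      heatE]
  · refine integrable_heatReal_mul ht (by fun_prop) (C := C ^ 2) fun y => ?_
    rw [Real.norm_of_nonneg (by positivity)]
    have := hC y
    gcongr
  · exact Filter.Eventually.of_forall fun y => mul_nonneg (heatReal_nonneg ht y) (by positivity)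

/-- The identity "variance plus square of the mean equals mean of the square" for the probability
density `heatE t`. It is what telescopes in `l2_sum_heat_hvar_le`. -/
theorem hvar_add {t : ℝ} (ht : 0 < t) (u : 𝓢(V, ℂ)) (x : V) :
    hvar ht u x + ‖conv (heat V t ht) u x‖ₑ ^ 2 = (heatE t ⋆ₗ fun y => ‖u y‖ₑ ^ 2) x := by
  obtain ⟨B, _, hB⟩ := exists_decay u 0
  simp only [pow_zero, inv_one, mul_one] at hB
  have hu := u.continuous
  set c : ℂ := conv (heat V t ht) u x with hc
  have hc' : c = ∫ y, heatReal t y • u (x - y) := by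
    rw [hc, conv_apply]; simp [heat_apply]
  have hi : Integrable fun y => heatReal t y • u (x - y) := by
    have := (heat V t ht).integrable.mul_bdd (μ := volume) (c := B) (g := fun y => u (x - y))
      (by fun_prop) (Filter.Eventually.of_forall fun y => hB _)
    simpa [heat_apply] using this
  have hInt : Integrable fun y => heatReal t y * inner ℝ c (u (x - y)) := by
    refine integrable_heatReal_mul ht (by fun_prop) (C := ‖c‖ * B) fun y => ?_
    refine (norm_inner_le_norm _ _).trans ?_
    gcongr
    exact hB _
  have hinner : ∫ y, heatReal t y * inner ℝ c (u (x - y)) = ‖c‖ ^ 2 := by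
    have := integral_inner (𝕜 := ℝ) hi c
    rw [← hc', real_inner_self_eq_norm_sq] at this
    rw [← this]
    congr with y
    rw [inner_smul_right]
  have i1 : Integrable fun y => heatReal t y * ‖u (x - y)‖ ^ 2 := by
    refine integrable_heatReal_mul ht (by fun_prop) (C := B ^ 2) fun y => ?_
    rw [Real.norm_of_nonneg (by positivity)]
    have := hB (x - y)
    gcongr
  have real : (∫ y, heatReal t y * ‖u (x - y) - c‖ ^ 2) + ‖c‖ ^ 2 =
      ∫ y, heatReal t y * ‖u (x - y)‖ ^ 2 := by
    have e : ∀ y, heatReal t y * ‖u (x - y) - c‖ ^ 2 = heatReal t y * ‖u (x - y)‖ ^ 2 -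
        2 * (heatReal t y * inner ℝ c (u (x - y))) + heatReal t y * ‖c‖ ^ 2 := fun y => by
      rw [norm_sub_sq_real, real_inner_comm]; ring
    simp only [e]
    have i2 : Integrable (fun y => heatReal t y * ‖u (x - y)‖ ^ 2 -
        2 * (heatReal t y * inner ℝ c (u (x - y)))) volume := i1.sub (hInt.const_mul 2)
    rw [integral_add i2 ((integrable_heatReal ht).mul_const _),
      integral_sub i1 (hInt.const_mul 2), integral_const_mul, integral_mul_const, hinner,
      integral_heatReal ht]
    ring
  unfold hvar
  rw [← hc, lconvolution_def, ← ofReal_integral_heatReal_mul ht (C := B + ‖c‖) (by fun_prop)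
    (fun y => (norm_sub_le _ _).trans (add_le_add_left (hB _) _))]
  simp only [neg_add_eq_sub]
  rw [← ofReal_integral_heatReal_mul ht (C := B) (by fun_prop) (fun y => hB _), ← real,
    ENNReal.ofReal_add (integral_nonneg fun y => mul_nonneg (heatReal_nonneg ht y) (by positivity))
      (by positivity), ENNReal.ofReal_pow (norm_nonneg _), ofReal_norm]

theorem hvar_le {t : ℝ} (ht : 0 < t) (u : 𝓢(V, ℂ)) (x : V) :
    hvar ht u x ≤ (heatE t ⋆ₗ fun y => ‖u y‖ₑ ^ 2) x := by
  rw [← hvar_add ht]; exact le_self_add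

theorem enorm_conv_heat_sq_le {t : ℝ} (ht : 0 < t) (u : 𝓢(V, ℂ)) (x : V) :
    ‖conv (heat V t ht) u x‖ₑ ^ 2 ≤ (heatE t ⋆ₗ fun y => ‖u y‖ₑ ^ 2) x := by
  rw [← hvar_add ht]; exact le_add_self

/-- A mean-zero kernel dominated by the heat kernel is controlled by the variance. -/
theorem enorm_conv_sq_le_hvar {t : ℝ} (ht : 0 < t) (K u : 𝓢(V, ℂ)) (hK : 𝓕 K 0 = 0) {C : ℝ≥0∞}
    (hC : ∀ y, ‖K y‖ₑ ≤ C * heatE t y) (x : V) :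
    ‖conv K u x‖ₑ ^ 2 ≤ (∫⁻ y, ‖K y‖ₑ) * (C * hvar ht u x) := by
  obtain ⟨B, _, hB⟩ := exists_decay u 0
  simp only [pow_zero, inv_one, mul_one] at hB
  have hu := u.continuous
  set c : ℂ := conv (heat V t ht) u x with hc
  have hK0 : ∫ y, K y = 0 := by
    rw [SchwartzMap.fourier_coe, Real.fourier_eq] at hK
    simpa using hK
  have hi : Integrable fun y => K y * u (x - y) :=
    K.integrable.mul_bdd (c := B) (by fun_prop) (Filter.Eventually.of_forall fun y => hB _)
  -- As `K` has mean zero, `u` may be replaced by its deviation from the heat average `c`.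
  have e : conv K u x = ∫ y, K y * (u (x - y) - c) := by
    simp only [mul_sub]
    rw [integral_sub hi (K.integrable.mul_const c), integral_mul_const, hK0, conv_apply]
    simp
  have hm : Measurable fun y => ‖u (x - y) - c‖ₑ := (Continuous.enorm (by fun_prop)).measurable
  calc ‖conv K u x‖ₑ ^ 2 ≤ (∫⁻ y, ‖K y‖ₑ * ‖u (x - y) - c‖ₑ) ^ 2 := by
        rw [e]
        gcongr
        refine (enorm_integral_le_lintegral_enorm _).trans (lintegral_mono fun y => ?_)
        rw [enorm_mul]
    _ ≤ (∫⁻ y, ‖K y‖ₑ) * ∫⁻ y, ‖K y‖ₑ * ‖u (x - y) - c‖ₑ ^ 2 :=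
        lintegral_mul_sq_le _ (measurable_enorm_schwartz K) hm
    _ ≤ (∫⁻ y, ‖K y‖ₑ) * ∫⁻ y, C * (heatE t y * ‖u (x - y) - c‖ₑ ^ 2) := by
        refine mul_le_mul' le_rfl (lintegral_mono fun y => ?_)
        rw [← mul_assoc]
        exact mul_le_mul' (hC y) le_rfl
    _ = _ := by
        rw [lintegral_const_mul _ (by fun_prop)]
        rfl

theorem sum_sum_le_two_mul {M : ℕ} (b : ℕ → ℕ → ℝ≥0∞) (hb : ∀ k i, b k i = b i k) :
    ∑ k ∈ Finset.range M, ∑ i ∈ Finset.range M, b k i ≤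
      2 * ∑ k ∈ Finset.range M, ∑ i ∈ Finset.Ico k M, b k i := by
  have h1 : ∀ k ∈ Finset.range M, ∑ i ∈ Finset.Ico k M, b k i =
      ∑ i ∈ Finset.range M, if k ≤ i then b k i else 0 := fun k _ => by
    rw [← Finset.sum_filter]
    congr 1
    ext i; simp; tauto
  rw [Finset.sum_congr rfl h1, two_mul]
  nth_rewrite 2 [Finset.sum_comm]
  simp only [← Finset.sum_add_distrib]
  refine Finset.sum_le_sum fun k _ => Finset.sum_le_sum fun i _ => ?_
  rcases le_total k i with h | h
  · simp [h]
  · simp [h, hb k i]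

/-- Energy estimate for the heat semigroup: the variances at the dyadic scales are jointly
controlled by `|f|²`. -/
theorem l2_sum_heat_hvar_le : ∃ C : ℝ≥0∞, C ≠ ⊤ ∧ ∀ (R₀ : ℝ), 0 < R₀ → ∀ (t : ℕ → ℝ)
    (ht : ∀ k, 0 < t k), (∀ k, t k = 1 / (R₀ * 2 ^ k) ^ 2) → ∀ (M : ℕ) (f : 𝓢(V, ℂ)),
    l2 (fun x => ∑ k ∈ Finset.range M, (heatE (t k) ⋆ₗ
      hvar (mul_pos three_pos (ht k)) (conv (heat V (t k) (ht k)) f)) x) ≤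
      C * l2 (fun x => ‖f x‖ₑ ^ 2) := by
  set N := Module.finrank ℝ V + 1 with hN
  obtain ⟨C₅, hC₅, h5⟩ := heatE_le_wt (V := V) (show (0 : ℝ) < 5 by norm_num) N
  set c : ℝ≥0∞ := ENNReal.ofReal ((6 : ℝ) ^ (Module.finrank ℝ V / 2 : ℝ)) with hc
  refine ⟨2 * c * (C₅ * (2 ^ (N + 2) * wtMass V N)), ?_, ?_⟩
  · have := wtMass_ne_top (V := V) (N := N) (by omega)
    finiteness
  intro R₀ hR₀ t ht htR M f
  have ht4 : ∀ k, 4 * t (k + 1) = t k := fun k => by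
    rw [htR, htR]; field_simp; ring
  have tmono : ∀ k i, k ≤ i → t i ≤ t k := fun k i h => by
    induction h with
    | refl => exact le_rfl
    | step _ ih => exact le_trans (by linarith [ht4 ‹_›, ht (‹ℕ› + 1)]) ih
  set u : ℕ → 𝓢(V, ℂ) := fun k => conv (heat V (t k) (ht k)) f with hu
  set W : ℕ → V → ℝ≥0∞ := fun k => hvar (mul_pos three_pos (ht k)) (u k) with hW
  have hWm : ∀ k, Measurable (W k) := fun k => measurable_hvar _ _
  set E : ℕ → V → ℝ≥0∞ := fun k => heatE (t k) ⋆ₗ W k with hE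
  have hEm : ∀ k, Measurable (E k) := fun k => measurable_lconvolution _ (measurable_heatE _) (hWm k)
  set F : V → ℝ≥0∞ := fun x => ‖f x‖ₑ ^ 2 with hF
  have hFm : Measurable F := (measurable_enorm_schwartz f).pow_const 2
  set X : V → ℝ≥0∞ := fun x => ∑ k ∈ Finset.range M, E k x with hX
  have hXm : Measurable X := Finset.measurable_fun_sum _ fun k _ => hEm k
  have assoc : ∀ {a b : ℝ} {g : V → ℝ≥0∞}, 0 < a → 0 < b → Measurable g →
      (heatE a ⋆ₗ (heatE b ⋆ₗ g)) = heatE (a + b) ⋆ₗ g := fun {a b g} ha hb hg => by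
    rw [lconvolution_assoc (measurable_heatE _) (measurable_heatE _) hg, heatE_lconv_heatE ha hb]
  have heat2 : ∀ {a b : ℝ} (ha : 0 < a) (hb : 0 < b) (g : 𝓢(V, ℂ)),
      conv (heat V a ha) (conv (heat V b hb) g) = conv (heat V (a + b) (add_pos ha hb)) g := by
    intro a b ha hb g
    rw [← conv_assoc, conv_heat_heat]
  have hsqm : ∀ g : 𝓢(V, ℂ), Measurable fun x => ‖g x‖ₑ ^ 2 := fun g =>
    (measurable_enorm_schwartz g).pow_const 2
  -- The variance identity reads `heatE (3 tᵢ) ⋆ₗ |uᵢ|² = Wᵢ + |heat (4 tᵢ) f|²`, since `uᵢ` has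
  -- already flowed for time `tᵢ`. Averaging for time `6 tₖ - 4 tᵢ` and using `tᵢ = 4 tᵢ₊₁` turns
  -- the left side into the next term of the chain.
  have telescope : ∀ k m, k ≤ m → ∀ x,
      ∑ i ∈ Finset.Ico k m, (heatE (6 * t k - 4 * t i) ⋆ₗ W i) x +
        (heatE (6 * t k - 4 * t k) ⋆ₗ fun y => ‖conv (heat V (4 * t k) (by linarith [ht k])) f y‖ₑ ^ 2) x =
      (heatE (6 * t k - 4 * t m) ⋆ₗ fun y => ‖conv (heat V (4 * t m) (by linarith [ht m])) f y‖ₑ ^ 2) x := by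
    intro k m hkm x
    induction m, hkm using Nat.le_induction with
    | base => simp
    | succ m hkm ih =>
      rw [Finset.sum_Ico_succ_top hkm, add_right_comm, ih, add_comm]
      have e1 : 6 * t k - 4 * t (m + 1) = (6 * t k - 4 * t m) + 3 * t m := by rw [ht4]; ring
      have p1 : 0 < 6 * t k - 4 * t m := by linarith [tmono k m hkm, ht k]
      have p3 : 0 < 3 * t m := by linarith [ht m]
      have e2 : conv (heat V (4 * t (m + 1)) (by linarith [ht (m + 1)])) f = u m := by
        simp only [hu, ht4]
      have e3 : conv (heat V (4 * t m) (by linarith [ht m])) f = conv (heat V (3 * t m) p3) (u m) := by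
        rw [hu, heat2]
        congr 2
        ring
      rw [e1, e2, e3, ← assoc p1 p3 (hsqm _)]
      have e4 : (heatE (3 * t m) ⋆ₗ fun y => ‖u m y‖ₑ ^ 2) =
          fun y => W m y + ‖conv (heat V (3 * t m) p3) (u m) y‖ₑ ^ 2 := by
        ext y; rw [← hvar_add p3]
      rw [e4]
      simp only [lconvolution_def, mul_add]
      rw [lintegral_add_left (by have := hWm m; fun_prop)]
  have tele_le : ∀ k, k ≤ M → ∀ x, ∑ i ∈ Finset.Ico k M, (heatE (6 * t k - 4 * t i) ⋆ₗ W i) x ≤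
      (heatE (6 * t k) ⋆ₗ F) x := by
    intro k hk x
    refine le_trans le_self_add ((telescope k M hk x).le.trans ?_)
    have p1 : 0 < 6 * t k - 4 * t M := by linarith [tmono k M hk, ht k]
    have p3 : 0 < 4 * t M := by linarith [ht M]
    have := congrFun (assoc p1 p3 hFm) x
    rw [sub_add_cancel] at this
    rw [← this]
    exact lconv_mono (fun _ => le_rfl) (fun y => enorm_conv_heat_sq_le p3 f y) x
  -- The two averages compose to time `tₖ + tᵢ`, and `tₖ + tᵢ ≤ 6 tₖ - 4 tᵢ ≤ 6 (tₖ + tᵢ)` for `tᵢ ≤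
  -- tₖ`. This gives the kernel of the telescoping sum and the constant `6^(d/2)`.
  have pair : ∀ k i, k ≤ i → ∫⁻ x, E k x * E i x ≤
      c * ∫⁻ x, W k x * (heatE (6 * t k - 4 * t i) ⋆ₗ W i) x := by
    intro k i hki
    have p1 := ht k
    have p2 := ht i
    have p3 := tmono k i hki
    rw [hE, lintegral_lconv_mul (measurable_heatE _) (hWm k) (hEm i) (heatE_neg _),
      assoc p1 p2 (hWm i), ← lintegral_const_mul _ (by have := hWm k; have := hWm i; fun_prop)]
    refine lintegral_mono fun x => ?_
    rw [mul_left_comm, ← const_mul_lconv c (by fun_prop) (hWm i)]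
    refine mul_le_mul' le_rfl ?_
    exact lconv_mono (fun y => heatE_le (by linarith) (by linarith) (by linarith) y)
      (fun _ => le_rfl) x
  have hfin : l2 X ≠ ⊤ := by
    refine ne_top_of_le_ne_top ?_ (l2_sum_le _ fun k _ => hEm k)
    refine ENNReal.sum_ne_top.2 fun k _ => ?_
    refine ne_top_of_le_ne_top ?_ (l2_lconv_le (measurable_heatE _) (hWm k))
    rw [lintegral_heatE (ht k), one_mul]
    refine ne_top_of_le_ne_top ?_ (l2_mono fun x => hvar_le _ (u k) x)
    refine ne_top_of_le_ne_top ?_ (l2_lconv_le (measurable_heatE _) (hsqm _))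
    rw [lintegral_heatE (by linarith [ht k]), one_mul]
    exact l2_enorm_sq_schwartz_ne_top _
  have hsq : l2 X ^ 2 ≤ l2 X * (2 * c * (C₅ * (2 ^ (N + 2) * wtMass V N)) * l2 F) := by
    have hR : ∀ k, 0 < R₀ * 2 ^ k := fun k => by positivity
    have hme : ∀ i j, Measurable fun x => E i x * E j x := fun i j => (hEm i).mul (hEm j)
    calc l2 X ^ 2 = ∑ k ∈ Finset.range M, ∑ i ∈ Finset.range M, ∫⁻ x, E k x * E i x := by
          rw [l2_sq]
          simp only [hX, pow_two, Finset.sum_mul_sum]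
          rw [lintegral_finsetSum _ fun i _ => Finset.measurable_fun_sum _ fun j _ => hme i j]
          exact Finset.sum_congr rfl fun i _ => lintegral_finsetSum _ fun j _ => hme i j
      _ ≤ 2 * ∑ k ∈ Finset.range M, ∑ i ∈ Finset.Ico k M, ∫⁻ x, E k x * E i x :=
          sum_sum_le_two_mul _ fun k i => by simp only [mul_comm]
      _ ≤ 2 * ∑ k ∈ Finset.range M, c * ∫⁻ x, W k x * (heatE (6 * t k) ⋆ₗ F) x := by
          gcongr with k hk
          rw [Finset.mem_range] at hk
          calc _ ≤ ∑ i ∈ Finset.Ico k M, c * ∫⁻ x, W k x * (heatE (6 * t k - 4 * t i) ⋆ₗ W i) x :=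
                Finset.sum_le_sum fun i hi => pair k i (Finset.mem_Ico.1 hi).1
            _ = c * ∫⁻ x, W k x * ∑ i ∈ Finset.Ico k M, (heatE (6 * t k - 4 * t i) ⋆ₗ W i) x := by
                simp only [Finset.mul_sum]
                rw [lintegral_finsetSum _ fun i _ => by have := hWm k; have := hWm i; fun_prop,
                  Finset.mul_sum]
            _ ≤ _ := by
                gcongr with x
                exact tele_le k hk.le x
      -- Splitting `6 tₖ = tₖ + 5 tₖ` recovers `E k`; the remaining average at time `5 tₖ` is
      -- removed by the dual maximal inequality.
      _ = 2 * c * ∫⁻ x, (∑ k ∈ Finset.range M, (heatE (5 * t k) ⋆ₗ E k) x) * F x := by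
          simp only [Finset.sum_mul]
          rw [lintegral_finsetSum _ fun i _ => by have := hEm i; fun_prop, ← Finset.mul_sum, mul_assoc]
          congr 2
          refine Finset.sum_congr rfl fun k _ => ?_
          have p := ht k
          rw [lintegral_lconv_mul (by fun_prop) (hEm k) hFm (heatE_neg _), hE,
            lintegral_lconv_mul (by fun_prop) (hWm k) (by fun_prop) (heatE_neg _),
            assoc p (by linarith) hFm, show t k + 5 * t k = 6 * t k by ring]
      _ ≤ 2 * c * (l2 (fun x => ∑ k ∈ Finset.range M, (heatE (5 * t k) ⋆ₗ E k) x) * l2 F) := by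
          gcongr
          exact lintegral_mul_le_l2 (Finset.measurable_fun_sum _ fun k _ =>
            measurable_lconvolution _ (measurable_heatE _) (hEm k)) hFm
      _ ≤ 2 * c * ((C₅ * (2 ^ (N + 2) * wtMass V N * l2 X)) * l2 F) := by
          gcongr
          calc _ ≤ l2 (fun x => C₅ * ∑ k ∈ Finset.range M,
                (wt N (dil (R₀ * 2 ^ k) (hR k).ne') ⋆ₗ E k) x) := by
                refine l2_mono fun x => ?_
                rw [Finset.mul_sum]
                gcongr with k
                rw [← const_mul_lconv _ (by fun_prop) (hEm k)]
                refine lconv_mono (fun y => ?_) (fun _ => le_rfl) x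
                rw [htR, mul_one_div]
                exact h5 _ (hR k) y
            _ = C₅ * l2 (fun x => ∑ k ∈ Finset.range M,
                (wt N (dil (R₀ * 2 ^ k) (hR k).ne') ⋆ₗ E k) x) :=
                l2_const_mul _ (Finset.measurable_fun_sum _ fun k _ =>
                  measurable_lconvolution _ (measurable_wt _ _) (hEm k))
            _ ≤ _ := by
                gcongr
                exact l2_sum_wt_dil_lconv_le (by omega) _ hR hEm
      _ = _ := by ring
  exact le_of_sq_le_mul hfin hsq

end LittlewoodPaley

/-! ### The Littlewood–Paley square function from the heat flow. -/

section LittlewoodPaleySquare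

variable {V : Type*} [NormedAddCommGroup V] [InnerProductSpace ℝ V] [FiniteDimensional ℝ V]
  [MeasurableSpace V] [BorelSpace V]

theorem dil_symm_apply {R : ℝ} (hR : R ≠ 0) (ξ : V) : (dil R hR : V ≃L[ℝ] V).symm ξ = R⁻¹ • ξ := by
  rw [ContinuousLinearEquiv.symm_apply_eq]; simp [hR]

/-- A compactly supported multiplier vanishing near the origin can be divided by a smooth function
that does not vanish away from the origin. -/
theorem exists_schwartz_mul (m : 𝓢(V, ℂ)) (hm : HasCompactSupport m) {ε : ℝ} (hε : 0 < ε)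
    (hm0 : ∀ ξ, ‖ξ‖ < ε → m ξ = 0) {g : V → ℂ} (hg : ContDiff ℝ ∞ g) (hg0 : ∀ ξ, ξ ≠ 0 → g ξ ≠ 0) :
    ∃ r : 𝓢(V, ℂ), ∀ ξ, m ξ = r ξ * g ξ := by
  have hsm : ContDiff ℝ ∞ fun ξ => m ξ * (g ξ)⁻¹ := by
    rw [contDiff_iff_contDiffAt]
    intro ξ
    rcases eq_or_ne ξ 0 with h | h
    · refine (contDiffAt_const (c := (0 : ℂ))).congr_of_eventuallyEq ?_
      filter_upwards [Metric.ball_mem_nhds ξ hε] with η hη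
      rw [hm0 η (by simpa [h] using hη), zero_mul]
    · exact (m.contDiffAt ⊤).mul (hg.contDiffAt.inv (hg0 ξ h))
  refine ⟨(hm.mul_right (f' := fun ξ => (g ξ)⁻¹)).toSchwartzMap hsm, fun ξ => ?_⟩
  change m ξ = m ξ * (g ξ)⁻¹ * g ξ
  rcases eq_or_ne ξ 0 with h | h
  · rw [hm0 ξ (by simpa [h] using hε)]; simp
  · rw [mul_assoc, inv_mul_cancel₀ (hg0 ξ h), mul_one]

/-- The Littlewood–Paley square function estimate in `L⁴`. -/
theorem littlewoodPaley (m : 𝓢(V, ℂ)) (hm : HasCompactSupport m) {ε : ℝ} (hε : 0 < ε)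
    (hm0 : ∀ ξ, ‖ξ‖ < ε → m ξ = 0) :
    ∃ C : ℝ≥0∞, C ≠ ⊤ ∧ ∀ (R₀ : ℝ) (hR : ∀ k : ℕ, 0 < R₀ * 2 ^ k), ∀ (M : ℕ) (f : 𝓢(V, ℂ)),
      l2 (fun x => ∑ k ∈ Finset.range M, ‖conv (dk (dil (R₀ * 2 ^ k) (hR k).ne') m) f x‖ₑ ^ 2) ≤
        C * l2 (fun x => ‖f x‖ₑ ^ 2) := by
  set γ : ℝ → V → ℂ := fun t ξ => ((Real.exp (-t * ‖ξ‖ ^ 2) : ℝ) : ℂ) with hγ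
  have hγs : ∀ t, ContDiff ℝ ∞ (γ t) := fun t =>
    Complex.ofRealCLM.contDiff.comp (contDiff_const.mul (contDiff_norm_sq ℝ)).exp
  -- The division is possible because `m` vanishes near `0`, the only zero of `γ 1 - γ 2`. After
  -- rescaling, one factor `γ 1` produces `u k`, the difference is a mean-zero kernel controlled by
  -- the variance `W k`, and the other `γ 1` supplies the heat average in `E k`.
  obtain ⟨r, hr⟩ := exists_schwartz_mul m hm hε hm0
    (g := fun ξ => γ 1 ξ * ((γ 1 ξ - γ 2 ξ) * γ 1 ξ)) ((hγs 1).mul (((hγs 1).sub (hγs 2)).mul (hγs 1)))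
    (fun ξ hξ => by
      have h1 : γ 1 ξ ≠ 0 := by simp only [hγ]; exact_mod_cast (Real.exp_pos _).ne'
      refine mul_ne_zero h1 (mul_ne_zero (sub_ne_zero.2 ?_) h1)
      simp only [hγ, Ne, Complex.ofReal_inj, Real.exp_eq_exp]
      have : 0 < ‖ξ‖ ^ 2 := by positivity
      intro h; linarith)
  set N := Module.finrank ℝ V + 1 with hN
  obtain ⟨Cr, hCr, hrw⟩ := enorm_dk_le r N
  obtain ⟨Ch, hCh, hh⟩ := l2_sum_heat_hvar_le (V := V)
  set I : ℝ≥0∞ := ∫⁻ x, ‖𝓕⁻ r x‖ₑ with hI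
  have hItop : I ≠ ⊤ := lintegral_enorm_schwartz_ne_top _
  set c : ℝ≥0∞ := ENNReal.ofReal ((3 : ℝ) ^ (Module.finrank ℝ V / 2 : ℝ)) with hc
  set D : ℝ≥0∞ := 2 * (2 * c) with hD
  refine ⟨I * (Cr * D) * (2 ^ (N + 2) * wtMass V N * Ch), ?_, ?_⟩
  · have := wtMass_ne_top (V := V) (N := N) (by omega)
    finiteness
  intro R₀ hR M f
  have hR₀ : 0 < R₀ := by simpa using hR 0
  set t : ℕ → ℝ := fun k => 1 / (R₀ * 2 ^ k) ^ 2 with ht'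
  have ht : ∀ k, 0 < t k := fun k => by positivity
  set u : ℕ → 𝓢(V, ℂ) := fun k => conv (heat V (t k) (ht k)) f with hu
  set W : ℕ → V → ℝ≥0∞ := fun k => hvar (mul_pos three_pos (ht k)) (u k) with hW
  have hWm : ∀ k, Measurable (W k) := fun k => measurable_hvar _ _
  set E : ℕ → V → ℝ≥0∞ := fun k => heatE (t k) ⋆ₗ W k with hE
  have hEm : ∀ k, Measurable (E k) := fun k => measurable_lconvolution _ (measurable_heatE _) (hWm k)
  have hmain := hh R₀ hR₀ t ht (fun k => rfl) M f
  have hsqm : ∀ g : 𝓢(V, ℂ), Measurable fun x => ‖g x‖ₑ ^ 2 := fun g =>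
    (measurable_enorm_schwartz g).pow_const 2
  have point : ∀ k x, ‖conv (dk (dil (R₀ * 2 ^ k) (hR k).ne') m) f x‖ₑ ^ 2 ≤
      I * (Cr * D) * (wt N (dil (R₀ * 2 ^ k) (hR k).ne') ⋆ₗ E k) x := by
    intro k x
    have p2 : 0 < 2 * t k := by linarith [ht k]
    set K : 𝓢(V, ℂ) := heat V (t k) (ht k) - heat V (2 * t k) p2 with hK
    have hKf : ∀ ξ, 𝓕 K ξ = 𝓕 (heat V (t k) (ht k)) ξ - 𝓕 (heat V (2 * t k) p2) ξ := fun ξ => by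
      rw [hK, sub_eq_add_neg, FourierTransform.fourier_add, FourierTransform.fourier_neg]; rfl
    have hKb : ∀ y, ‖K y‖ₑ ≤ heatE (t k) y + heatE (2 * t k) y := fun y => by
      rw [← enorm_heat (ht k), ← enorm_heat p2]
      exact enorm_sub_le
    have hK1 : ∫⁻ y, ‖K y‖ₑ ≤ 2 := by
      refine (lintegral_mono hKb).trans ?_
      rw [lintegral_add_left (by fun_prop), lintegral_heatE (ht k), lintegral_heatE p2]
      norm_num
    -- Both times `tₖ` and `2 tₖ` are compared with `3 tₖ`, the time at which the variance `W k` is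
    -- taken.
    have hK2 : ∀ y, ‖K y‖ₑ ≤ 2 * c * heatE (3 * t k) y := fun y => by
      refine (hKb y).trans ?_
      rw [show 2 * c * heatE (3 * t k) y = c * heatE (3 * t k) y + c * heatE (3 * t k) y by ring]
      refine add_le_add ?_ ?_
      · exact heatE_le (ht k) (by linarith [ht k]) le_rfl y
      · exact heatE_le p2 (by linarith [ht k]) (by linarith [ht k]) y
    have hv : ∀ y, ‖conv K (u k) y‖ₑ ^ 2 ≤ D * W k y := fun y => by
      refine (enorm_conv_sq_le_hvar (mul_pos three_pos (ht k)) K (u k) ?_ hK2 y).trans ?_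
      · rw [hKf, fourier_heat, fourier_heat]; simp
      · exact (mul_le_mul' hK1 le_rfl).trans_eq (by rw [hD]; simp only [hW]; ring)
    have e : conv (dk (dil (R₀ * 2 ^ k) (hR k).ne') m) f =
        conv (dk (dil (R₀ * 2 ^ k) (hR k).ne') r) (conv (heat V (t k) (ht k)) (conv K (u k))) := by
      refine ext_fourier fun ξ => ?_
      simp only [hu, fourier_conv, hKf, fourier_dk, fourier_heat, hr, dil_symm_apply, hγ, norm_smul,
        norm_inv, Real.norm_of_nonneg (hR k).le]
      have e1 : ∀ a : ℝ, -(a * t k) * ‖ξ‖ ^ 2 = -a * ((R₀ * 2 ^ k)⁻¹ * ‖ξ‖) ^ 2 := fun a => by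
        simp only [ht']; field_simp
      have e2 := e1 1
      rw [one_mul] at e2
      rw [e2, e1 2]
      ring
    rw [e]
    refine (enorm_conv_sq_le _ _ x).trans ?_
    rw [lintegral_enorm_dk (selfAdj_dil _), mul_assoc]
    gcongr
    rw [mul_assoc, ← lconv_const_mul D (by fun_prop) (hEm k), ← const_mul_lconv Cr (by fun_prop)
      ((hEm k).const_mul D)]
    refine lconv_mono (fun y => hrw _ (selfAdj_dil _) y) (fun y => ?_) x
    refine (enorm_conv_heat_sq_le (ht k) _ y).trans ?_
    rw [hE, ← lconv_const_mul D (by fun_prop) (hWm k)]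
    exact lconv_mono (fun _ => le_rfl) hv y
  calc _ ≤ l2 (fun x => I * (Cr * D) * ∑ k ∈ Finset.range M,
        (wt N (dil (R₀ * 2 ^ k) (hR k).ne') ⋆ₗ E k) x) := by
        refine l2_mono fun x => ?_
        rw [Finset.mul_sum]
        exact Finset.sum_le_sum fun k _ => point k x
    _ = I * (Cr * D) * l2 (fun x => ∑ k ∈ Finset.range M,
        (wt N (dil (R₀ * 2 ^ k) (hR k).ne') ⋆ₗ E k) x) :=
        l2_const_mul _ (Finset.measurable_fun_sum _ fun k _ =>
          measurable_lconvolution _ (measurable_wt _ _) (hEm k))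
    _ ≤ I * (Cr * D) * (2 ^ (N + 2) * wtMass V N * l2 (fun x => ∑ k ∈ Finset.range M, E k x)) := by
        gcongr
        exact l2_sum_wt_dil_lconv_le (by omega) _ hR hEm
    _ ≤ I * (Cr * D) * (2 ^ (N + 2) * wtMass V N * (Ch * l2 (fun x => ‖f x‖ₑ ^ 2))) := by
        gcongr
    _ = _ := by ring

end LittlewoodPaleySquare

/-! ### Interpolation between `L²` and `L^∞`. -/

section Interpolation

variable {V : Type*} [NormedAddCommGroup V] [InnerProductSpace ℝ V] [FiniteDimensional ℝ V]
  [MeasurableSpace V] [BorelSpace V]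

/-- A smooth truncation of a Schwartz function to the set where it is large. -/
theorem exists_truncation (f : 𝓢(V, ℂ)) {a : ℝ} (ha : 0 < a) :
    ∃ g : 𝓢(V, ℂ), (∀ x, ‖f x - g x‖ ≤ 2 * a) ∧ (∀ x, ‖g x‖ ≤ ‖f x‖) ∧
      ∀ x, ‖f x‖ < a → g x = 0 := by
  -- Using `‖f x‖ ^ 2` keeps the cutoff smooth at the zeros of `f`; it is `0` where `‖f‖ ≤ a` and
  -- `1` where `‖f‖ ≥ 2a`.
  set χ : V → ℝ := fun x => Real.smoothTransition (‖f x‖ ^ 2 / a ^ 2 - 1) with hχ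
  have hχ0 : ∀ x, ‖f x‖ ≤ a → χ x = 0 := fun x hx => by
    refine Real.smoothTransition.zero_of_nonpos ?_
    rw [sub_nonpos, div_le_one (by positivity)]
    gcongr
  have hsm : ContDiff ℝ ∞ fun x => χ x • f x := by
    have h2 : ContDiff ℝ ∞ fun x => ‖f x‖ ^ 2 := (f.smooth ⊤).norm_sq ℝ
    have h1 : ContDiff ℝ ∞ χ :=
      Real.smoothTransition.contDiff.comp ((h2.div_const _).sub contDiff_const)
    exact h1.smul (f.smooth ⊤)
  have hcs : HasCompactSupport fun x => χ x • f x := by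
    obtain ⟨C, hC0, hC⟩ := exists_decay f 1
    refine HasCompactSupport.intro (isCompact_closedBall (0 : V) (C / a)) fun x hx => ?_
    rw [hχ0 x, zero_smul]
    refine (hC x).trans ?_
    simp only [Metric.mem_closedBall, dist_zero_right, not_le, pow_one] at hx ⊢
    rw [div_lt_iff₀ ha] at hx
    rw [← div_eq_mul_inv, div_le_iff₀ (by positivity)]
    nlinarith
  refine ⟨hcs.toSchwartzMap hsm, fun x => ?_, fun x => ?_, fun x hx => ?_⟩
  · change ‖f x - χ x • f x‖ ≤ 2 * a
    rcases le_total (2 * a) ‖f x‖ with h | h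
    · have : χ x = 1 := by
        refine Real.smoothTransition.one_of_one_le ?_
        rw [le_sub_iff_add_le, le_div_iff₀ (by positivity)]
        nlinarith
      rw [this]; simp; positivity
    · have e : f x - χ x • f x = (1 - χ x) • f x := by rw [sub_smul, one_smul]
      rw [e, norm_smul, Real.norm_of_nonneg (by linarith [Real.smoothTransition.le_one (‖f x‖ ^ 2 / a ^ 2 - 1)])]
      have := Real.smoothTransition.nonneg (‖f x‖ ^ 2 / a ^ 2 - 1)
      calc _ ≤ 1 * ‖f x‖ := by gcongr; simp only [hχ]; linarith
        _ ≤ _ := by linarith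
  · change ‖χ x • f x‖ ≤ _
    rw [norm_smul, Real.norm_of_nonneg (Real.smoothTransition.nonneg _)]
    exact mul_le_of_le_one_left (norm_nonneg _) (Real.smoothTransition.le_one _)
  · change χ x • f x = 0
    rw [hχ0 x hx.le, zero_smul]

theorem lintegral_Ioc_ofReal {c : ℝ} (hc : 0 ≤ c) :
    ∫⁻ a in Set.Ioc 0 c, ENNReal.ofReal a = ENNReal.ofReal (c ^ 2 / 2) := by
  rw [← ofReal_integral_eq_lintegral_ofReal, ← intervalIntegral.integral_of_le hc, integral_id]
  · simp
  · exact (continuous_id.integrableOn_Icc).mono_set Set.Ioc_subset_Icc_self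
  · exact (ae_restrict_iff' measurableSet_Ioc).2 (Filter.Eventually.of_forall fun a ha => ha.1.le)

/-- Integrating level sets: `∫ g² · (c ‖g‖)² / 2` as a double integral. -/
theorem lintegral_level_sets {g : V → ℝ} (hg : Measurable g) (hg0 : ∀ x, 0 ≤ g x) {c : ℝ}
    (hc : 0 ≤ c) :
    ∫⁻ a in Set.Ioi (0 : ℝ), ENNReal.ofReal a *
        ∫⁻ x, (if a ≤ c * g x then ENNReal.ofReal (g x) ^ 2 else 0) =
      ENNReal.ofReal (c ^ 2 / 2) * ∫⁻ x, ENNReal.ofReal (g x) ^ 4 := by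
  have hm : Measurable fun p : ℝ × V => if p.1 ≤ c * g p.2 then ENNReal.ofReal (g p.2) ^ 2 else 0 :=
    Measurable.ite (measurableSet_le (by fun_prop) (by fun_prop)) (by fun_prop) (by fun_prop)
  have e1 : ∀ a : ℝ, ENNReal.ofReal a * ∫⁻ x, (if a ≤ c * g x then ENNReal.ofReal (g x) ^ 2 else 0) =
      ∫⁻ x, ENNReal.ofReal a * (if a ≤ c * g x then ENNReal.ofReal (g x) ^ 2 else 0) := fun a =>
    (lintegral_const_mul _ (hm.comp (measurable_const.prodMk measurable_id))).symm
  simp only [e1]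
  rw [lintegral_lintegral_swap (((ENNReal.measurable_ofReal.comp measurable_fst).mul hm).aemeasurable),
    ← lintegral_const_mul _ (by fun_prop)]
  congr with x
  have e2 : ∀ a : ℝ, ENNReal.ofReal a * (if a ≤ c * g x then ENNReal.ofReal (g x) ^ 2 else 0) =
      ENNReal.ofReal (g x) ^ 2 * (Set.Iic (c * g x)).indicator (fun a => ENNReal.ofReal a) a :=
    fun a => by
      by_cases h : a ≤ c * g x
      · simp [h, mul_comm]
      · simp [h]
  simp only [e2]
  rw [lintegral_const_mul _ (Measurable.indicator (by fun_prop) measurableSet_Iic),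
    lintegral_indicator measurableSet_Iic, Measure.restrict_restrict measurableSet_Iic,
    Set.Iic_inter_Ioi, lintegral_Ioc_ofReal (mul_nonneg hc (hg0 x))]
  rw [← ENNReal.ofReal_pow (hg0 x), ← ENNReal.ofReal_pow (hg0 x), ← ENNReal.ofReal_mul (by positivity),
    ← ENNReal.ofReal_mul (by positivity)]
  congr 1
  ring

/-- Interpolation between `L²` and `L^∞`: a family of convolution operators bounded on `L^∞` and
almost orthogonal in `L²` is bounded from `L⁴` to `ℓ⁴ L⁴`. -/
theorem sum_lintegral_conv_pow_four_le {ι : Type*} (s : Finset ι) (K : ι → 𝓢(V, ℂ)) {B : ℝ}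
    (hB : 0 < B) (hK1 : ∀ i ∈ s, ∫⁻ x, ‖K i x‖ₑ ≤ ENNReal.ofReal B)
    (hK2 : ∀ ξ, ∑ i ∈ s, ‖𝓕 (K i) ξ‖ₑ ^ 2 ≤ ENNReal.ofReal (B ^ 2)) (f : 𝓢(V, ℂ)) :
    ∑ i ∈ s, ∫⁻ x, ‖conv (K i) f x‖ₑ ^ 4 ≤ ENNReal.ofReal (64 * B ^ 4) * ∫⁻ x, ‖f x‖ₑ ^ 4 := by
  -- Where `‖conv (K i) f‖ ≥ 4Ba`, the bounded part `f - g` contributes at most `2Ba`, that is, at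
  -- most half. Hence `‖conv (K i) f‖² ≤ 4 ‖conv (K i) g‖²` there, and Plancherel sums the right
  -- side over `i`. Integration against `a da` then yields fourth powers.
  have level : ∀ a : ℝ, 0 < a →
      ∑ i ∈ s, ∫⁻ x, (if a ≤ (4 * B)⁻¹ * ‖conv (K i) f x‖ then
        ENNReal.ofReal ‖conv (K i) f x‖ ^ 2 else 0) ≤
      ENNReal.ofReal (4 * B ^ 2) * ∫⁻ x, (if a ≤ 1 * ‖f x‖ then ENNReal.ofReal ‖f x‖ ^ 2 else 0) := by
    intro a ha
    obtain ⟨g, hg1, hg2, hg3⟩ := exists_truncation f ha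
    have hdiff : ∀ i ∈ s, ∀ x, ‖conv (K i) f x‖ ≤ ‖conv (K i) g x‖ + 2 * B * a := by
      intro i hi x
      have e : conv (K i) f x = conv (K i) g x + conv (K i) (f - g) x := by
        rw [conv, conv, conv, map_sub]; simp
      rw [e]
      refine (norm_add_le _ _).trans (add_le_add_right ?_ _)
      have h1 : ‖conv (K i) (f - g) x‖ₑ ≤ ENNReal.ofReal (2 * B * a) := by
        refine (enorm_conv_le _ _ x).trans ?_
        calc _ ≤ ∫⁻ y, ‖K i y‖ₑ * ENNReal.ofReal (2 * a) := by
              rw [lconvolution_def]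
              gcongr with y
              rw [← ofReal_norm]
              exact ENNReal.ofReal_le_ofReal (hg1 _)
          _ ≤ ENNReal.ofReal B * ENNReal.ofReal (2 * a) := by
              rw [lintegral_mul_const _ (measurable_enorm_schwartz _)]
              gcongr
              exact hK1 i hi
          _ = _ := by rw [← ENNReal.ofReal_mul hB.le]; ring_nf
      rwa [← ofReal_norm, ENNReal.ofReal_le_ofReal_iff (by positivity)] at h1
    calc _ ≤ ∑ i ∈ s, ∫⁻ x, 4 * ‖conv (K i) g x‖ₑ ^ 2 := by
          refine Finset.sum_le_sum fun i hi => lintegral_mono fun x => ?_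
          split_ifs with h
          · rw [inv_mul_eq_div, le_div_iff₀ (by positivity)] at h
            have h2 := hdiff i hi x
            rw [← ofReal_norm, ← ENNReal.ofReal_pow (norm_nonneg _), ← ENNReal.ofReal_pow (norm_nonneg _),
              show (4 : ℝ≥0∞) = ENNReal.ofReal 4 by simp, ← ENNReal.ofReal_mul (by norm_num)]
            apply ENNReal.ofReal_le_ofReal
            nlinarith [norm_nonneg (conv (K i) f x), norm_nonneg (conv (K i) g x)]
          · exact zero_le
      _ = 4 * ∫⁻ ξ, ∑ i ∈ s, ‖𝓕 (conv (K i) g) ξ‖ₑ ^ 2 := by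
          rw [lintegral_finsetSum _ fun i _ => (measurable_enorm_schwartz _).pow_const 2, Finset.mul_sum]
          refine Finset.sum_congr rfl fun i _ => ?_
          rw [lintegral_const_mul _ ((measurable_enorm_schwartz _).pow_const 2), lintegral_enorm_fourier_sq]
      _ ≤ 4 * ∫⁻ ξ, ENNReal.ofReal (B ^ 2) * ‖𝓕 g ξ‖ₑ ^ 2 := by
          gcongr with ξ
          simp only [fourier_conv, enorm_mul, mul_pow, ← Finset.sum_mul]
          gcongr
          exact hK2 ξ
      _ = ENNReal.ofReal (4 * B ^ 2) * ∫⁻ x, ‖g x‖ₑ ^ 2 := by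
          rw [lintegral_const_mul _ ((measurable_enorm_schwartz _).pow_const 2),
            lintegral_enorm_fourier_sq, ENNReal.ofReal_mul (by norm_num), mul_assoc]
          simp
      _ ≤ _ := by
          gcongr with x
          split_ifs with h
          · rw [← ofReal_norm]
            gcongr
            exact hg2 x
          · rw [hg3 x (by simpa using h)]; simp
  have hmeas : ∀ (g : 𝓢(V, ℂ)) (c : ℝ), Measurable fun a : ℝ => ENNReal.ofReal a *
      ∫⁻ x, (if a ≤ c * ‖g x‖ then ENNReal.ofReal ‖g x‖ ^ 2 else 0) := by
    intro g c
    have hgn : Measurable fun x => ‖g x‖ := g.continuous.norm.measurable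
    have hm : Measurable fun p : ℝ × V => if p.1 ≤ c * ‖g p.2‖ then ENNReal.ofReal ‖g p.2‖ ^ 2 else 0 :=
      Measurable.ite (measurableSet_le (by fun_prop) (by fun_prop)) (by fun_prop) (by fun_prop)
    exact ENNReal.measurable_ofReal.mul hm.lintegral_prod_right'
  have total : ∑ i ∈ s, ENNReal.ofReal (((4 * B)⁻¹) ^ 2 / 2) *
      ∫⁻ x, ENNReal.ofReal ‖conv (K i) f x‖ ^ 4 ≤ ENNReal.ofReal (4 * B ^ 2) *
        (ENNReal.ofReal (1 ^ 2 / 2) * ∫⁻ x, ENNReal.ofReal ‖f x‖ ^ 4) := by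
    rw [← lintegral_level_sets f.continuous.norm.measurable (fun x => norm_nonneg _) zero_le_one,
      ← lintegral_const_mul _ (hmeas f 1)]
    have e : ∀ i ∈ s, ENNReal.ofReal (((4 * B)⁻¹) ^ 2 / 2) * ∫⁻ x, ENNReal.ofReal ‖conv (K i) f x‖ ^ 4 =
        ∫⁻ a in Set.Ioi (0 : ℝ), ENNReal.ofReal a * ∫⁻ x, (if a ≤ (4 * B)⁻¹ * ‖conv (K i) f x‖ then
          ENNReal.ofReal ‖conv (K i) f x‖ ^ 2 else 0) := fun i _ =>
      (lintegral_level_sets (conv (K i) f).continuous.norm.measurable (fun x => norm_nonneg _)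
        (by positivity)).symm
    rw [Finset.sum_congr rfl e, ← lintegral_finsetSum _ fun i _ => hmeas _ _]
    refine lintegral_mono_ae ((ae_restrict_iff' measurableSet_Ioi).2
      (Filter.Eventually.of_forall fun a ha => ?_))
    rw [← Finset.mul_sum, mul_left_comm]
    gcongr
    exact level a ha
  rw [← Finset.mul_sum] at total
  simp only [ofReal_norm] at total
  calc ∑ i ∈ s, ∫⁻ x, ‖conv (K i) f x‖ₑ ^ 4 = ENNReal.ofReal (32 * B ^ 2) *
        (ENNReal.ofReal (((4 * B)⁻¹) ^ 2 / 2) * ∑ i ∈ s, ∫⁻ x, ‖conv (K i) f x‖ₑ ^ 4) := by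
        rw [← mul_assoc, ← ENNReal.ofReal_mul (by positivity)]
        have : 32 * B ^ 2 * (((4 * B)⁻¹) ^ 2 / 2) = 1 := by field_simp; norm_num
        rw [this]; simp
    _ ≤ _ := mul_le_mul' le_rfl total
    _ = _ := by
        rw [← mul_assoc, ← mul_assoc, ← ENNReal.ofReal_mul (by positivity),
          ← ENNReal.ofReal_mul (by positivity)]
        congr 2
        ring

end Interpolation

/-! ### Local orthogonality on a box. -/

section LocalOrthogonality

variable {V : Type*} [NormedAddCommGroup V] [InnerProductSpace ℝ V] [FiniteDimensional ℝ V]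
  [MeasurableSpace V] [BorelSpace V]

/-- The factor by which a weight can change under translation. -/
def peetre (N : ℕ) (L : V ≃L[ℝ] V) (y : V) : ℝ≥0∞ := ENNReal.ofReal ((1 + ‖L y‖) ^ N)

@[fun_prop]
theorem measurable_peetre (N : ℕ) (L : V ≃L[ℝ] V) : Measurable (peetre N L) := by
  unfold peetre
  have := L.continuous.measurable
  fun_prop

theorem wt_sub_le (N : ℕ) (L : V ≃L[ℝ] V) (x y : V) : wt N L (x - y) ≤ peetre N L y * wt N L x := by
  rw [wt, wt, peetre, ← ENNReal.ofReal_mul (by positivity)]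
  exact ENNReal.ofReal_le_ofReal (wtReal_sub_le N L x y)

theorem wt_le_sub (N : ℕ) (L : V ≃L[ℝ] V) (x y : V) : wt N L x ≤ peetre N L y * wt N L (x - y) := by
  have h := wt_sub_le N L (x - y) (-y)
  simpa [peetre] using h

/-- By Peetre's inequality a translation by `y` changes the weight by at most the factor `peetre N L
y`, so convolution costs a moment of `g`; `le_wt_lconv` is the matching lower bound. -/
theorem wt_lconv_le (N : ℕ) (L : V ≃L[ℝ] V) {g : V → ℝ≥0∞} (hg : Measurable g) (x : V) :
    (wt N L ⋆ₗ g) x ≤ (∫⁻ y, peetre N L y * g y) * wt N L x := by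
  rw [lconvolution_comm, lconvolution_def, ← lintegral_mul_const _ (by fun_prop)]
  refine lintegral_mono fun y => ?_
  rw [neg_add_eq_sub, mul_comm (peetre _ _ _), mul_assoc]
  exact mul_le_mul' le_rfl (wt_sub_le N L x y)

theorem le_wt_lconv (N : ℕ) (L : V ≃L[ℝ] V) {g : V → ℝ≥0∞} (hg : Measurable g) (x : V) :
    (∫⁻ y, (peetre N L y)⁻¹ * g y) * wt N L x ≤ (wt N L ⋆ₗ g) x := by
  rw [lconvolution_comm, lconvolution_def, ← lintegral_mul_const _ (by fun_prop)]
  refine lintegral_mono fun y => ?_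
  rw [neg_add_eq_sub, mul_comm (peetre _ _ _)⁻¹, mul_assoc]
  refine mul_le_mul' le_rfl ?_
  have h0 : peetre N L y ≠ 0 := by
    unfold peetre
    rw [Ne, ENNReal.ofReal_eq_zero, not_le]; positivity
  have h1 : peetre N L y ≠ ⊤ := ENNReal.ofReal_ne_top
  rw [mul_comm, ← div_eq_mul_inv]
  exact ENNReal.div_le_of_le_mul (by rw [mul_comm]; exact wt_le_sub N L x y)

/-- The kernel whose Fourier transform is `ρ ∘ L⁻¹` translated by `v`. -/
def kap (L : V ≃L[ℝ] V) (ρ : 𝓢(V, ℂ)) (v : V) : 𝓢(V, ℂ) :=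
  𝓕⁻ (SchwartzMap.compSubConstCLM ℂ v (SchwartzMap.compCLMOfContinuousLinearEquiv ℂ L.symm ρ))

theorem fourier_kap (L : V ≃L[ℝ] V) (ρ : 𝓢(V, ℂ)) (v ξ : V) :
    𝓕 (kap L ρ v) ξ = ρ (L.symm (ξ - v)) := by
  rw [kap, FourierTransform.fourier_fourierInv_eq]
  simp

theorem kap_apply (L : V ≃L[ℝ] V) (ρ : 𝓢(V, ℂ)) (v y : V) :
    kap L ρ v y = 𝐞 (inner ℝ v y) • dk L ρ y := by
  rw [kap, dk, SchwartzMap.fourierInv_coe, SchwartzMap.fourierInv_coe, Real.fourierInv_eq,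
    Real.fourierInv_eq, Circle.smul_def, smul_eq_mul, ← integral_const_mul,
    ← integral_add_right_eq_self _ v]
  congr with η
  simp [inner_add_left, AddChar.map_add_eq_mul, Circle.smul_def]
  ring

/-- The function `y ↦ κ y * F (x - y)`. -/
def window (κ F : 𝓢(V, ℂ)) (x : V) : 𝓢(V, ℂ) :=
  SchwartzMap.pairing (ContinuousLinearMap.mul ℂ ℂ) κ
    (SchwartzMap.compSubConstCLM ℂ x
      (SchwartzMap.compCLMOfContinuousLinearEquiv ℂ (ContinuousLinearEquiv.neg ℝ) F))

theorem window_apply (κ F : 𝓢(V, ℂ)) (x y : V) : window κ F x y = κ y * F (x - y) := by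
  simp [window, SchwartzMap.pairing_apply_apply]

theorem conv_kap (L : V ≃L[ℝ] V) (ρ F : 𝓢(V, ℂ)) (v x : V) :
    conv (kap L ρ v) F x = 𝓕⁻ (window (dk L ρ) F x) v := by
  rw [conv_apply, SchwartzMap.fourierInv_coe, Real.fourierInv_eq]
  congr with y
  rw [kap_apply, window_apply, real_inner_comm, smul_mul_assoc]

/-- For fixed `x`, the function `v ↦ conv (kap L ρ v) F x` is the inverse Fourier transform of a
windowed copy of `F`, so Plancherel in `v` gives an exact identity. -/
theorem lintegral_conv_kap (L : V ≃L[ℝ] V) (ρ F : 𝓢(V, ℂ)) (x : V) :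
    ∫⁻ v, ‖conv (kap L ρ v) F x‖ₑ ^ 2 =
      ((fun y => ‖dk L ρ y‖ₑ ^ 2) ⋆ₗ fun y => ‖F y‖ₑ ^ 2) x := by
  simp only [conv_kap]
  rw [lintegral_enorm_fourierInv_sq, lconvolution_def]
  simp [window_apply, enorm_mul, mul_pow, neg_add_eq_sub]

theorem measurable_conv_kap (L : V ≃L[ℝ] V) (ρ F : 𝓢(V, ℂ)) :
    Measurable fun p : V × V => ‖conv (kap L ρ p.1) F p.2‖ₑ ^ 2 := by
  have h : (fun p : V × V => conv (kap L ρ p.1) F p.2) =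
      fun p : V × V => ∫ y, 𝐞 (inner ℝ p.1 y) • dk L ρ y * F (p.2 - y) := by
    ext p
    rw [conv_apply]
    simp only [kap_apply]
  have hc : Continuous fun q : (V × V) × V =>
      𝐞 (inner ℝ q.1.1 q.2) • dk L ρ q.2 * F (q.1.2 - q.2) := by
    have h1 := (dk L ρ).continuous
    have h2 := F.continuous
    have h3 := Real.continuous_fourierChar
    fun_prop
  have hm : StronglyMeasurable fun p : V × V => conv (kap L ρ p.1) F p.2 := by
    rw [h]
    exact hc.stronglyMeasurable.integral_prod_right'
  exact hm.enorm.pow_const 2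

theorem measurable_enorm_sq (g : 𝓢(V, ℂ)) : Measurable fun x => ‖g x‖ₑ ^ 2 :=
  (measurable_enorm_schwartz g).pow_const 2

/-- The constants `a` and `b` are moments of `|𝓕⁻ ρ|²` and do not see `L`: after the change of
variables `y ↦ L y` the determinants collect in the single factor `d`, which cancels in
`local_orthogonality`. -/
theorem exists_window_bounds (N : ℕ) (ρ : 𝓢(V, ℂ)) (hρ : ρ ≠ 0) : ∃ a b : ℝ≥0∞,
    a ≠ 0 ∧ a ≠ ⊤ ∧ b ≠ ⊤ ∧ ∀ L : V ≃L[ℝ] V, SelfAdj L → ∃ d : ℝ≥0∞, d ≠ 0 ∧ d ≠ ⊤ ∧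
      ∀ x, d * a * wt N L x ≤ (wt N L ⋆ₗ fun y => ‖dk L ρ y‖ₑ ^ 2) x ∧
        (wt N L ⋆ₗ fun y => ‖dk L ρ y‖ₑ ^ 2) x ≤ d * b * wt N L x := by
  set h : V → ℝ≥0∞ := fun y => ‖𝓕⁻ ρ y‖ₑ ^ 2 with hh
  have hhm : Measurable h := (measurable_enorm_schwartz _).pow_const 2
  set a : ℝ≥0∞ := ∫⁻ y, (ENNReal.ofReal ((1 + ‖y‖) ^ N))⁻¹ * h y with ha
  set b : ℝ≥0∞ := ∫⁻ y, ENNReal.ofReal ((1 + ‖y‖) ^ N) * h y with hb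
  have hb_top : b ≠ ⊤ := by
    obtain ⟨C, hC0, hC⟩ := exists_decay (𝓕⁻ ρ) (N + (Module.finrank ℝ V + 1))
    have hle : ∀ y, ENNReal.ofReal ((1 + ‖y‖) ^ N) * h y ≤ ENNReal.ofReal (C ^ 2) *
        ENNReal.ofReal ((1 + ‖y‖) ^ (Module.finrank ℝ V + 1))⁻¹ := fun y => by
      rw [hh, ← ENNReal.ofReal_mul (by positivity)]
      simp only [← ofReal_norm]
      rw [← ENNReal.ofReal_pow (norm_nonneg _), ← ENNReal.ofReal_mul (by positivity)]
      apply ENNReal.ofReal_le_ofReal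
      have h1 : (1 : ℝ) ≤ (1 + ‖y‖) := by linarith [norm_nonneg y]
      have h2 : ‖𝓕⁻ ρ y‖ ≤ C := (hC y).trans (mul_le_of_le_one_right hC0
        (inv_le_one_of_one_le₀ (one_le_pow₀ h1)))
      calc (1 + ‖y‖) ^ N * ‖𝓕⁻ ρ y‖ ^ 2 = (1 + ‖y‖) ^ N * (‖𝓕⁻ ρ y‖ * ‖𝓕⁻ ρ y‖) := by ring
        _ ≤ (1 + ‖y‖) ^ N * (C * (C * ((1 + ‖y‖) ^ (N + (Module.finrank ℝ V + 1)))⁻¹)) := by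
            gcongr
            exact hC y
        _ = C ^ 2 * ((1 + ‖y‖) ^ (Module.finrank ℝ V + 1))⁻¹ := by
            rw [pow_add]; field_simp
    refine ne_top_of_le_ne_top ?_ (lintegral_mono hle)
    rw [lintegral_const_mul _ (by fun_prop)]
    exact ENNReal.mul_ne_top ENNReal.ofReal_ne_top (wtMass_ne_top (by omega))
  have ha0 : a ≠ 0 := by
    have hρ' : 𝓕⁻ ρ ≠ 0 := fun h0 => hρ (by
      have : 𝓕 (𝓕⁻ ρ) = 𝓕 (0 : 𝓢(V, ℂ)) := by rw [h0]
      rw [FourierTransform.fourier_fourierInv_eq, FourierTransform.fourier_zero] at this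
      exact this)
    rw [ha, Ne, lintegral_eq_zero_iff (by fun_prop)]
    intro h0
    apply hρ'
    have h1 : ((𝓕⁻ ρ : 𝓢(V, ℂ)) : V → ℂ) =ᵐ[volume] fun _ => (0 : ℂ) := by
      filter_upwards [h0] with y hy
      simpa [hh] using hy
    have h2 := (Continuous.ae_eq_iff_eq volume (𝓕⁻ ρ).continuous continuous_const).1 h1
    ext y
    exact congrFun h2 y
  have ha_top : a ≠ ⊤ := by
    refine ne_top_of_le_ne_top hb_top (lintegral_mono fun y => mul_le_mul' ?_ le_rfl)
    have h1 : (1 : ℝ≥0∞) ≤ ENNReal.ofReal ((1 + ‖y‖) ^ N) := by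
      rw [ENNReal.one_le_ofReal]
      exact one_le_pow₀ (by linarith [norm_nonneg y])
    exact (ENNReal.inv_le_one.2 h1).trans h1
  refine ⟨a, b, ha0, ha_top, hb_top, fun L hL => ?_⟩
  set d : ℝ≥0∞ := ENNReal.ofReal |LinearMap.det (L : V →ₗ[ℝ] V)| with hd
  have hd0 : d ≠ 0 := by
    rw [hd, Ne, ENNReal.ofReal_eq_zero, not_le]; exact abs_pos.2 (det_ne_zero L)
  have hd_top : d ≠ ⊤ := ENNReal.ofReal_ne_top
  have hΩm := measurable_enorm_sq (dk L ρ)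
  have hΩe : ∀ y, ‖dk L ρ y‖ₑ ^ 2 = d * (d * h (L y)) := fun y => by
    simp only [enorm_dk hL, hh, mul_pow]; ring
  have hLm : Measurable L := L.continuous.measurable
  refine ⟨d, hd0, hd_top, fun x => ⟨?_, ?_⟩⟩
  · refine le_trans (le_of_eq ?_) (le_wt_lconv N L hΩm x)
    congr 1
    simp only [hΩe, peetre]
    rw [ha, ← lintegral_comp_equiv L (g := fun y => (ENNReal.ofReal ((1 + ‖y‖) ^ N))⁻¹ * h y)
      (by fun_prop), ← hd, ← lintegral_const_mul _ (by fun_prop),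
      ← lintegral_const_mul _ (by fun_prop)]
    congr with y
    ring
  · refine (wt_lconv_le N L hΩm x).trans (le_of_eq ?_)
    congr 1
    simp only [hΩe, peetre]
    rw [hb, ← lintegral_comp_equiv L (g := fun y => ENNReal.ofReal ((1 + ‖y‖) ^ N) * h y)
      (by fun_prop), ← hd, ← lintegral_const_mul _ (by fun_prop),
      ← lintegral_const_mul _ (by fun_prop)]
    congr with y
    ring

theorem measurable_lconv_conv_kap {w : V → ℝ≥0∞} (hw : Measurable w) (L : V ≃L[ℝ] V)
    (ρ F : 𝓢(V, ℂ)) (x : V) :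
    Measurable fun p : V × V => w p.2 * ‖conv (kap L ρ p.1) F (-p.2 + x)‖ₑ ^ 2 := by
  have h1 : Measurable fun p : V × V => (p.1, -p.2 + x) := by fun_prop
  have h2 : Measurable fun p : V × V => w p.2 := hw.comp measurable_snd
  have h3 := measurable_conv_kap L ρ F
  have h4 := h3.comp h1
  simp only [Function.comp_def] at h4
  exact Measurable.mul h2 h4

theorem lintegral_lconv_conv_kap {w : V → ℝ≥0∞} (hw : Measurable w) (L : V ≃L[ℝ] V)
    (ρ F : 𝓢(V, ℂ)) (x : V) :
    ∫⁻ v, (w ⋆ₗ fun y => ‖conv (kap L ρ v) F y‖ₑ ^ 2) x =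
      ((w ⋆ₗ fun y => ‖dk L ρ y‖ₑ ^ 2) ⋆ₗ fun y => ‖F y‖ₑ ^ 2) x := by
  rw [← lconvolution_assoc hw (measurable_enorm_sq _) (measurable_enorm_sq _), lconvolution_def]
  simp only [lconvolution_def (f := w) (g := fun y => ‖conv (kap L ρ _) F y‖ₑ ^ 2)]
  rw [lintegral_lintegral_swap (measurable_lconv_conv_kap hw L ρ F x).aemeasurable]
  congr with y
  rw [lintegral_const_mul, lintegral_conv_kap]
  have h1 : Measurable fun v : V => (v, -y + x) := by fun_prop
  have h3 := measurable_conv_kap L ρ F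
  have h4 := h3.comp h1
  simp only [Function.comp_def] at h4
  exact h4

theorem wt_lconv_conv_sq_le {w : V → ℝ≥0∞} (hw : Measurable w) (K g : 𝓢(V, ℂ)) {C₁ : ℝ≥0∞}
    (h1 : ∀ x, (w ⋆ₗ fun y => ‖K y‖ₑ) x ≤ C₁ * w x) (h2 : ∫⁻ y, ‖K y‖ₑ ≤ C₁) (x : V) :
    (w ⋆ₗ fun y => ‖conv K g y‖ₑ ^ 2) x ≤ C₁ ^ 2 * (w ⋆ₗ fun y => ‖g y‖ₑ ^ 2) x := by
  have hKm := measurable_enorm_schwartz K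
  have hg := measurable_enorm_sq g
  calc _ ≤ (w ⋆ₗ fun y => C₁ * ((fun y => ‖K y‖ₑ) ⋆ₗ fun y => ‖g y‖ₑ ^ 2) y) x :=
        lconv_mono (fun _ => le_rfl) (fun y => (enorm_conv_sq_le _ _ y).trans
          (mul_le_mul' h2 le_rfl)) x
    _ = C₁ * ((w ⋆ₗ fun y => ‖K y‖ₑ) ⋆ₗ fun y => ‖g y‖ₑ ^ 2) x := by
        rw [lconv_const_mul _ hw (measurable_lconvolution _ hKm hg),
          lconvolution_assoc hw hKm hg]
    _ ≤ C₁ * ((fun y => C₁ * w y) ⋆ₗ fun y => ‖g y‖ₑ ^ 2) x :=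
        mul_le_mul' le_rfl (lconv_mono h1 (fun _ => le_rfl) x)
    _ = _ := by rw [const_mul_lconv _ hw hg]; ring

/-- For `j` outside `J'` the multipliers of `K j` and `κ` have product zero and the term vanishes;
the at most `J'.card` remaining terms are bounded one at a time. -/
theorem wt_lconv_sum_conv_sq_le {w : V → ℝ≥0∞} (hw : Measurable w) {ι : Type*} (J J' : Finset ι)
    (K : ι → 𝓢(V, ℂ)) (κ f : 𝓢(V, ℂ)) {C₁ : ℝ≥0∞}
    (h1 : ∀ j ∈ J, ∀ x, (w ⋆ₗ fun y => ‖K j y‖ₑ) x ≤ C₁ * w x)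
    (h2 : ∀ j ∈ J, ∫⁻ y, ‖K j y‖ₑ ≤ C₁)
    (h3 : ∀ j ∈ J, j ∉ J' → ∀ ξ, 𝓕 (K j) ξ = 0 ∨ 𝓕 κ ξ = 0) (x : V) :
    ∑ j ∈ J, (w ⋆ₗ fun y => ‖conv κ (conv (K j) f) y‖ₑ ^ 2) x ≤
      C₁ ^ 2 * J'.card * (w ⋆ₗ fun y => ‖conv κ f y‖ₑ ^ 2) x := by
  classical
  simp only [fun j => conv_left_comm κ (K j) f]
  rw [← Finset.sum_subset (Finset.inter_subset_left : J ∩ J' ⊆ J)]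
  · calc _ ≤ ∑ j ∈ J ∩ J', C₁ ^ 2 * (w ⋆ₗ fun y => ‖conv κ f y‖ₑ ^ 2) x :=
          Finset.sum_le_sum fun j hj => wt_lconv_conv_sq_le hw _ _
            (h1 j (Finset.mem_inter.1 hj).1) (h2 j (Finset.mem_inter.1 hj).1) x
      _ ≤ _ := by
          rw [Finset.sum_const, nsmul_eq_mul, ← mul_assoc, mul_comm ((J ∩ J').card : ℝ≥0∞)]
          gcongr
          exact Finset.inter_subset_right
  · intro j hj hj'
    have hj'' : j ∉ J' := fun hh => hj' (Finset.mem_inter.2 ⟨hj, hh⟩)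
    have : conv (K j) (conv κ f) = 0 := by
      refine ext_fourier fun ξ => ?_
      rw [fourier_conv, fourier_conv, FourierTransform.fourier_zero]
      rcases h3 j hj hj'' ξ with h0 | h0 <;> rw [h0] <;> simp
    rw [this]
    simp [lconvolution_def]

/-- Local orthogonality: operators whose frequency supports have bounded overlap with the translates
of a box satisfy a weighted square function estimate, the weight being adapted to the dual box. -/
theorem local_orthogonality (N : ℕ) (ρ : 𝓢(V, ℂ)) (hρ : ρ ≠ 0) : ∃ C : ℝ≥0∞, C ≠ ⊤ ∧
    ∀ (L : V ≃L[ℝ] V), SelfAdj L → ∀ {ι : Type} (J : Finset ι) (K : ι → 𝓢(V, ℂ)) (C₁ : ℝ≥0∞) (C₂ : ℕ),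
      (∀ j ∈ J, ∀ x, (wt N L ⋆ₗ fun y => ‖K j y‖ₑ) x ≤ C₁ * wt N L x) →
      (∀ j ∈ J, ∫⁻ y, ‖K j y‖ₑ ≤ C₁) →
      (∀ v, ∃ J' : Finset ι, J'.card ≤ C₂ ∧
        ∀ j ∈ J, j ∉ J' → ∀ ξ, 𝓕 (K j) ξ = 0 ∨ ρ (L.symm (ξ - v)) = 0) →
      ∀ (f : 𝓢(V, ℂ)) (x : V), (wt N L ⋆ₗ fun y => ∑ j ∈ J, ‖conv (K j) f y‖ₑ ^ 2) x ≤
        C * (C₁ ^ 2 * C₂) * (wt N L ⋆ₗ fun y => ‖f y‖ₑ ^ 2) x := by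
  obtain ⟨a, b, ha0, ha_top, hb_top, H⟩ := exists_window_bounds N ρ hρ
  refine ⟨b / a, (ENNReal.div_lt_top hb_top ha0).ne, ?_⟩
  intro L hL ι J K C₁ C₂ hK1 hK2 hov f x
  obtain ⟨d, hd0, hd_top, hd⟩ := H L hL
  have hw : Measurable (wt N L) := measurable_wt _ _
  have perv : ∀ v, ∑ j ∈ J, (wt N L ⋆ₗ fun y => ‖conv (kap L ρ v) (conv (K j) f) y‖ₑ ^ 2) x ≤
      C₁ ^ 2 * C₂ * (wt N L ⋆ₗ fun y => ‖conv (kap L ρ v) f y‖ₑ ^ 2) x := by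
    intro v
    obtain ⟨J', hJ', hov⟩ := hov v
    refine (wt_lconv_sum_conv_sq_le hw J J' K (kap L ρ v) f hK1 hK2
      (fun j hj hj' ξ => by rw [fourier_kap]; exact hov j hj hj' ξ) x).trans ?_
    gcongr
  have hm : ∀ F : 𝓢(V, ℂ),
      Measurable fun v => (wt N L ⋆ₗ fun y => ‖conv (kap L ρ v) F y‖ₑ ^ 2) x := by
    intro F
    simp only [lconvolution_def]
    exact (measurable_lconv_conv_kap hw L ρ F x).lintegral_prod_right'
  have hsqm := measurable_enorm_sq (V := V)
  -- The weight is exchanged for `wt N L ⋆ₗ |dk L ρ|²`, which is an integral over all translates `v`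
  -- of the box. For each `v` at most `C₂` indices matter; after that the weight is restored.
  refine (ENNReal.mul_le_mul_iff_right (mul_ne_zero hd0 ha0) (ENNReal.mul_ne_top hd_top ha_top)).1 ?_
  calc _ = ∑ j ∈ J, ((fun y => d * a * wt N L y) ⋆ₗ fun y => ‖conv (K j) f y‖ₑ ^ 2) x := by
        rw [lconv_sum _ hw fun j _ => hsqm _, Finset.mul_sum]
        exact Finset.sum_congr rfl fun j _ => by rw [const_mul_lconv _ hw (hsqm _)]
    _ ≤ ∑ j ∈ J, ∫⁻ v, (wt N L ⋆ₗ fun y => ‖conv (kap L ρ v) (conv (K j) f) y‖ₑ ^ 2) x := by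
        refine Finset.sum_le_sum fun j _ => ?_
        rw [lintegral_lconv_conv_kap hw]
        exact lconv_mono (fun y => (hd y).1) (fun _ => le_rfl) x
    _ = ∫⁻ v, ∑ j ∈ J, (wt N L ⋆ₗ fun y => ‖conv (kap L ρ v) (conv (K j) f) y‖ₑ ^ 2) x :=
        (lintegral_finsetSum _ fun j _ => hm _).symm
    _ ≤ ∫⁻ v, C₁ ^ 2 * C₂ * (wt N L ⋆ₗ fun y => ‖conv (kap L ρ v) f y‖ₑ ^ 2) x := lintegral_mono perv
    _ = C₁ ^ 2 * C₂ * ((wt N L ⋆ₗ fun y => ‖dk L ρ y‖ₑ ^ 2) ⋆ₗ fun y => ‖f y‖ₑ ^ 2) x := by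
        rw [lintegral_const_mul _ (hm f), lintegral_lconv_conv_kap hw]
    _ ≤ C₁ ^ 2 * C₂ * ((fun y => d * b * wt N L y) ⋆ₗ fun y => ‖f y‖ₑ ^ 2) x :=
        mul_le_mul' le_rfl (lconv_mono (fun y => (hd y).2) (fun _ => le_rfl) x)
    _ = C₁ ^ 2 * C₂ * (d * b * (wt N L ⋆ₗ fun y => ‖f y‖ₑ ^ 2) x) := by
        rw [const_mul_lconv _ hw (hsqm f)]
    _ = d * (a * (b / a)) * (C₁ ^ 2 * C₂ * (wt N L ⋆ₗ fun y => ‖f y‖ₑ ^ 2) x) := by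
        rw [ENNReal.mul_div_cancel ha0 ha_top]; ring
    _ = _ := by ring

end LocalOrthogonality

/-! ### Spectra of products and almost orthogonality. -/

section Products

variable {V : Type*} [NormedAddCommGroup V] [InnerProductSpace ℝ V] [FiniteDimensional ℝ V]
  [MeasurableSpace V] [BorelSpace V]

/-- The complex conjugate of a Schwartz function. -/
def conjS (g : 𝓢(V, ℂ)) : 𝓢(V, ℂ) := SchwartzMap.postcompCLM (𝕜 := ℝ) Complex.conjCLE.toContinuousLinearMap g

theorem conjS_apply (g : 𝓢(V, ℂ)) (x : V) : conjS g x = starRingEnd ℂ (g x) := by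
  simp [conjS]

theorem fourier_conjS (g : 𝓢(V, ℂ)) (ξ : V) : 𝓕 (conjS g) ξ = starRingEnd ℂ (𝓕 g (-ξ)) := by
  rw [SchwartzMap.fourier_coe, SchwartzMap.fourier_coe, Real.fourier_eq, Real.fourier_eq,
    ← integral_conj]
  congr with v
  rw [conjS_apply]
  simp [Circle.smul_def, ← Circle.coe_inv_eq_conj, AddChar.map_neg_eq_inv]

/-- The product of a Schwartz function and the conjugate of another. -/
def mulConj (f g : 𝓢(V, ℂ)) : 𝓢(V, ℂ) :=
  SchwartzMap.pairing (ContinuousLinearMap.mul ℂ ℂ) f (conjS g)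

theorem mulConj_apply (f g : 𝓢(V, ℂ)) (x : V) : mulConj f g x = f x * starRingEnd ℂ (g x) := by
  simp [mulConj, SchwartzMap.pairing_apply_apply, conjS_apply]

theorem fourier_fourier_apply (f : 𝓢(V, ℂ)) (x : V) : 𝓕 (𝓕 f) x = f (-x) := by
  have h : 𝓕⁻ (𝓕 f) (-x) = f (-x) := by rw [FourierTransform.fourierInv_fourier_eq]
  rw [← h, SchwartzMap.fourierInv_coe, SchwartzMap.fourier_coe (𝓕 f),
    Real.fourierInv_eq_fourier_neg, neg_neg]

theorem fourier_mulConj (f g : 𝓢(V, ℂ)) : 𝓕 (mulConj f g) = conv (𝓕 f) (𝓕 (conjS g)) := by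
  refine ext_fourier fun x => ?_
  rw [fourier_conv, fourier_fourier_apply, fourier_fourier_apply, fourier_fourier_apply,
    mulConj_apply, conjS_apply]

/-- The Fourier transform of `f * conj g` is a correlation, hence lives on differences of
frequencies. This locates the spectrum of the squares `|F|²`. -/
theorem exists_of_fourier_mulConj_ne_zero {f g : 𝓢(V, ℂ)} {ξ : V} (h : 𝓕 (mulConj f g) ξ ≠ 0) :
    ∃ η η', 𝓕 f η ≠ 0 ∧ 𝓕 g η' ≠ 0 ∧ ξ = η - η' := by
  by_contra! hc
  apply h
  rw [fourier_mulConj, conv_apply]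
  refine integral_eq_zero_of_ae (Filter.Eventually.of_forall fun y => ?_)
  by_cases hf : 𝓕 f y = 0
  · simp [hf]
  · have : 𝓕 g (y - ξ) = 0 := by
      by_contra hg
      exact hc y (y - ξ) hf hg (by abel)
    simp [fourier_conjS, this]

theorem fourier_sum {ι : Type*} (s : Finset ι) (u : ι → 𝓢(V, ℂ)) (ξ : V) :
    𝓕 (∑ i ∈ s, u i) ξ = ∑ i ∈ s, 𝓕 (u i) ξ := by
  classical
  induction s using Finset.induction_on with
  | empty => simp [FourierTransform.fourier_zero]
  | insert a s ha ih => rw [Finset.sum_insert ha, Finset.sum_insert ha, FourierTransform.fourier_add,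
      add_apply, ih]

theorem sum_schwartz_apply {ι : Type*} (s : Finset ι) (u : ι → 𝓢(V, ℂ)) (x : V) :
    (∑ i ∈ s, u i) x = ∑ i ∈ s, u i x := by
  classical
  induction s using Finset.induction_on with
  | empty => simp
  | insert a s ha ih => rw [Finset.sum_insert ha, Finset.sum_insert ha, add_apply, ih]

theorem conv_sum {ι : Type*} (s : Finset ι) (K : 𝓢(V, ℂ)) (u : ι → 𝓢(V, ℂ)) :
    conv K (∑ i ∈ s, u i) = ∑ i ∈ s, conv K (u i) :=
  ext_fourier fun ξ => by simp only [fourier_conv, fourier_sum, Finset.mul_sum]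

theorem enorm_sum_sq_le {ι : Type*} (s : Finset ι) (a : ι → ℂ) :
    ‖∑ i ∈ s, a i‖ₑ ^ 2 ≤ s.card * ∑ i ∈ s, ‖a i‖ₑ ^ 2 := by
  have h1 : ‖∑ i ∈ s, a i‖ ^ 2 ≤ s.card * ∑ i ∈ s, ‖a i‖ ^ 2 :=
    (pow_le_pow_left₀ (norm_nonneg _) (norm_sum_le _ _) 2).trans sq_sum_le_card_mul_sum_sq
  have h2 := ENNReal.ofReal_le_ofReal h1
  rw [ENNReal.ofReal_mul (by positivity), ENNReal.ofReal_sum_of_nonneg fun i _ => by positivity] at h2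
  simpa [ENNReal.ofReal_pow, ofReal_norm] using h2

/-- Almost orthogonality of functions whose Fourier supports have bounded overlap. -/
theorem lintegral_enorm_sum_sq_le {ι : Type*} (s : Finset ι) (u : ι → 𝓢(V, ℂ)) (C : ℕ)
    (h : ∀ ξ, ∃ t : Finset ι, t.card ≤ C ∧ ∀ i ∈ s, 𝓕 (u i) ξ ≠ 0 → i ∈ t) :
    ∫⁻ x, ‖(∑ i ∈ s, u i) x‖ₑ ^ 2 ≤ C * ∑ i ∈ s, ∫⁻ x, ‖u i x‖ₑ ^ 2 := by
  classical
  refine lintegral_sq_le_of_fourier s _ u C fun ξ => ?_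
  obtain ⟨t, ht, hs⟩ := h ξ
  rw [fourier_sum, ← Finset.sum_subset (Finset.inter_subset_left : s ∩ t ⊆ s)]
  · refine (enorm_sum_sq_le _ _).trans ?_
    gcongr
    · exact (Finset.card_le_card Finset.inter_subset_right).trans ht
    · exact Finset.inter_subset_left
  · intro i hi hi'
    by_contra h0
    exact hi' (Finset.mem_inter.2 ⟨hi, hs i hi h0⟩)

end Products

/-! ### Linear maps with separate scales along and across a direction. -/

section Boxes

variable {V : Type*} [NormedAddCommGroup V] [InnerProductSpace ℝ V] [FiniteDimensional ℝ V]
  [MeasurableSpace V] [BorelSpace V]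

/-- The linear map that multiplies the line spanned by `e` by `a` and its complement by `b`. -/
def boxLin (e : V) (a b : ℝ) : V →ₗ[ℝ] V where
  toFun x := b • x + ((a - b) * inner ℝ e x) • e
  map_add' x y := by simp only [inner_add_right, mul_add, add_smul, smul_add]; abel
  map_smul' c x := by
    simp only [inner_smul_right, RingHom.id_apply, smul_add, smul_smul]
    congr 2 <;> ring

theorem boxLin_apply (e : V) (a b : ℝ) (x : V) :
    boxLin e a b x = b • x + ((a - b) * inner ℝ e x) • e := rfl

theorem boxLin_boxLin {e : V} (he : ‖e‖ = 1) (a b a' b' : ℝ) (x : V) :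
    boxLin e a b (boxLin e a' b' x) = boxLin e (a * a') (b * b') x := by
  have h1 : inner ℝ e e = (1 : ℝ) := by rw [real_inner_self_eq_norm_sq, he]; norm_num
  simp only [boxLin_apply, inner_add_right, inner_smul_right, h1, smul_add, smul_smul, add_assoc,
    ← add_smul]
  congr 2
  ring

theorem boxLin_self (e : V) (a : ℝ) (x : V) : boxLin e a a x = a • x := by simp [boxLin_apply]

/-- The invertible map that multiplies the line spanned by `e` by `a` and its complement by `b`. -/
def box (e : V) (he : ‖e‖ = 1) (a b : ℝ) (ha : 0 < a) (hb : 0 < b) : V ≃L[ℝ] V :=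
  LinearEquiv.toContinuousLinearEquiv
    { boxLin e a b with
      invFun := boxLin e a⁻¹ b⁻¹
      left_inv := fun x => by
        change boxLin e a⁻¹ b⁻¹ (boxLin e a b x) = x
        rw [boxLin_boxLin he, inv_mul_cancel₀ ha.ne', inv_mul_cancel₀ hb.ne', boxLin_self, one_smul]
      right_inv := fun x => by
        change boxLin e a b (boxLin e a⁻¹ b⁻¹ x) = x
        rw [boxLin_boxLin he, mul_inv_cancel₀ ha.ne', mul_inv_cancel₀ hb.ne', boxLin_self, one_smul] }

variable {e : V} (he : ‖e‖ = 1) {a b : ℝ} (ha : 0 < a) (hb : 0 < b)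

theorem box_apply (x : V) : box e he a b ha hb x = boxLin e a b x := rfl

theorem box_symm_apply (x : V) : (box e he a b ha hb).symm x = boxLin e a⁻¹ b⁻¹ x := rfl

theorem selfAdj_box : SelfAdj (box e he a b ha hb) := fun x y => by
  simp only [box_apply, boxLin_apply, inner_add_left, inner_add_right, inner_smul_left,
    inner_smul_right, real_inner_comm e]
  simp
  ring

theorem box_self : box e he a a ha ha = dil a ha.ne' := by
  ext x
  rw [box_apply, boxLin_self, dil_apply]

theorem norm_boxLin_sq (he : ‖e‖ = 1) (a b : ℝ) (x : V) :
    ‖boxLin e a b x‖ ^ 2 = (a * inner ℝ e x) ^ 2 + (b * ‖x - (inner ℝ e x : ℝ) • e‖) ^ 2 := by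
  have h1 : inner ℝ e e = (1 : ℝ) := by rw [real_inner_self_eq_norm_sq, he]; norm_num
  rw [mul_pow b, ← real_inner_self_eq_norm_sq, ← real_inner_self_eq_norm_sq, boxLin_apply]
  simp only [inner_add_left, inner_add_right, inner_smul_left, inner_sub_left, inner_sub_right,
    inner_smul_right, real_inner_comm e, h1]
  simp
  ring

theorem norm_sub_inner_smul_le (he : ‖e‖ = 1) (x : V) (c : ℝ) : ‖x - (inner ℝ e x : ℝ) • e‖ ≤ ‖x - c • e‖ := by
  have h1 : inner ℝ e e = (1 : ℝ) := by rw [real_inner_self_eq_norm_sq, he]; norm_num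
  refine le_of_sq_le_sq ?_ (norm_nonneg _)
  rw [← real_inner_self_eq_norm_sq, ← real_inner_self_eq_norm_sq]
  simp only [inner_sub_left, inner_sub_right, inner_smul_left, inner_smul_right,
    real_inner_comm e, h1]
  simp
  nlinarith [sq_nonneg (inner ℝ e x - c)]

/-- The multiple of `e` nearest to `x` is the orthogonal projection, so any other multiple `c • e`
gives an upper bound. The freedom in `c` allows norms of frequencies to replace inner products. -/
theorem norm_boxLin_le (he : ‖e‖ = 1) (a b c : ℝ) (x : V) :
    ‖boxLin e a b x‖ ≤ |a| * |inner ℝ e x| + |b| * ‖x - c • e‖ := by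
  calc ‖boxLin e a b x‖ ≤ |a| * |inner ℝ e x| + |b| * ‖x - (inner ℝ e x : ℝ) • e‖ := by
        refine le_of_sq_le_sq ?_ (by positivity)
        rw [norm_boxLin_sq he, ← abs_mul, mul_pow b, ← sq_abs (a * _), ← sq_abs b]
        have : 0 ≤ |a * inner ℝ e x| * (|b| * ‖x - (inner ℝ e x : ℝ) • e‖) := by positivity
        nlinarith
    _ ≤ _ := by
        gcongr
        exact norm_sub_inner_smul_le he x c

theorem abs_mul_inner_le_norm_boxLin (he : ‖e‖ = 1) (a b : ℝ) (x : V) : |a * inner ℝ e x| ≤ ‖boxLin e a b x‖ := by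
  refine abs_le_of_sq_le_sq ?_ (norm_nonneg _)
  rw [norm_boxLin_sq he]
  nlinarith [sq_nonneg (b * ‖x - (inner ℝ e x : ℝ) • e‖)]

theorem mul_norm_le_norm_boxLin (he : ‖e‖ = 1) {a b : ℝ} (hb : 0 ≤ b) (hab : b ≤ a) (x : V) :
    b * ‖x‖ ≤ ‖boxLin e a b x‖ := by
  refine le_of_sq_le_sq ?_ (norm_nonneg _)
  have h := norm_boxLin_sq he 1 1 x
  rw [boxLin_self, one_smul, one_mul, one_mul] at h
  rw [norm_boxLin_sq he, mul_pow, h]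
  nlinarith [mul_nonneg (sq_nonneg (inner ℝ e x)) (mul_nonneg (sub_nonneg.2 hab) (add_nonneg hb (hb.trans hab)))]

theorem norm_boxLin_sub_le (he : ‖e‖ = 1) {a b : ℝ} (x : V) :
    ‖boxLin e a b x - (a * inner ℝ e x) • e‖ ≤ |b| * ‖x‖ := by
  have : boxLin e a b x - (a * inner ℝ e x) • e = b • (x - (inner ℝ e x : ℝ) • e) := by
    rw [boxLin_apply, smul_sub, smul_smul, sub_mul, sub_smul]; abel
  rw [this, norm_smul, Real.norm_eq_abs]
  gcongr
  simpa using norm_sub_inner_smul_le he x 0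

end Boxes

/-! ### Counting separated points and directions. -/

section Counting

variable {V : Type*} [NormedAddCommGroup V] [InnerProductSpace ℝ V] [FiniteDimensional ℝ V]
  [MeasurableSpace V] [BorelSpace V] {ι : Type*}

/-- Volume packing: the balls of radius `r / 2` about the points are disjoint and lie in the ball of
radius `(C + 1/2) r` about `c`. -/
theorem card_le_of_separated {θ : ι → V} {r : ℝ} (hr : 0 < r) (t : Finset ι)
    (hsep : ∀ i ∈ t, ∀ j ∈ t, i ≠ j → r ≤ ‖θ i - θ j‖) (c : V) (C : ℕ)
    (hc : ∀ i ∈ t, ‖θ i - c‖ ≤ C * r) : t.card ≤ (2 * C + 1) ^ Module.finrank ℝ V := by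
  set μ : Measure V := volume
  have hd : (t : Set ι).PairwiseDisjoint fun i => Metric.ball (θ i) (r * (1 / 2)) := by
    intro i hi j hj hij
    apply Metric.ball_disjoint_ball
    rw [dist_eq_norm]
    linarith [hsep i hi j hj hij]
  have hsub : (⋃ i ∈ t, Metric.ball (θ i) (r * (1 / 2))) ⊆ Metric.ball c (r * (C + 1 / 2)) := by
    refine Set.iUnion₂_subset fun i hi => Metric.ball_subset_ball' ?_
    rw [dist_eq_norm]
    linarith [hc i hi]
  have h1 := measure_mono (μ := μ) hsub
  rw [measure_biUnion_finset hd fun i _ => measurableSet_ball] at h1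
  simp only [mul_comm r] at h1
  simp only [Measure.addHaar_ball_mul_of_pos μ _ (by positivity : (0 : ℝ) < 1 / 2),
    Measure.addHaar_ball_mul_of_pos μ _ (by positivity : (0 : ℝ) < C + 1 / 2)] at h1
  rw [Finset.sum_const, nsmul_eq_mul, ← mul_assoc] at h1
  have hpos : μ (Metric.ball 0 r) ≠ 0 := (Metric.measure_ball_pos μ 0 hr).ne'
  have hfin : μ (Metric.ball 0 r) ≠ ⊤ := measure_ball_lt_top.ne
  rw [ENNReal.mul_le_mul_iff_left hpos hfin, ← ENNReal.ofReal_natCast,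
    ← ENNReal.ofReal_mul (by positivity), ENNReal.ofReal_le_ofReal_iff (by positivity)] at h1
  have h2 : ((C : ℝ) + 1 / 2) = (2 * C + 1) * (1 / 2) := by ring
  rw [h2, mul_pow] at h1
  have h3 := le_of_mul_le_mul_right h1 (by positivity)
  exact_mod_cast h3

/-- Only boundedly many separated points are close to one of two given antipodal points. -/
theorem exists_finset_near {θ : ι → V} {r : ℝ} (hr : 0 < r) (s : Finset ι)
    (hsep : ∀ i ∈ s, ∀ j ∈ s, i ≠ j → r ≤ ‖θ i - θ j‖) (u : V) (C : ℕ) :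
    ∃ t : Finset ι, t.card ≤ 2 * (2 * C + 1) ^ Module.finrank ℝ V ∧
      ∀ i ∈ s, ‖θ i - u‖ ≤ C * r ∨ ‖θ i + u‖ ≤ C * r → i ∈ t := by
  classical
  refine ⟨s.filter (fun i => ‖θ i - u‖ ≤ C * r) ∪ s.filter (fun i => ‖θ i - -u‖ ≤ C * r), ?_, ?_⟩
  · refine (Finset.card_union_le _ _).trans ?_
    rw [two_mul (_ ^ _)]
    refine add_le_add ?_ ?_
    all_goals
      refine card_le_of_separated hr _ (fun i hi j hj => hsep i (Finset.mem_filter.1 hi).1 j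
        (Finset.mem_filter.1 hj).1) _ C fun i hi => (Finset.mem_filter.1 hi).2
  · intro i hi h
    simp only [Finset.mem_union, Finset.mem_filter, hi, true_and, sub_neg_eq_add]
    exact h

theorem exists_maximal_separated (θ : ι → V) (r : ℝ) (s : Finset ι) :
    ∃ t ⊆ s, (∀ i ∈ t, ∀ j ∈ t, i ≠ j → r ≤ ‖θ i - θ j‖) ∧ ∀ j ∈ s, j ∉ t → ∃ i ∈ t, ‖θ j - θ i‖ ≤ r := by
  classical
  induction s using Finset.induction_on with
  | empty => exact ⟨∅, by simp⟩
  | insert a s ha ih =>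
    obtain ⟨t, hts, hsep, hmax⟩ := ih
    by_cases h : ∃ i ∈ t, ‖θ a - θ i‖ ≤ r
    · refine ⟨t, hts.trans (Finset.subset_insert _ _), hsep, fun j hj hjt => ?_⟩
      rcases Finset.mem_insert.1 hj with rfl | hj
      · exact h
      · exact hmax j hj hjt
    · push Not at h
      refine ⟨insert a t, Finset.insert_subset_insert _ hts, ?_, fun j hj hjt => ?_⟩
      · intro i hi j hj hij
        rcases Finset.mem_insert.1 hi with hi | hi <;> rcases Finset.mem_insert.1 hj with hj | hj
        · exact absurd (hi.trans hj.symm) hij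
        · rw [hi]; exact (h j hj).le
        · rw [hj, norm_sub_rev]; exact (h i hi).le
        · exact hsep i hi j hj hij
      · rw [Finset.mem_insert, not_or] at hjt
        rcases Finset.mem_insert.1 hj with rfl | hj
        · exact absurd rfl hjt.1
        · obtain ⟨i, hi, hij⟩ := hmax j hj hjt.2
          exact ⟨i, Finset.mem_insert_of_mem hi, hij⟩

/-- Since `‖η‖` and `|lam|` differ by at most `E`, replacing `lam` by `±‖η‖` costs another `E`. The
sign of `lam` is unknown, hence two antipodal alternatives here and in `exists_finset_near`. -/
theorem direction_near {e η : V} (he : ‖e‖ = 1) (hη : 0 < ‖η‖) {lam E : ℝ}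
    (h : ‖η - lam • e‖ ≤ E) :
    ‖e - ‖η‖⁻¹ • η‖ ≤ 2 * E / ‖η‖ ∨ ‖e + ‖η‖⁻¹ • η‖ ≤ 2 * E / ‖η‖ := by
  have h0 : abs (‖η‖ - |lam|) ≤ E := by
    refine le_trans ?_ ((abs_norm_sub_norm_le _ _).trans h)
    rw [norm_smul, he, Real.norm_eq_abs, mul_one]
  have key : ∀ σ : ℝ, |σ| = 1 → σ * |lam| = lam → ‖σ • e - ‖η‖⁻¹ • η‖ ≤ 2 * E / ‖η‖ := by
    intro σ hσ hl
    have e1 : σ • e - ‖η‖⁻¹ • η = ‖η‖⁻¹ • ((σ * (‖η‖ - |lam|)) • e - (η - lam • e)) := by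
      rw [mul_sub, hl, sub_smul, smul_sub, smul_sub, smul_sub, smul_smul ‖η‖⁻¹ (σ * ‖η‖),
        show ‖η‖⁻¹ * (σ * ‖η‖) = σ by field_simp]
      abel
    rw [e1, norm_smul, norm_inv, norm_norm, inv_mul_eq_div]
    gcongr
    refine (norm_sub_le _ _).trans ?_
    rw [norm_smul, he, Real.norm_eq_abs, abs_mul, hσ]
    linarith
  rcases le_total 0 lam with hl | hl
  · left
    simpa using key 1 (by simp) (by rw [abs_of_nonneg hl]; ring)
  · right
    have := key (-1) (by simp) (by rw [abs_of_nonpos hl]; ring)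
    rwa [show (-1 : ℝ) • e - ‖η‖⁻¹ • η = -(e + ‖η‖⁻¹ • η) by rw [neg_one_smul]; abel,
      norm_neg] at this

theorem finite_of_separated {θ : ι → V} {r : ℝ} (hr : 0 < r)
    (hsep : ∀ i j, i ≠ j → r ≤ ‖θ i - θ j‖) (hθ : ∀ i, ‖θ i‖ ≤ 1) : Finite ι := by
  by_contra h
  rw [not_finite_iff_infinite] at h
  obtain ⟨C, hC⟩ := exists_nat_ge r⁻¹
  obtain ⟨t, ht⟩ := Infinite.exists_subset_card_eq ι ((2 * C + 1) ^ Module.finrank ℝ V + 1)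
  have := card_le_of_separated hr t (fun i _ j _ => hsep i j) 0 C fun i _ => by
    rw [sub_zero]
    refine (hθ i).trans ?_
    rw [← inv_mul_cancel₀ hr.ne']
    gcongr
  omega

end Counting

/-! ### Quantitative bounds for all derivatives. -/

section DerivBounds

variable {E F G : Type*} [NormedAddCommGroup E] [NormedSpace ℝ E] [NormedAddCommGroup F]
  [NormedSpace ℝ F] [NormedAddCommGroup G] [NormedSpace ℝ G]

/-- `f` is smooth and its `k`-th derivative is bounded by `A k`, for every `k`. -/
def DerivBound (A : ℕ → ℝ) (f : E → F) : Prop :=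
  ContDiff ℝ ∞ f ∧ ∀ k x, ‖iteratedFDeriv ℝ k f x‖ ≤ A k

theorem natCast_le_infty (k : ℕ) : (k : WithTop ℕ∞) ≤ ((⊤ : ℕ∞) : WithTop ℕ∞) := mod_cast le_top

theorem exists_derivBound {f : E → F} (h1 : ContDiff ℝ ∞ f) (h2 : HasCompactSupport f) :
    ∃ A, DerivBound A f := by
  choose A hA using fun k => (h2.toSchwartzMap h1).decay 0 k
  exact ⟨A, h1, fun k x => by
    have := (hA k).2 x
    rw [pow_zero, one_mul] at this
    exact this⟩

/-- The derivative bounds of a product. -/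
def prodBound (A B : ℕ → ℝ) (k : ℕ) : ℝ :=
  ∑ i ∈ Finset.range (k + 1), (k.choose i : ℝ) * A i * B (k - i)

theorem DerivBound.nonneg {A : ℕ → ℝ} {f : E → F} (h : DerivBound A f) (k : ℕ) : 0 ≤ A k :=
  (norm_nonneg _).trans (h.2 k 0)

theorem DerivBound.smul {A B : ℕ → ℝ} {f : E → ℝ} {g : E → F} (hf : DerivBound A f)
    (hg : DerivBound B g) : DerivBound (prodBound A B) fun x => f x • g x := by
  refine ⟨hf.1.smul hg.1, fun k x => (norm_iteratedFDeriv_smul_le hf.1 hg.1 x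
    (natCast_le_infty k)).trans (Finset.sum_le_sum fun i _ => ?_)⟩
  have := hf.nonneg i
  gcongr
  · exact hf.2 i x
  · exact hg.2 _ x

theorem DerivBound.clm_comp {A : ℕ → ℝ} {f : E → F} (hf : DerivBound A f) (L : F →L[ℝ] G)
    (hL : ‖L‖ ≤ 1) : DerivBound A (L ∘ f) := by
  refine ⟨L.contDiff.comp hf.1, fun k x => (L.norm_iteratedFDeriv_comp_left hf.1.contDiffAt
    (natCast_le_infty k)).trans ?_⟩
  exact (mul_le_of_le_one_left (norm_nonneg _) hL).trans (hf.2 k x)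

theorem DerivBound.comp_clm {A : ℕ → ℝ} {f : F → G} (hf : DerivBound A f) (L : E →L[ℝ] F)
    (hL : ‖L‖ ≤ 1) : DerivBound A (f ∘ L) := by
  refine ⟨hf.1.comp L.contDiff, fun k x => ?_⟩
  rw [L.iteratedFDeriv_comp_right hf.1 x (natCast_le_infty k)]
  refine (ContinuousMultilinearMap.norm_compContinuousLinearMap_le _ _).trans ?_
  rw [Finset.prod_const, Finset.card_fin]
  exact (mul_le_of_le_one_right (norm_nonneg _) (pow_le_one₀ (norm_nonneg _) hL)).trans (hf.2 k _)

/-- The derivative bounds of a composition. -/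
def compBound (A B : ℕ → ℝ) (k : ℕ) : ℝ :=
  k.factorial * (∑ i ∈ Finset.range (k + 1), A i) * (1 + ∑ i ∈ Finset.range (k + 1), B i) ^ k

/-- Composition with a function that is only defined on an open set, after adding a constant. -/
theorem DerivBound.comp_const_add {A B : ℕ → ℝ} {f : E → F} {g : F → G} {t : Set F}
    (ht : IsOpen t) (c : F) (hft : ∀ x, c + f x ∈ t) (hf : DerivBound B f) (hg : ContDiffOn ℝ ∞ g t)
    (hgA : ∀ k x, ‖iteratedFDeriv ℝ k g (c + f x)‖ ≤ A k) :
    DerivBound (compBound A B) fun x => g (c + f x) := by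
  have hcf : ContDiff ℝ ∞ fun x => c + f x := contDiff_const.add hf.1
  have hA : ∀ i, 0 ≤ A i := fun i => (norm_nonneg _).trans (hgA i 0)
  refine ⟨hg.comp_contDiff hcf hft, fun k x => ?_⟩
  refine norm_iteratedFDeriv_comp_le' (f := fun x => c + f x) (Set.range_subset_iff.2 hft)
    ht.uniqueDiffOn hg hcf (natCast_le_infty k) x ?_ ?_
  · intro i hi
    rw [iteratedFDerivWithin_of_isOpen i ht (hft x)]
    refine (hgA i x).trans ?_
    exact Finset.single_le_sum (f := A) (fun i _ => hA i) (Finset.mem_range.2 (by omega))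
  · intro i h1 hi
    have hs : (0 : ℝ) ≤ ∑ i ∈ Finset.range (k + 1), B i := Finset.sum_nonneg fun i _ => hf.nonneg i
    -- Only derivatives of positive order of the inner function enter, so the constant `c` does not
    -- affect the bound. In the application `c = δ⁻¹ • θ` is large.
    have e : iteratedFDeriv ℝ i (fun x => c + f x) x = iteratedFDeriv ℝ i f x := by
      have := fun_iteratedFDeriv_add_apply (𝕜 := ℝ) (i := i) (f := fun _ : E => c) (g := f) (x := x)
        contDiffAt_const (hf.1.contDiffAt.of_le (natCast_le_infty i))
      rw [this, iteratedFDeriv_const_of_ne (by omega)]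
      simp
    rw [e]
    refine (hf.2 i x).trans ?_
    calc B i ≤ ∑ i ∈ Finset.range (k + 1), B i :=
          Finset.single_le_sum (f := B) (fun i _ => hf.nonneg i) (Finset.mem_range.2 (by omega))
      _ ≤ 1 + ∑ i ∈ Finset.range (k + 1), B i := by linarith
      _ ≤ _ := le_self_pow₀ (by linarith) (by omega)

end DerivBounds

/-! ### Decay of Fourier transforms, uniform in derivative bounds. -/

section UniformDecay

variable {V : Type*} [NormedAddCommGroup V] [InnerProductSpace ℝ V] [FiniteDimensional ℝ V]
  [MeasurableSpace V] [BorelSpace V]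

/-- The Fourier transform of a function supported in a fixed ball decays, uniformly in terms of its
derivative bounds. -/
theorem exists_uniform_decay (N : ℕ) (A : ℕ → ℝ) (r : ℝ) : ∃ C : ℝ, 0 ≤ C ∧ ∀ M : 𝓢(V, ℂ),
    DerivBound A M → (∀ x, r < ‖x‖ → M x = 0) → ∀ y, ‖𝓕⁻ M y‖ ≤ C * ((1 + ‖y‖) ^ N)⁻¹ := by
  set q : Seminorm ℂ 𝓢(V, ℂ) :=
    ((Finset.Iic (N, 0)).sup (schwartzSeminormFamily ℂ V ℂ)).comp
      (FourierTransform.fourierInvCLM ℂ 𝓢(V, ℂ) : 𝓢(V, ℂ) →ₗ[ℂ] 𝓢(V, ℂ)) with hq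
  have hqc : Continuous q := by
    have h1 : Continuous ((Finset.Iic (N, 0)).sup (schwartzSeminormFamily ℂ V ℂ) : Seminorm ℂ 𝓢(V, ℂ)) := by
      apply Seminorm.continuous_finsetSup
      intro i _
      exact (schwartz_withSeminorms ℂ V ℂ).continuous_seminorm i
    exact h1.comp (FourierTransform.fourierInvCLM ℂ 𝓢(V, ℂ)).continuous
  -- Uniformity comes from continuity of `𝓕⁻` on Schwartz space: the decay seminorm of `𝓕⁻ M` is
  -- controlled by finitely many seminorms of `M`, and those by `A` and `r`.
  obtain ⟨s, C, hC0, hC⟩ := Seminorm.bound_of_continuous (schwartz_withSeminorms ℂ V ℂ) q hqc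
  set D : ℝ := ∑ i ∈ s, (|r| ^ i.1 * |A i.2|) with hD
  have hDn : 0 ≤ D := Finset.sum_nonneg fun i _ => by positivity
  refine ⟨2 ^ N * (C * D), by positivity, fun M hM hsupp y => ?_⟩
  have h1 := SchwartzMap.one_add_le_sup_seminorm_apply (𝕜 := ℂ) (m := (N, 0)) (k := N) (n := 0)
    le_rfl le_rfl (𝓕⁻ M) y
  rw [norm_iteratedFDeriv_zero, mul_comm] at h1
  rw [← div_eq_mul_inv, le_div_iff₀ (by positivity)]
  refine h1.trans ?_
  gcongr
  have h2 : q M ≤ C * (s.sup (schwartzSeminormFamily ℂ V ℂ)) M := hC M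
  refine le_trans h2 ?_
  gcongr
  refine Seminorm.finset_sup_apply_le hDn fun i hi => ?_
  refine le_trans ?_ (Finset.single_le_sum (f := fun i : ℕ × ℕ => |r| ^ i.1 * |A i.2|)
    (fun i _ => by positivity) hi)
  refine SchwartzMap.seminorm_le_bound ℂ _ _ _ (by positivity) fun x => ?_
  by_cases hx : ‖x‖ ≤ |r|
  · gcongr
    exact (hM.2 _ x).trans (le_abs_self _)
  · have hzero : iteratedFDeriv ℝ i.2 M x = 0 := by
      have hev : (M : V → ℂ) =ᶠ[nhds x] fun _ => 0 := by
        have : {z : V | |r| < ‖z‖} ∈ nhds x :=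
          (isOpen_lt continuous_const continuous_norm).mem_nhds (not_le.1 hx)
        filter_upwards [this] with z hz
        exact hsupp z ((le_abs_self r).trans_lt hz)
      rw [(hev.iteratedFDeriv ℝ i.2).eq_of_nhds]
      simp [iteratedFDeriv_fun_zero]
    rw [hzero]
    simp
    positivity

end UniformDecay

/-! ### Smooth radial cutoffs. -/

section Cutoffs

variable {V : Type*} [NormedAddCommGroup V] [InnerProductSpace ℝ V] [FiniteDimensional ℝ V]
  [MeasurableSpace V] [BorelSpace V]

/-- A smooth radial cutoff, equal to `1` on the unit ball and supported in the ball of radius `2`. -/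
def cutR (ξ : V) : ℝ := (⟨1, 2, one_pos, one_lt_two⟩ : ContDiffBump (0 : V)) ξ

theorem cutR_eq_one {ξ : V} (h : ‖ξ‖ ≤ 1) : cutR ξ = 1 :=
  ContDiffBump.one_of_mem_closedBall _ (by simpa using h)

theorem cutR_eq_zero {ξ : V} (h : 2 ≤ ‖ξ‖) : cutR ξ = 0 :=
  ContDiffBump.zero_of_le_dist _ (by simpa using h)

theorem cutR_nonneg (ξ : V) : 0 ≤ cutR ξ := ContDiffBump.nonneg _

theorem cutR_le_one (ξ : V) : cutR ξ ≤ 1 := ContDiffBump.le_one _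

theorem contDiff_cutR : ContDiff ℝ ∞ (cutR : V → ℝ) := ContDiffBump.contDiff _

theorem hasCompactSupport_cutR : HasCompactSupport (cutR : V → ℝ) := ContDiffBump.hasCompactSupport _

/-- The function `ξ ↦ cutR (ξ / c)` as a Schwartz function. -/
def cut (V : Type*) [NormedAddCommGroup V] [InnerProductSpace ℝ V] [FiniteDimensional ℝ V]
    [MeasurableSpace V] [BorelSpace V] (c : ℝ) (hc : 0 < c) : 𝓢(V, ℂ) :=
  SchwartzMap.compCLMOfContinuousLinearEquiv ℝ (dil c⁻¹ (inv_pos.2 hc).ne')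
    (SchwartzMap.postcompCLM (𝕜 := ℝ) Complex.ofRealCLM
      (hasCompactSupport_cutR.toSchwartzMap contDiff_cutR))

theorem cut_apply {c : ℝ} (hc : 0 < c) (ξ : V) : cut V c hc ξ = (cutR (c⁻¹ • ξ) : ℝ) := by
  change ((cutR (dil c⁻¹ (inv_pos.2 hc).ne' ξ) : ℝ) : ℂ) = _
  rw [dil_apply]

/-- The annular cutoff `cutR (ξ / 2) - cutR ξ`. -/
def annR (ξ : V) : ℝ := cutR ((2 : ℝ)⁻¹ • ξ) - cutR ξ

theorem annR_eq_zero_of_le {ξ : V} (h : ‖ξ‖ ≤ 1) : annR ξ = 0 := by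
  rw [annR, cutR_eq_one h, cutR_eq_one, sub_self]
  rw [norm_smul, norm_inv, Real.norm_ofNat]
  linarith [norm_nonneg ξ]

theorem annR_eq_zero_of_ge {ξ : V} (h : 4 ≤ ‖ξ‖) : annR ξ = 0 := by
  rw [annR, cutR_eq_zero (ξ := ξ) (by linarith), cutR_eq_zero, sub_self]
  rw [norm_smul, norm_inv, Real.norm_ofNat]
  linarith

theorem contDiff_annR : ContDiff ℝ ∞ (annR : V → ℝ) :=
  (contDiff_cutR.comp (contDiff_id.const_smul _)).sub contDiff_cutR

theorem hasCompactSupport_annR : HasCompactSupport (annR : V → ℝ) :=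
  HasCompactSupport.intro (isCompact_closedBall (0 : V) 4) fun x hx =>
    annR_eq_zero_of_ge (by simpa using (not_le.1 (by simpa using hx)).le)

end Cutoffs

/-! ### Homogeneous extensions of bump functions. -/

section Kernels

variable {n : ℕ}

theorem radialExt_smul (φ : UnitSphere n → ℝ) {c : ℝ} (hc : 0 < c) (ξ : Space n) :
    radialExt φ (c • ξ) = radialExt φ ξ := by
  unfold radialExt
  by_cases h : ξ = 0
  · simp [h]
  · have h' : c • ξ ≠ 0 := smul_ne_zero hc.ne' h
    rw [dif_pos h, dif_pos h']
    congr 1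
    ext1
    simp only [direction, norm_smul, Real.norm_eq_abs, abs_of_pos hc, smul_smul]
    congr 1
    field_simp

/-- The extension is homogeneous of degree `0`, so its `k`-th derivative at `y` is of size `‖y‖⁻ᵏ`
times the one on the sphere, and `‖y‖ ≥ δ⁻¹` absorbs the loss `δ⁻ᵏ` of the bump. -/
theorem norm_iteratedFDeriv_radialExt_le {A : ℕ → ℝ} {δ : ℝ} (hδ : 0 < δ) {θ : UnitSphere n}
    {φ : UnitSphere n → ℝ} (h : IsBump A δ θ φ) (k : ℕ) {y : Space n} (hy : δ⁻¹ ≤ ‖y‖) :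
    ‖iteratedFDeriv ℝ k (radialExt φ) y‖ ≤ A k := by
  have hy0 : 0 < ‖y‖ := (inv_pos.2 hδ).trans_le hy
  set a := ‖y‖⁻¹ with ha
  have ha0 : 0 < a := inv_pos.2 hy0
  set L : Space n ≃L[ℝ] Space n := dil a ha0.ne'
  have hcomp : radialExt φ ∘ L = radialExt φ := by
    ext x
    simp only [L, Function.comp, dil_apply, radialExt_smul φ ha0]
  have hx : ‖L y‖ = 1 := by
    simp only [L, dil_apply, norm_smul, norm_inv, norm_norm, ha]
    exact inv_mul_cancel₀ hy0.ne'
  have h1 := L.iteratedFDerivWithin_comp_right (radialExt φ) uniqueDiffOn_univ (Set.mem_univ (L y)) k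
  rw [Set.preimage_univ, iteratedFDerivWithin_univ, iteratedFDerivWithin_univ, hcomp] at h1
  rw [h1]
  refine (ContinuousMultilinearMap.norm_compContinuousLinearMap_le _ _).trans ?_
  have hLn : ‖(L : Space n →L[ℝ] Space n)‖ ≤ a := by
    refine ContinuousLinearMap.opNorm_le_bound _ ha0.le fun x => ?_
    change ‖L x‖ ≤ _
    simp only [L, dil_apply, norm_smul, Real.norm_eq_abs, abs_of_pos ha0, le_refl]
  have hd := h.deriv_bound k ⟨L y, by simpa using hx⟩
  have haδ : a ≤ δ := by rw [ha]; exact inv_le_of_inv_le₀ hδ hy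
  rw [Finset.prod_const, Finset.card_fin]
  calc _ ≤ (A k * δ⁻¹ ^ k) * δ ^ k := by
        gcongr
        · exact (norm_nonneg _).trans hd
        · exact hLn.trans haδ
    _ = A k := by rw [mul_assoc, ← mul_pow, inv_mul_cancel₀ hδ.ne', one_pow, mul_one]

theorem radialExt_ne_zero {A : ℕ → ℝ} {δ : ℝ} {θ : UnitSphere n} {φ : UnitSphere n → ℝ}
    (h : IsBump A δ θ φ) {ξ : Space n} (hξ : radialExt φ ξ ≠ 0) :
    ‖ξ - ‖ξ‖ • (θ : Space n)‖ ≤ δ * ‖ξ‖ := by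
  unfold radialExt at hξ
  split_ifs at hξ with h0
  · have h1 := h.support_subset (Function.mem_support.2 hξ)
    rw [Metric.mem_ball, Subtype.dist_eq, dist_eq_norm] at h1
    have hn : 0 < ‖ξ‖ := norm_pos_iff.2 h0
    have e : ξ - ‖ξ‖ • (θ : Space n) = ‖ξ‖ • ((direction ξ h0 : Space n) - θ) := by
      simp only [direction, smul_sub, smul_smul, mul_inv_cancel₀ hn.ne', one_smul]
    rw [e, norm_smul, norm_norm, mul_comm]
    gcongr
  · exact absurd rfl hξ

theorem enorm_radialExt_le {A : ℕ → ℝ} {δ : ℝ} {θ : UnitSphere n} {φ : UnitSphere n → ℝ}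
    (h : IsBump A δ θ φ) (ξ : Space n) : |radialExt φ ξ| ≤ max (A 0) 0 := by
  unfold radialExt
  split_ifs with h0
  · have h1 := h.deriv_bound 0 (direction ξ h0)
    rw [norm_iteratedFDeriv_zero, pow_zero, mul_one, Real.norm_eq_abs] at h1
    refine le_trans (le_of_eq ?_) (h1.trans (le_max_left _ _))
    have hn : 0 < ‖ξ‖ := norm_pos_iff.2 h0
    change _ = |radialExt φ (‖ξ‖⁻¹ • ξ)|
    rw [radialExt_smul φ (inv_pos.2 hn), radialExt, dif_pos h0]
  · simp

/-- A smooth function on the line, supported in a compact subset of `(0, ∞)`, equal to `1 / t` for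
`1 / 4 ≤ t ≤ 23 / 4`. -/
theorem exists_smooth_inv : ∃ h : ℝ → ℝ, ContDiff ℝ ∞ h ∧ HasCompactSupport h ∧
    ∀ t, 1 / 4 ≤ t → t ≤ 23 / 4 → h t = t⁻¹ := by
  let b : ContDiffBump (3 : ℝ) := ⟨11 / 4, 29 / 10, by norm_num, by norm_num⟩
  refine ⟨fun t => b t * t⁻¹, ?_, b.hasCompactSupport.mul_right, fun t h1 h2 => ?_⟩
  · rw [contDiff_iff_contDiffAt]
    intro t
    by_cases ht : t = 0
    · have hev : (fun t => b t * t⁻¹) =ᶠ[nhds t] fun _ => 0 := by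
        have : Metric.ball (0 : ℝ) (1 / 10) ∈ nhds t := by
          rw [ht]; exact Metric.ball_mem_nhds _ (by norm_num)
        filter_upwards [this] with u hu
        rw [b.zero_of_le_dist, zero_mul]
        rw [Metric.mem_ball, Real.dist_eq, sub_zero, abs_lt] at hu
        change (29 / 10 : ℝ) ≤ _
        rw [Real.dist_eq, abs_sub_comm]
        exact le_trans (by linarith) (le_abs_self _)
      exact contDiffAt_const.congr_of_eventuallyEq hev
    · exact b.contDiffAt.mul (contDiffAt_inv ℝ ht)
  · change b t * _ = _
    rw [b.one_of_mem_closedBall, one_mul]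
    rw [Metric.mem_closedBall, Real.dist_eq, abs_le]
    constructor
    · change -(11 / 4 : ℝ) ≤ _; linarith
    · change _ ≤ (11 / 4 : ℝ); linarith

end Kernels

/-! ### Kernels of the frequency-localized cone multipliers. -/

section ConeKernels

variable {n : ℕ}

theorem lintegral_le_of_decay {V : Type*} [NormedAddCommGroup V] [InnerProductSpace ℝ V]
    [FiniteDimensional ℝ V] [MeasurableSpace V] [BorelSpace V] (N : ℕ) {f : V → ℂ} {C : ℝ}
    (hC : 0 ≤ C) (hf : ∀ y, ‖f y‖ ≤ C * ((1 + ‖y‖) ^ (N + (Module.finrank ℝ V + 1)))⁻¹) :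
    ∫⁻ y, ENNReal.ofReal ((1 + ‖y‖) ^ N) * ‖f y‖ₑ ≤
      ENNReal.ofReal C * wtMass V (Module.finrank ℝ V + 1) := by
  rw [wtMass, ← lintegral_const_mul _ (by fun_prop)]
  refine lintegral_mono fun y => ?_
  rw [← ofReal_norm, ← ENNReal.ofReal_mul (by positivity), ← ENNReal.ofReal_mul hC]
  apply ENNReal.ofReal_le_ofReal
  calc _ ≤ (1 + ‖y‖) ^ N * (C * ((1 + ‖y‖) ^ (N + (Module.finrank ℝ V + 1)))⁻¹) := by
        gcongr; exact hf y
    _ = _ := by rw [pow_add]; field_simp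

theorem near_axis {θ x : Space n} (hθ : ‖θ‖ = 1) {δ : ℝ} (hδ : 0 < δ) (hδ' : δ ≤ 1 / 2)
    (hx1 : 1 < ‖x‖) (hx4 : ‖x‖ < 4) (hx : ‖x - ‖x‖ • θ‖ ≤ δ * ‖x‖) :
    1 / 2 ≤ (inner ℝ θ x : ℝ) ∧ (inner ℝ θ x : ℝ) ≤ 4 ∧ ‖x - (inner ℝ θ x : ℝ) • θ‖ ≤ 4 * δ := by
  have h1 : inner ℝ θ θ = (1 : ℝ) := by rw [real_inner_self_eq_norm_sq, hθ]; norm_num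
  have h2 : (inner ℝ θ x : ℝ) = ‖x‖ + inner ℝ θ (x - ‖x‖ • θ) := by
    rw [inner_sub_right, inner_smul_right, h1]; ring
  have h3 := abs_real_inner_le_norm θ (x - ‖x‖ • θ)
  rw [hθ, one_mul, abs_le] at h3
  have h4 := real_inner_le_norm θ x
  rw [hθ, one_mul] at h4
  have h5 : δ * ‖x‖ ≤ 1 / 2 * ‖x‖ := by gcongr
  refine ⟨by linarith [h3.1], by linarith, (norm_sub_inner_smul_le hθ x ‖x‖).trans ?_⟩
  nlinarith

/-- Once the directions transverse to `θ` are stretched by `δ⁻¹`, the multiplier is a bump of unit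
size. With `t` the component of `ζ` along `θ` and `ζ'` the transverse part, homogeneity moves the
argument `t θ + δ ζ'` of `radialExt φ` to `δ⁻¹ θ + ζ' / t`, where the derivatives are bounded
independently of `δ`; the rest is the chain rule, `t` being bounded away from `0`. -/
theorem exists_normalized_multiplier (n : ℕ) (A : ℕ → ℝ) (N : ℕ) : ∃ C : ℝ≥0∞, C ≠ ⊤ ∧
    ∀ δ : ℝ, 0 < δ → δ ≤ 1 / 2 → ∀ (θ : UnitSphere n) (φ : UnitSphere n → ℝ), IsBump A δ θ φ →
      ∃ M : 𝓢(Space n, ℂ), (∀ ζ, M ζ = ((radialExt φ (boxLin (θ : Space n) 1 δ ζ) *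
          annR (boxLin (θ : Space n) 1 δ ζ) : ℝ) : ℂ)) ∧
        ∫⁻ y, ENNReal.ofReal ((1 + ‖y‖) ^ N) * ‖𝓕⁻ M y‖ₑ ≤ C := by
  -- The cutoffs are nested. Where the multiplier is nonzero, `t ∈ [1/2, 4]` and `‖ζ‖ ≤ 8`, so `η`
  -- and `b` equal `1`. On the supports of `η` and `b`, `h t = t⁻¹` and `b₂ = 1`, so `q` below is
  -- the true `ζ' / t`.
  let η : ContDiffBump (3 : ℝ) := ⟨5 / 2, 11 / 4, by norm_num, by norm_num⟩
  let b : ContDiffBump (0 : Space n) := ⟨8, 9, by norm_num, by norm_num⟩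
  let b₂ : ContDiffBump (0 : Space n) := ⟨9, 10, by norm_num, by norm_num⟩
  obtain ⟨h, hh, hhc, hinv⟩ := exists_smooth_inv
  obtain ⟨Aη, hAη⟩ := exists_derivBound η.contDiff η.hasCompactSupport
  obtain ⟨Ah, hAh⟩ := exists_derivBound hh hhc
  obtain ⟨Ab, hAb⟩ := exists_derivBound b.contDiff b.hasCompactSupport
  obtain ⟨Ag, hAg⟩ := exists_derivBound (f := fun ζ => b₂ ζ • ζ) (b₂.contDiff.smul contDiff_id)
    b₂.hasCompactSupport.smul_right
  obtain ⟨Ap, hAp⟩ := exists_derivBound (contDiff_annR (V := Space n)) hasCompactSupport_annR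
  obtain ⟨C, hC0, hC⟩ := exists_uniform_decay (V := Space n)
    (N + (Module.finrank ℝ (Space n) + 1))
    (prodBound Aη (prodBound Ab (prodBound Ap (compBound A (prodBound Ah Ag))))) 9
  refine ⟨ENNReal.ofReal C * wtMass (Space n) (Module.finrank ℝ (Space n) + 1),
    ENNReal.mul_ne_top ENNReal.ofReal_ne_top (wtMass_ne_top (by omega)), ?_⟩
  intro δ hδ hδ' θ' φ hφ
  set θ : Space n := θ'.1 with hθdef
  have hθ : ‖θ‖ = 1 := mem_sphere_zero_iff_norm.1 θ'.2
  have hθθ : inner ℝ θ θ = (1 : ℝ) := by rw [real_inner_self_eq_norm_sq, hθ]; norm_num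
  set P : Space n →L[ℝ] Space n := LinearMap.toContinuousLinearMap (boxLin θ 0 1) with hP
  have hPa : ∀ x, P x = x - (inner ℝ θ x : ℝ) • θ := fun x => by
    change boxLin θ 0 1 x = _
    rw [boxLin_apply]; simp [sub_eq_add_neg]
  have hPn : ‖P‖ ≤ 1 := ContinuousLinearMap.opNorm_le_bound _ zero_le_one fun x => by
    rw [hPa, one_mul]; simpa using norm_sub_inner_smul_le hθ x 0
  set B : Space n →L[ℝ] Space n := LinearMap.toContinuousLinearMap (boxLin θ 1 δ) with hB
  have hBa : ∀ x, B x = boxLin θ 1 δ x := fun x => rfl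
  have hBn : ‖B‖ ≤ 1 := ContinuousLinearMap.opNorm_le_bound _ zero_le_one fun x => by
    rw [hBa, one_mul]
    refine le_of_sq_le_sq ?_ (norm_nonneg _)
    have h1 := norm_boxLin_sq hθ 1 1 x
    rw [boxLin_self, one_smul] at h1
    rw [norm_boxLin_sq hθ, h1, mul_pow δ, one_mul ‖_‖]
    gcongr
    exact mul_le_of_le_one_left (sq_nonneg _) (pow_le_one₀ hδ.le (by linarith))
  set I : Space n →L[ℝ] ℝ := innerSL ℝ θ with hI
  have hIa : ∀ x, I x = inner ℝ θ x := fun x => rfl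
  have hIn : ‖I‖ ≤ 1 := by rw [hI, innerSL_apply_norm, hθ]
  set q : Space n → Space n := fun ζ => (h ∘ I) ζ • (P ∘ fun ζ => b₂ ζ • ζ) ζ with hq
  have hqB : DerivBound (prodBound Ah Ag) q := (hAh.comp_clm I hIn).smul (hAg.clm_comp P hPn)
  -- `q ζ` is orthogonal to `θ`, so the component along `θ` alone has length `δ⁻¹`.
  have hfn : ∀ ζ, δ⁻¹ ≤ ‖δ⁻¹ • θ + q ζ‖ := fun ζ => by
    have h1 := real_inner_le_norm θ (δ⁻¹ • θ + q ζ)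
    have h2 : inner ℝ θ (q ζ) = (0 : ℝ) := by
      simp only [hq, Function.comp, hPa, inner_smul_right, inner_sub_right, hθθ]; ring
    rwa [hθ, one_mul, inner_add_right, h2, inner_smul_right, hθθ, mul_one, add_zero] at h1
  have hcomp : DerivBound (compBound A (prodBound Ah Ag))
      fun ζ => radialExt φ (δ⁻¹ • θ + q ζ) := by
    refine DerivBound.comp_const_add (t := {0}ᶜ) isOpen_compl_singleton _ (fun ζ => ?_) hqB hφ.smooth
      fun k ζ => norm_iteratedFDeriv_radialExt_le hδ hφ k (hfn ζ)
    exact norm_pos_iff.1 ((inv_pos.2 hδ).trans_le (hfn ζ))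
  set Mr : Space n → ℝ := fun ζ => (η ∘ I) ζ • (b ζ • ((annR ∘ B) ζ • radialExt φ (δ⁻¹ • θ + q ζ)))
    with hMr
  have hMB : DerivBound _ Mr :=
    (hAη.comp_clm I hIn).smul (hAb.smul ((hAp.comp_clm B hBn).smul hcomp))
  have hMs : ∀ ζ, 9 ≤ ‖ζ‖ → Mr ζ = 0 := fun ζ hζ => by
    have : b ζ = 0 := b.zero_of_le_dist (by simpa using hζ)
    simp [hMr, this]
  have hMeq : ∀ ζ, Mr ζ = radialExt φ (boxLin θ 1 δ ζ) * annR (boxLin θ 1 δ ζ) := by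
    intro ζ
    have htB : (inner ℝ θ (boxLin θ 1 δ ζ) : ℝ) = inner ℝ θ ζ := by
      rw [boxLin_apply, inner_add_right, inner_smul_right, inner_smul_right, hθθ]; ring
    have hin : 1 / 4 ≤ (inner ℝ θ ζ : ℝ) → (inner ℝ θ ζ : ℝ) ≤ 23 / 4 → ‖ζ‖ ≤ 9 →
        radialExt φ (δ⁻¹ • θ + q ζ) = radialExt φ (boxLin θ 1 δ ζ) := by
      intro h1 h2 h3
      have hb2 : b₂ ζ = 1 := b₂.one_of_mem_closedBall (by simpa using h3)
      have ht : (0 : ℝ) < inner ℝ θ ζ := by linarith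
      rw [← radialExt_smul φ (mul_pos hδ ht)]
      congr 1
      simp only [hq, Function.comp, hIa, hinv _ h1 h2, hb2, one_smul, hPa, boxLin_apply]
      rw [smul_add, smul_smul, smul_smul, smul_sub, smul_smul,
        show δ * (inner ℝ θ ζ : ℝ) * (inner ℝ θ ζ : ℝ)⁻¹ = δ by field_simp,
        show δ * (inner ℝ θ ζ : ℝ) * δ⁻¹ = inner ℝ θ ζ by field_simp, sub_mul, sub_smul, one_mul]
      abel
    have hM : Mr ζ = η (inner ℝ θ ζ) * (b ζ * (annR (boxLin θ 1 δ ζ) *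
      radialExt φ (δ⁻¹ • θ + q ζ))) := rfl
    by_cases hX : radialExt φ (boxLin θ 1 δ ζ) * annR (boxLin θ 1 δ ζ) = 0
    · rw [hX, hM]
      by_cases h1 : η (inner ℝ θ ζ : ℝ) = 0
      · simp [h1]
      by_cases h2 : b ζ = 0
      · simp [h2]
      have h1' : (inner ℝ θ ζ : ℝ) ∈ Metric.ball (3 : ℝ) (11 / 4) := by
        have := Function.mem_support.2 h1
        rwa [η.support_eq] at this
      have h2' : ζ ∈ Metric.ball (0 : Space n) 9 := by
        have := Function.mem_support.2 h2
        rwa [b.support_eq] at this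
      rw [Metric.mem_ball, Real.dist_eq, abs_lt] at h1'
      rw [hin (by linarith) (by linarith) (by simpa using (mem_ball_zero_iff.1 h2').le), mul_comm (annR _), hX]
      simp
    · have hr := radialExt_ne_zero hφ (left_ne_zero_of_mul hX)
      have ha := right_ne_zero_of_mul hX
      have hx1 : 1 < ‖boxLin θ 1 δ ζ‖ := not_le.1 fun h => ha (annR_eq_zero_of_le h)
      have hx4 : ‖boxLin θ 1 δ ζ‖ < 4 := not_le.1 fun h => ha (annR_eq_zero_of_ge h)
      obtain ⟨h1, h2, h3⟩ := near_axis hθ hδ hδ' hx1 hx4 hr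
      rw [htB] at h1 h2 h3
      have h4 : ‖ζ‖ ≤ 8 := by
        have e : boxLin θ 1 δ ζ - (inner ℝ θ ζ : ℝ) • θ = δ • (ζ - (inner ℝ θ ζ : ℝ) • θ) := by
          rw [boxLin_apply, smul_sub, smul_smul, sub_mul, sub_smul, one_mul]; abel
        rw [e, norm_smul, Real.norm_of_nonneg hδ.le, mul_comm, mul_le_mul_iff_left₀ hδ] at h3
        have h5 : ‖(inner ℝ θ ζ : ℝ) • θ‖ ≤ 4 := by
          rw [norm_smul, hθ, mul_one, Real.norm_eq_abs, abs_le]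
          constructor <;> linarith
        calc ‖ζ‖ = ‖(ζ - (inner ℝ θ ζ : ℝ) • θ) + (inner ℝ θ ζ : ℝ) • θ‖ := by simp
          _ ≤ 8 := (norm_add_le _ _).trans (by linarith)
      have hη1 : η (inner ℝ θ ζ : ℝ) = 1 := η.one_of_mem_closedBall (by
        rw [Metric.mem_closedBall, Real.dist_eq, abs_le]
        constructor
        · change -(5 / 2 : ℝ) ≤ _; linarith
        · change _ ≤ (5 / 2 : ℝ); linarith)
      have hb1 : b ζ = 1 := b.one_of_mem_closedBall (by simpa using h4)
      rw [hM, hη1, hb1, hin (by linarith) (by linarith) (by linarith), one_mul, one_mul, mul_comm]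
  have hMc : HasCompactSupport Mr := HasCompactSupport.intro (isCompact_closedBall (0 : Space n) 9)
    fun x hx => hMs x (by simpa using (not_le.1 (by simpa using hx)).le)
  set M : 𝓢(Space n, ℂ) :=
    SchwartzMap.postcompCLM (𝕜 := ℝ) Complex.ofRealCLM (hMc.toSchwartzMap hMB.1) with hM
  have hMa : ∀ ζ, M ζ = (Mr ζ : ℂ) := fun ζ => rfl
  refine ⟨M, fun ζ => by rw [hMa, hMeq], lintegral_le_of_decay N hC0 (hC M ?_ ?_)⟩
  · exact hMB.clm_comp Complex.ofRealCLM (by simp)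
  · intro x hx
    rw [hMa, hMs x hx.le, Complex.ofReal_zero]

theorem boxLin_symm_eq (θ : Space n) {R δ : ℝ} (hδ : δ ≠ 0) (hθ : ‖θ‖ = 1) (ξ : Space n) :
    boxLin θ 1 δ (boxLin θ R⁻¹ (R * δ)⁻¹ ξ) = R⁻¹ • ξ := by
  rw [boxLin_boxLin hθ, one_mul, mul_inv, mul_left_comm, mul_inv_cancel₀ hδ, mul_one, boxLin_self]

/-- The kernels of the frequency localized cone multipliers, with uniform decay adapted to the cone. -/
theorem exists_cone_kernel (n : ℕ) (A : ℕ → ℝ) (N : ℕ) : ∃ C : ℝ≥0∞, C ≠ ⊤ ∧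
    ∀ (δ : ℝ) (hδ : 0 < δ), δ ≤ 1 / 2 → ∀ (θ : UnitSphere n) (hθ : ‖(θ : Space n)‖ = 1)
      (φ : UnitSphere n → ℝ), IsBump A δ θ φ → ∀ (R : ℝ) (hR : 0 < R),
      ∃ K : 𝓢(Space n, ℂ),
        (∀ ξ, 𝓕 K ξ = (radialExt φ ξ : ℂ) * (annR (R⁻¹ • ξ) : ℝ)) ∧
        ∫⁻ y, peetre N (box (θ : Space n) hθ R (R * δ) hR (mul_pos hR hδ)) y * ‖K y‖ₑ ≤ C := by
  obtain ⟨C, hC, H⟩ := exists_normalized_multiplier n A N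
  refine ⟨C, hC, fun δ hδ hδ' θ hθ φ hφ R hR => ?_⟩
  obtain ⟨M, hM, hMi⟩ := H δ hδ hδ' θ φ hφ
  set L := box (θ : Space n) hθ R (R * δ) hR (mul_pos hR hδ) with hL
  refine ⟨dk L M, fun ξ => ?_, ?_⟩
  · rw [fourier_dk, hM, hL, box_symm_apply, boxLin_symm_eq _ hδ.ne' hθ,
      radialExt_smul _ (inv_pos.2 hR), Complex.ofReal_mul]
  · refine le_trans (le_of_eq ?_) hMi
    have hLs : SelfAdj L := selfAdj_box _ _ _
    have hm := measurable_enorm_schwartz (𝓕⁻ M)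
    have hLm : Measurable L := L.continuous.measurable
    have hm' : Measurable fun x => ENNReal.ofReal ((1 + ‖L x‖) ^ N) * ‖𝓕⁻ M (L x)‖ₑ :=
      Measurable.mul (by fun_prop) (hm.comp hLm)
    rw [← lintegral_comp_equiv L (g := fun y => ENNReal.ofReal ((1 + ‖y‖) ^ N) * ‖𝓕⁻ M y‖ₑ)
      (by fun_prop), ← lintegral_const_mul _ hm']
    congr with y
    rw [enorm_dk hLs, peetre]
    ring

end ConeKernels

/-! ### Local orthogonality for the cones in a cap. -/

section ConePieces

variable {V : Type*} [NormedAddCommGroup V] [InnerProductSpace ℝ V] [FiniteDimensional ℝ V]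
  [MeasurableSpace V] [BorelSpace V]

/-- `K` is a kernel whose Fourier transform lives in the part `R ≤ |ξ| ≤ 4 R` of the cone of aperture
`δ` around `θ`, and which decays at the dual scales. -/
structure ConePiece (N : ℕ) (C₁ : ℝ≥0∞) {δ R : ℝ} (hδ : 0 < δ) (hR : 0 < R) {θ : V} (hθ : ‖θ‖ = 1)
    (K : 𝓢(V, ℂ)) : Prop where
  supp : ∀ ξ, 𝓕 K ξ ≠ 0 → R ≤ ‖ξ‖ ∧ ‖ξ‖ ≤ 4 * R ∧ ‖ξ - ‖ξ‖ • θ‖ ≤ δ * ‖ξ‖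
  mass : ∫⁻ y, peetre N (box θ hθ R (R * δ) hR (mul_pos hR hδ)) y * ‖K y‖ₑ ≤ C₁

theorem one_le_peetre (N : ℕ) (L : V ≃L[ℝ] V) (y : V) : 1 ≤ peetre N L y := by
  rw [peetre, ENNReal.one_le_ofReal]
  exact one_le_pow₀ (by linarith [norm_nonneg (L y)])

/-- Tilting the axis from `θ` to `e` costs `R s * 2 r ‖y‖ = 2 R δ ‖y‖`, no more than the transverse
part. The factor `11` is `8` (from `s ≤ 8`) plus `2` (the tilt) plus `1` (the transverse part). -/
theorem peetre_box_le (N : ℕ) {e θ : V} (he : ‖e‖ = 1) (hθ : ‖θ‖ = 1) {δ R s r : ℝ} (hδ : 0 < δ)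
    (hR : 0 < R) (hs : 0 < s) (hsr : s * r = δ) (hs8 : s ≤ 8) (hδ1 : δ ≤ 1) (hθe : ‖θ - e‖ ≤ 2 * r)
    (y : V) :
    peetre N (box e he (R * s) (R * δ) (mul_pos hR hs) (mul_pos hR hδ)) y ≤
      11 ^ N * peetre N (box θ hθ R (R * δ) hR (mul_pos hR hδ)) y := by
  rw [peetre, peetre, show (11 : ℝ≥0∞) ^ N = ENNReal.ofReal (11 ^ N) by
    rw [ENNReal.ofReal_pow (by norm_num)]; norm_num, ← ENNReal.ofReal_mul (by positivity), ← mul_pow,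
    box_apply, box_apply]
  apply ENNReal.ofReal_le_ofReal
  gcongr
  have h1 := norm_boxLin_le he (R * s) (R * δ) 0 y
  rw [zero_smul, sub_zero, abs_of_pos (mul_pos hR hs), abs_of_pos (mul_pos hR hδ)] at h1
  have h2 := abs_mul_inner_le_norm_boxLin hθ R (R * δ) y
  rw [abs_mul, abs_of_pos hR] at h2
  have h3 := mul_norm_le_norm_boxLin hθ (mul_pos hR hδ).le
    (mul_le_of_le_one_right hR.le hδ1) y
  have h4 : |inner ℝ e y| ≤ |inner ℝ θ y| + 2 * r * ‖y‖ := by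
    have : inner ℝ e y = inner ℝ θ y - inner ℝ (θ - e) y := by rw [inner_sub_left]; ring
    rw [this]
    refine (abs_sub _ _).trans ?_
    gcongr
    exact (abs_real_inner_le_norm _ _).trans (by gcongr)
  have h5 : R * s * |inner ℝ e y| ≤ 8 * (R * |inner ℝ θ y|) + 2 * (R * δ * ‖y‖) := by
    calc R * s * |inner ℝ e y| ≤ R * s * (|inner ℝ θ y| + 2 * r * ‖y‖) := by gcongr
      _ = s * (R * |inner ℝ θ y|) + 2 * (R * (s * r) * ‖y‖) := by ring
      _ ≤ _ := by rw [hsr]; gcongr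
  linarith

theorem norm_direction_sub_le {ξ θ : V} {δ : ℝ} (hξ : 0 < ‖ξ‖) (h : ‖ξ - ‖ξ‖ • θ‖ ≤ δ * ‖ξ‖) :
    ‖θ - ‖ξ‖⁻¹ • ξ‖ ≤ δ := by
  have : θ - ‖ξ‖⁻¹ • ξ = -(‖ξ‖⁻¹ • (ξ - ‖ξ‖ • θ)) := by
    rw [smul_sub, smul_smul, inv_mul_cancel₀ hξ.ne', one_smul]; abel
  rw [this, norm_neg, norm_smul, norm_inv, norm_norm, inv_mul_le_iff₀ hξ]
  linarith

/-- Two cone pieces that meet a common translate of the box are close to each other. -/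
theorem near_of_common_box {e θ θ₀ ξ ξ₀ v : V} (he : ‖e‖ = 1) (hθ₀ : ‖θ₀‖ = 1) {δ R s r : ℝ}
    (hδ : 0 < δ) (hR : 0 < R) (hs : 0 < s) (hsr : s * r = δ) (hθe : ‖θ₀ - e‖ ≤ 2 * r)
    (h1 : R ≤ ‖ξ‖) (h3 : ‖ξ - ‖ξ‖ • θ‖ ≤ δ * ‖ξ‖)
    (h2' : ‖ξ₀‖ ≤ 4 * R) (h3' : ‖ξ₀ - ‖ξ₀‖ • θ₀‖ ≤ δ * ‖ξ₀‖)
    (hv : ‖(box e he (R * s) (R * δ) (mul_pos hR hs) (mul_pos hR hδ)).symm (ξ - v)‖ ≤ 2)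
    (hv' : ‖(box e he (R * s) (R * δ) (mul_pos hR hs) (mul_pos hR hδ)).symm (ξ₀ - v)‖ ≤ 2) :
    ‖θ - θ₀‖ ≤ (33 : ℕ) * δ ∨ ‖θ + θ₀‖ ≤ (33 : ℕ) * δ := by
  set L := box e he (R * s) (R * δ) (mul_pos hR hs) (mul_pos hR hδ) with hL
  set z := L.symm (ξ - v) - L.symm (ξ₀ - v) with hz
  have hz4 : ‖z‖ ≤ 4 := (norm_sub_le _ _).trans (by linarith)
  have hLz : boxLin e (R * s) (R * δ) z = ξ - ξ₀ := by
    rw [← box_apply he (mul_pos hR hs) (mul_pos hR hδ), ← hL, hz, map_sub,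
      ContinuousLinearEquiv.apply_symm_apply, ContinuousLinearEquiv.apply_symm_apply]
    abel
  set a := R * s * inner ℝ e z with ha
  have h5 := norm_boxLin_sub_le he (a := R * s) (b := R * δ) z
  rw [hLz, ← ha, abs_of_pos (mul_pos hR hδ)] at h5
  have ha4 : |a| ≤ R * s * 4 := by
    rw [ha, abs_mul, abs_of_pos (mul_pos hR hs)]
    gcongr
    exact (abs_real_inner_le_norm _ _).trans (by rw [he, one_mul]; exact hz4)
  -- The aperture at `ξ₀` and the width of the box cost `4 R δ` each, the tilt `8 R δ`.
  -- `direction_near` doubles the total, and the aperture at `ξ` adds one more `δ`, whence `33`.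
  have key : ‖ξ - (‖ξ₀‖ + a) • θ₀‖ ≤ 16 * (R * δ) := by
    have e1 : ξ - (‖ξ₀‖ + a) • θ₀ = (ξ₀ - ‖ξ₀‖ • θ₀) + (ξ - ξ₀ - a • e) - a • (θ₀ - e) := by
      rw [add_smul, smul_sub]; abel
    rw [e1]
    refine (norm_sub_le _ _).trans ?_
    refine (add_le_add_left (norm_add_le _ _) _).trans ?_
    have h6 : ‖a • (θ₀ - e)‖ ≤ R * s * 4 * (2 * r) := by
      rw [norm_smul, Real.norm_eq_abs]
      gcongr
    have h7 : R * s * 4 * (2 * r) = 8 * (R * δ) := by rw [← hsr]; ring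
    have h8 : δ * ‖ξ₀‖ ≤ δ * (4 * R) := by gcongr
    have h9 : R * δ * ‖z‖ ≤ R * δ * 4 := by gcongr
    linarith
  have hξ : 0 < ‖ξ‖ := hR.trans_le h1
  have hd := norm_direction_sub_le hξ h3
  have hE : 2 * (16 * (R * δ)) / ‖ξ‖ ≤ 32 * δ := by
    rw [div_le_iff₀ hξ]
    nlinarith [mul_le_mul_of_nonneg_left h1 hδ.le]
  rcases direction_near hθ₀ hξ key with h | h
  · left
    have : θ - θ₀ = (θ - ‖ξ‖⁻¹ • ξ) - (θ₀ - ‖ξ‖⁻¹ • ξ) := by abel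
    rw [this]
    refine (norm_sub_le _ _).trans ?_
    push_cast
    linarith
  · right
    have : θ + θ₀ = (θ - ‖ξ‖⁻¹ • ξ) + (θ₀ + ‖ξ‖⁻¹ • ξ) := by abel
    rw [this]
    refine (norm_add_le _ _).trans ?_
    push_cast
    linarith

theorem cut_ne_zero {c : ℝ} (hc : 0 < c) {ξ : V} (h : cut V c hc ξ ≠ 0) : ‖ξ‖ ≤ 2 * c := by
  by_contra! hlt
  apply h
  rw [cut_apply, cutR_eq_zero, Complex.ofReal_zero]
  rw [norm_smul, norm_inv, Real.norm_of_nonneg hc.le, inv_mul_eq_div, le_div_iff₀ hc]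
  linarith

theorem cut_eq_one {c : ℝ} (hc : 0 < c) {ξ : V} (h : ‖ξ‖ ≤ c) : cut V c hc ξ = 1 := by
  rw [cut_apply, cutR_eq_one, Complex.ofReal_one]
  rw [norm_smul, norm_inv, Real.norm_of_nonneg hc.le, inv_mul_eq_div, div_le_iff₀ hc]
  linarith

/-- Cones of the cap whose pieces at frequency `R` meet a common translate of the box have axes
within `33 δ` of each other up to sign, so `δ`-separation bounds their number. The kernel bounds
needed in `local_orthogonality` follow from `peetre_box_le`. -/
theorem cone_local_orthogonality (N : ℕ) (C₁ : ℝ≥0∞) (hC₁ : C₁ ≠ ⊤) : ∃ C : ℝ≥0∞, C ≠ ⊤ ∧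
    ∀ {ι : Type} (J : Finset ι) (θ : ι → V) (hθ : ∀ j, ‖θ j‖ = 1) (K : ι → 𝓢(V, ℂ)) {δ R s r : ℝ}
      (hδ : 0 < δ) (hR : 0 < R) (hs : 0 < s) (e : V) (he : ‖e‖ = 1), s * r = δ → s ≤ 8 → δ ≤ 1 →
      (∀ i ∈ J, ∀ j ∈ J, i ≠ j → δ ≤ ‖θ i - θ j‖) → (∀ j ∈ J, ‖θ j - e‖ ≤ 2 * r) →
      (∀ j ∈ J, ConePiece N C₁ hδ hR (hθ j) (K j)) → ∀ (f : 𝓢(V, ℂ)) (x : V),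
      (wt N (box e he (R * s) (R * δ) (mul_pos hR hs) (mul_pos hR hδ)) ⋆ₗ
          fun y => ∑ j ∈ J, ‖conv (K j) f y‖ₑ ^ 2) x ≤
        C * (wt N (box e he (R * s) (R * δ) (mul_pos hR hs) (mul_pos hR hδ)) ⋆ₗ
          fun y => ‖f y‖ₑ ^ 2) x := by
  have hρ : cut V 1 one_pos ≠ 0 := fun h => by
    have h1 : cut V 1 one_pos (0 : V) = 1 := cut_eq_one one_pos (by simp)
    rw [h] at h1
    simp at h1
  obtain ⟨C, hC, H⟩ := local_orthogonality N (cut V 1 one_pos) hρ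
  refine ⟨C * ((11 ^ N * C₁) ^ 2 * (2 * (2 * 33 + 1) ^ Module.finrank ℝ V : ℕ)), ?_, ?_⟩
  · exact ENNReal.mul_ne_top hC (ENNReal.mul_ne_top (ENNReal.pow_ne_top
      (ENNReal.mul_ne_top (ENNReal.pow_ne_top (by norm_num)) hC₁)) (ENNReal.natCast_ne_top _))
  intro ι J θ hθ K δ R s r hδ hR hs e he hsr hs8 hδ1 hsep hclose hK f x
  refine H _ (selfAdj_box he _ _) J K _ _ (fun j hj x => ?_) (fun j hj => ?_) (fun v => ?_) f x
  · refine (wt_lconv_le N _ (measurable_enorm_schwartz _) x).trans ?_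
    gcongr
    calc _ ≤ ∫⁻ y, 11 ^ N * (peetre N (box (θ j) (hθ j) R (R * δ) hR (mul_pos hR hδ)) y * ‖K j y‖ₑ) := by
          refine lintegral_mono fun y => ?_
          rw [← mul_assoc]
          gcongr
          exact peetre_box_le N he (hθ j) hδ hR hs hsr hs8 hδ1 (hclose j hj) y
      _ = 11 ^ N * ∫⁻ y, peetre N (box (θ j) (hθ j) R (R * δ) hR (mul_pos hR hδ)) y * ‖K j y‖ₑ :=
          lintegral_const_mul _ ((measurable_peetre _ _).mul (measurable_enorm_schwartz _))
      _ ≤ _ := mul_le_mul' le_rfl (hK j hj).mass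
  · calc _ ≤ ∫⁻ y, peetre N (box (θ j) (hθ j) R (R * δ) hR (mul_pos hR hδ)) y * ‖K j y‖ₑ :=
          lintegral_mono fun y => le_mul_of_one_le_left zero_le (one_le_peetre _ _ _)
      _ ≤ C₁ := (hK j hj).mass
      _ ≤ _ := le_mul_of_one_le_left zero_le (one_le_pow₀ (by norm_num))
  · by_cases hex : ∃ j ∈ J, ∃ ξ, 𝓕 (K j) ξ ≠ 0 ∧ cut V 1 one_pos
        ((box e he (R * s) (R * δ) (mul_pos hR hs) (mul_pos hR hδ)).symm (ξ - v)) ≠ 0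
    · obtain ⟨j₀, hj₀, ξ₀, h0, h0'⟩ := hex
      obtain ⟨t, ht, htm⟩ := exists_finset_near hδ J hsep (θ j₀) 33
      refine ⟨t, ht, fun j hj hjt ξ => ?_⟩
      by_contra! hc
      obtain ⟨a1, -, a3⟩ := (hK j hj).supp ξ hc.1
      obtain ⟨-, b2, b3⟩ := (hK j₀ hj₀).supp ξ₀ h0
      exact hjt (htm j hj (near_of_common_box he (hθ j₀) hδ hR hs hsr (hclose j₀ hj₀) a1 a3 b2 b3
        (by simpa using cut_ne_zero one_pos hc.2) (by simpa using cut_ne_zero one_pos h0')))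
    · push Not at hex
      refine ⟨∅, by simp, fun j hj _ ξ => ?_⟩
      by_cases h0 : 𝓕 (K j) ξ = 0
      · exact Or.inl h0
      · exact Or.inr (hex j hj ξ h0)

end ConePieces

/-! ### One shell inside one cap. -/

section HighFrequency

variable {V : Type*} [NormedAddCommGroup V] [InnerProductSpace ℝ V] [FiniteDimensional ℝ V]
  [MeasurableSpace V] [BorelSpace V]

/-- A cutoff to the annulus `1 ≤ |ξ| ≤ 4`. -/
def annS (V : Type*) [NormedAddCommGroup V] [InnerProductSpace ℝ V] [FiniteDimensional ℝ V]
    [MeasurableSpace V] [BorelSpace V] : 𝓢(V, ℂ) := cut V 2 two_pos - cut V 1 one_pos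

/-- A cutoff to the annulus `1 / 2 ≤ |ξ| ≤ 8`, equal to `1` for `1 ≤ |ξ| ≤ 4`. -/
def annW (V : Type*) [NormedAddCommGroup V] [InnerProductSpace ℝ V] [FiniteDimensional ℝ V]
    [MeasurableSpace V] [BorelSpace V] : 𝓢(V, ℂ) := cut V 4 four_pos - cut V (1 / 2) one_half_pos

theorem annS_apply (ξ : V) : annS V ξ = (annR ξ : ℝ) := by
  rw [annS, sub_apply, cut_apply, cut_apply, inv_one, one_smul, annR, Complex.ofReal_sub]

theorem norm_cut_sub_cut_le {a b : ℝ} (ha : 0 < a) (hb : 0 < b) (ξ : V) :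
    ‖cut V a ha ξ - cut V b hb ξ‖ ≤ 1 := by
  rw [cut_apply, cut_apply, ← Complex.ofReal_sub, Complex.norm_real, Real.norm_eq_abs, abs_le]
  have h1 := cutR_nonneg (a⁻¹ • ξ)
  have h2 := cutR_le_one (a⁻¹ • ξ)
  have h3 := cutR_nonneg (b⁻¹ • ξ)
  have h4 := cutR_le_one (b⁻¹ • ξ)
  constructor <;> linarith

theorem norm_cut_le {a : ℝ} (ha : 0 < a) (ξ : V) : ‖cut V a ha ξ‖ ≤ 1 := by
  rw [cut_apply, Complex.norm_real, Real.norm_of_nonneg (cutR_nonneg _)]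
  exact cutR_le_one _

theorem annS_ne_zero {ξ : V} (h : annS V ξ ≠ 0) : 1 < ‖ξ‖ ∧ ‖ξ‖ < 4 := by
  rw [annS_apply, Complex.ofReal_ne_zero] at h
  exact ⟨not_le.1 fun h' => h (annR_eq_zero_of_le h'), not_le.1 fun h' => h (annR_eq_zero_of_ge h')⟩

theorem annW_ne_zero {ξ : V} (h : annW V ξ ≠ 0) : 1 / 2 < ‖ξ‖ ∧ ‖ξ‖ ≤ 8 := by
  rw [annW, sub_apply] at h
  refine ⟨not_le.1 fun h' => h ?_, not_lt.1 fun h' => h ?_⟩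
  · rw [cut_eq_one _ (by linarith), cut_eq_one _ h', sub_self]
  · have h1 : cut V 4 four_pos ξ = 0 := by
      by_contra hc
      linarith [cut_ne_zero _ hc]
    have h2 : cut V (1 / 2) one_half_pos ξ = 0 := by
      by_contra hc
      linarith [cut_ne_zero _ hc]
    rw [h1, h2, sub_self]

theorem annW_eq_one {ξ : V} (h1 : 1 ≤ ‖ξ‖) (h4 : ‖ξ‖ ≤ 4) : annW V ξ = 1 := by
  have h2 : cut V (1 / 2) one_half_pos ξ = 0 := by
    rw [cut_apply, cutR_eq_zero, Complex.ofReal_zero]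
    rw [norm_smul, norm_inv]
    norm_num
    linarith
  rw [annW, sub_apply, cut_eq_one _ h4, h2, sub_zero]

theorem enorm_sum_mulConj {ι : Type*} (J : Finset ι) (F : ι → 𝓢(V, ℂ)) (x : V) :
    ‖(∑ j ∈ J, mulConj (F j) (F j)) x‖ₑ = ∑ j ∈ J, ‖F j x‖ₑ ^ 2 := by
  have h : (∑ j ∈ J, mulConj (F j) (F j)) x = ((∑ j ∈ J, ‖F j x‖ ^ 2 : ℝ) : ℂ) := by
    rw [sum_schwartz_apply, Complex.ofReal_sum]
    exact Finset.sum_congr rfl fun j _ => by rw [mulConj_apply, Complex.mul_conj']; push_cast; rfl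
  have h0 : (0 : ℝ) ≤ ∑ j ∈ J, ‖F j x‖ ^ 2 := Finset.sum_nonneg fun j _ => by positivity
  rw [h, ← ofReal_norm, Complex.norm_real, Real.norm_of_nonneg h0,
    ENNReal.ofReal_sum_of_nonneg fun j _ => by positivity]
  exact Finset.sum_congr rfl fun j _ => by rw [ENNReal.ofReal_pow (norm_nonneg _), ofReal_norm]

/-- Differences of points of a cone piece are close to the axis. -/
theorem norm_sub_sub_smul_le {e θ η η' : V} {δ R s r : ℝ} (hδ : 0 < δ) (hsr : s * r = δ)
    (hR : 0 < R) (hs : 0 < s) (hθe : ‖θ - e‖ ≤ 2 * r) (h2 : ‖η‖ ≤ 4 * R) (h3 : ‖η - ‖η‖ • θ‖ ≤ δ * ‖η‖)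
    (h2' : ‖η'‖ ≤ 4 * R) (h3' : ‖η' - ‖η'‖ • θ‖ ≤ δ * ‖η'‖) (hd : ‖η - η'‖ ≤ 4 * (R * s)) :
    ‖(η - η') - (‖η‖ - ‖η'‖) • e‖ ≤ 16 * (R * δ) := by
  have e1 : (η - η') - (‖η‖ - ‖η'‖) • e =
      (η - ‖η‖ • θ) - (η' - ‖η'‖ • θ) + (‖η‖ - ‖η'‖) • (θ - e) := by
    rw [smul_sub, sub_smul, sub_smul]; abel
  rw [e1]
  refine (norm_add_le _ _).trans ((add_le_add_left (norm_sub_le _ _) _).trans ?_)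
  have h6 : ‖(‖η‖ - ‖η'‖) • (θ - e)‖ ≤ 4 * (R * s) * (2 * r) := by
    rw [norm_smul, Real.norm_eq_abs]
    gcongr
    exact (abs_norm_sub_norm_le _ _).trans hd
  have h7 : 4 * (R * s) * (2 * r) = 8 * (R * δ) := by rw [← hsr]; ring
  have h8 : δ * ‖η‖ ≤ δ * (4 * R) := by gcongr
  have h9 : δ * ‖η'‖ ≤ δ * (4 * R) := by gcongr
  linarith

theorem l2_enorm_conv_le_of_norm_le_one {K : 𝓢(V, ℂ)} (hK : ∀ ξ, ‖𝓕 K ξ‖ ≤ 1) (W : 𝓢(V, ℂ)) :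
    ∫⁻ x, ‖conv K W x‖ₑ ^ 2 ≤ ∫⁻ x, ‖W x‖ₑ ^ 2 := by
  have := lintegral_sq_le_of_fourier {()} (conv K W) (fun _ => W) 1 fun ξ => ?_
  · simpa using this
  · rw [fourier_conv, enorm_mul, mul_pow, Finset.sum_singleton]
    gcongr
    refine pow_le_one₀ zero_le ?_
    rw [← ofReal_norm]
    exact ENNReal.ofReal_le_one.2 (hK ξ)

/-- The part of frequency `|ξ| ~ R s` of the square function over the cones in a cap of radius `r`. -/
theorem exists_cap_estimate (N : ℕ) (hN : Module.finrank ℝ V < N) (C₁ : ℝ≥0∞) (hC₁ : C₁ ≠ ⊤) :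
    ∃ C : ℝ≥0∞, C ≠ ⊤ ∧
    ∀ {ι : Type} (J : Finset ι) (θ : ι → V) (hθ : ∀ j, ‖θ j‖ = 1) (K : ι → 𝓢(V, ℂ)) {δ R s r : ℝ}
      (hδ : 0 < δ) (hR : 0 < R) (hs : 0 < s) (hr : 0 < r) (e : V) (he : ‖e‖ = 1),
      s * r = δ → s ≤ 8 → δ ≤ 1 →
      (∀ i ∈ J, ∀ j ∈ J, i ≠ j → δ ≤ ‖θ i - θ j‖) → (∀ j ∈ J, ‖θ j - e‖ ≤ 2 * r) →
      (∀ j ∈ J, ConePiece N C₁ hδ hR (hθ j) (K j)) → ∀ (f : 𝓢(V, ℂ)),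
      ∫⁻ x, ‖conv (dk (dil (R * s) (mul_pos hR hs).ne') (annS V))
          (∑ j ∈ J, mulConj (conv (K j) f) (conv (K j) f)) x‖ₑ ^ 2 ≤
        C * ∫⁻ x, ‖conv (conv (dk (box e he R (R * r) hR (mul_pos hR hr)) (cut V 64 (by norm_num)))
          (dk (dil R hR.ne') (annW V))) f x‖ₑ ^ 4 := by
  obtain ⟨C, hC, H⟩ := cone_local_orthogonality (V := V) N C₁ hC₁
  obtain ⟨C', hC', H'⟩ := enorm_dk_le (cut V 32 (by norm_num)) N
  refine ⟨(C' * (C * wtMass V N)) ^ 2, ENNReal.pow_ne_top (ENNReal.mul_ne_top hC'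
    (ENNReal.mul_ne_top hC (wtMass_ne_top hN))), ?_⟩
  intro ι J θ hθ K δ R s r hδ hR hs hr e he hsr hs8 hδ1 hsep hclose hK f
  set g := conv (conv (dk (box e he R (R * r) hR (mul_pos hR hr)) (cut V 64 (by norm_num)))
          (dk (dil R hR.ne') (annW V))) f with hg
  set L := box e he (R * s) (R * δ) (mul_pos hR hs) (mul_pos hR hδ) with hL
  have hRs := mul_pos hR hs
  have hRδ := mul_pos hR hδ
  -- The cap multiplier is `1` wherever some `𝓕 (K j)` is nonzero, the normalized norm being at most
  -- `4 + 40 ≤ 64`; so `f` may be replaced by its cap projection `g`.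
  have hKg : ∀ j ∈ J, conv (K j) f = conv (K j) g := by
    intro j hj
    refine ext_fourier fun ξ => ?_
    rw [fourier_conv, fourier_conv]
    by_cases h0 : 𝓕 (K j) ξ = 0
    · rw [h0, zero_mul, zero_mul]
    · obtain ⟨h1, h2, h3⟩ := (hK j hj).supp ξ h0
      have e1 : annW V (R⁻¹ • ξ) = 1 := by
        apply annW_eq_one
        · rw [norm_smul, norm_inv, Real.norm_of_nonneg hR.le, inv_mul_eq_div, le_div_iff₀ hR]
          linarith
        · rw [norm_smul, norm_inv, Real.norm_of_nonneg hR.le, inv_mul_eq_div, div_le_iff₀ hR]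
          linarith
      have e2 : cut V 64 (by norm_num) ((box e he R (R * r) hR (mul_pos hR hr)).symm ξ) = 1 := by
        apply cut_eq_one
        rw [box_symm_apply]
        refine (norm_boxLin_le he _ _ ‖ξ‖ ξ).trans ?_
        rw [abs_of_pos (inv_pos.2 hR), abs_of_pos (inv_pos.2 (mul_pos hR hr))]
        have a1 : R⁻¹ * |inner ℝ e ξ| ≤ 4 := by
          rw [inv_mul_le_iff₀ hR]
          refine (abs_real_inner_le_norm _ _).trans ?_
          rw [he]; linarith
        have a2 : (R * r)⁻¹ * ‖ξ - ‖ξ‖ • e‖ ≤ 40 := by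
          rw [inv_mul_le_iff₀ (mul_pos hR hr)]
          have e3 : ξ - ‖ξ‖ • e = (ξ - ‖ξ‖ • θ j) + ‖ξ‖ • (θ j - e) := by rw [smul_sub]; abel
          rw [e3]
          refine (norm_add_le _ _).trans ?_
          rw [norm_smul, norm_norm]
          have b1 : ‖ξ‖ * ‖θ j - e‖ ≤ 4 * R * (2 * r) := by
            gcongr
            exact hclose j hj
          have b2 : δ * ‖ξ‖ ≤ 8 * r * (4 * R) := by
            gcongr
            rw [← hsr]; gcongr
          linarith
        linarith
      rw [hg, fourier_conv, fourier_conv, fourier_dk, fourier_dk, dil_symm_apply, e1, e2, one_mul, one_mul]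
  have hU : ∑ j ∈ J, mulConj (conv (K j) f) (conv (K j) f) =
      ∑ j ∈ J, mulConj (conv (K j) g) (conv (K j) g) :=
    Finset.sum_congr rfl fun j hj => by rw [← hKg j hj]
  set U := ∑ j ∈ J, mulConj (conv (K j) f) (conv (K j) f) with hUdef
  set a := dk (dil (R * s) hRs.ne') (annS V) with ha
  -- Within `‖ξ‖ ≤ 4 R s` the spectrum of `U` lies in the box of length `R s` and width `R δ`, with
  -- normalized norm at most `4 + 16 ≤ 32`. A cutoff to that box can thus be inserted; its kernel is
  -- dominated by the weight for which local orthogonality holds.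
  have hloc : conv a U = conv a (conv (dk L (cut V 32 (by norm_num))) U) := by
    refine ext_fourier fun ξ => ?_
    rw [fourier_conv, fourier_conv, fourier_conv, fourier_dk L]
    by_cases h0 : 𝓕 a ξ = 0
    · rw [h0, zero_mul, zero_mul]
    by_cases hu0 : 𝓕 U ξ = 0
    · rw [hu0, mul_zero, mul_zero, mul_zero]
    have h1 : ‖ξ‖ ≤ 4 * (R * s) := by
      rw [ha, fourier_dk, dil_symm_apply] at h0
      have := (annS_ne_zero h0).2
      rw [norm_smul, norm_inv, Real.norm_of_nonneg hRs.le, inv_mul_eq_div, div_lt_iff₀ hRs] at this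
      exact this.le
    rw [hUdef, fourier_sum] at hu0
    obtain ⟨j, hj, hj0⟩ := Finset.exists_ne_zero_of_sum_ne_zero hu0
    obtain ⟨η, η', hη, hη', rfl⟩ := exists_of_fourier_mulConj_ne_zero hj0
    rw [fourier_conv] at hη hη'
    obtain ⟨-, b2, b3⟩ := (hK j hj).supp η (left_ne_zero_of_mul hη)
    obtain ⟨-, c2, c3⟩ := (hK j hj).supp η' (left_ne_zero_of_mul hη')
    have key := norm_sub_sub_smul_le hδ hsr hR hs (hclose j hj) b2 b3 c2 c3 h1
    rw [cut_eq_one, one_mul]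
    rw [hL, box_symm_apply]
    refine (norm_boxLin_le he _ _ (‖η‖ - ‖η'‖) _).trans ?_
    rw [abs_of_pos (inv_pos.2 hRs), abs_of_pos (inv_pos.2 hRδ)]
    have a1 : (R * s)⁻¹ * |inner ℝ e (η - η')| ≤ 4 := by
      rw [inv_mul_le_iff₀ hRs]
      refine (abs_real_inner_le_norm _ _).trans ?_
      rw [he]; linarith
    have a2 : (R * δ)⁻¹ * ‖η - η' - (‖η‖ - ‖η'‖) • e‖ ≤ 16 := by
      rw [inv_mul_le_iff₀ hRδ]; linarith
    linarith
  have hwm : Measurable (wt N L) := measurable_wt _ _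
  have hgm := measurable_enorm_sq g
  have hpt : ∀ x, ‖conv (dk L (cut V 32 (by norm_num))) U x‖ₑ ≤
      C' * (C * (wt N L ⋆ₗ fun y => ‖g y‖ₑ ^ 2) x) := by
    intro x
    refine (enorm_conv_le _ _ x).trans ?_
    refine (lconv_mono (H' L (selfAdj_box _ _ _)) (fun _ => le_rfl) x).trans ?_
    rw [const_mul_lconv _ hwm (measurable_enorm_schwartz _)]
    gcongr
    rw [hU]
    simp only [enorm_sum_mulConj]
    exact H J θ hθ K hδ hR hs e he hsr hs8 hδ1 hsep hclose hK g x
  rw [hloc]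
  refine (l2_enorm_conv_le_of_norm_le_one (fun ξ => ?_) _).trans ?_
  · rw [ha, fourier_dk]
    exact norm_cut_sub_cut_le _ _ _
  rw [← l2_sq]
  have h4 : ∫⁻ x, ‖g x‖ₑ ^ 4 = l2 (fun x => ‖g x‖ₑ ^ 2) ^ 2 := by
    rw [l2_sq]; congr with x; ring
  rw [h4, ← mul_pow]
  gcongr
  refine (l2_mono hpt).trans ?_
  have hlm : Measurable (wt N L ⋆ₗ fun y => ‖g y‖ₑ ^ 2) := measurable_lconvolution _ hwm hgm
  rw [l2_const_mul _ (hlm.const_mul _), l2_const_mul _ hlm, mul_assoc, mul_assoc]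
  gcongr
  refine (l2_lconv_le hwm hgm).trans ?_
  rw [lintegral_wt]

end HighFrequency

/-! ### Summing a shell over caps and scales. -/

section HighSum

variable {V : Type*} [NormedAddCommGroup V] [InnerProductSpace ℝ V] [FiniteDimensional ℝ V]
  [MeasurableSpace V] [BorelSpace V]

/-- If `k₀` is the least admissible index, every admissible `k` satisfies `k₀ ≤ k < k₀ + m`. -/
theorem exists_finset_scale {c : ℝ} (hc : 0 < c) (x : ℝ) (m : ℕ) :
    ∃ T : Finset ℕ, T.card ≤ m ∧ ∀ k : ℕ, c * 2 ^ k < x → x ≤ c * 2 ^ k * 2 ^ m → k ∈ T := by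
  classical
  by_cases h : ∃ k : ℕ, c * 2 ^ k < x ∧ x ≤ c * 2 ^ k * 2 ^ m
  · refine ⟨Finset.Ico (Nat.find h) (Nat.find h + m), by simp, fun k h1 h2 => ?_⟩
    rw [Finset.mem_Ico]
    refine ⟨Nat.find_min' h ⟨h1, h2⟩, ?_⟩
    have h3 := h1.trans_le (Nat.find_spec h).2
    rw [mul_assoc, ← pow_add, mul_lt_mul_iff_right₀ hc] at h3
    exact (pow_lt_pow_iff_right₀ one_lt_two).1 h3
  · exact ⟨∅, by simp, fun k h1 h2 => absurd ⟨k, h1, h2⟩ h⟩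

theorem lintegral_enorm_conv_le (K f : 𝓢(V, ℂ)) :
    ∫⁻ x, ‖conv K f x‖ₑ ≤ (∫⁻ x, ‖K x‖ₑ) * ∫⁻ x, ‖f x‖ₑ := by
  rw [← lintegral_lconv (measurable_enorm_schwartz K) (measurable_enorm_schwartz f)]
  exact lintegral_mono (enorm_conv_le K f)

/-- The kernel of a smooth projection to the cap of radius `r` around `e` at frequency `R`. -/
def capKernel {e : V} (he : ‖e‖ = 1) {R r : ℝ} (hR : 0 < R) (hr : 0 < r) : 𝓢(V, ℂ) :=
  conv (dk (box e he R (R * r) hR (mul_pos hR hr)) (cut V 64 (by norm_num)))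
    (dk (dil R hR.ne') (annW V))

/-- The cutoff allows distance `2 * 64 * R r` from the axis; `direction_near` doubles it, and
dividing by `‖ξ‖ > R / 2` doubles it again, giving `512`. -/
theorem fourier_capKernel_ne_zero {e : V} (he : ‖e‖ = 1) {R r : ℝ} (hR : 0 < R) (hr : 0 < r) {ξ : V}
    (h : 𝓕 (capKernel he hR hr) ξ ≠ 0) : R / 2 < ‖ξ‖ ∧ ‖ξ‖ ≤ 8 * R ∧
      (‖e - ‖ξ‖⁻¹ • ξ‖ ≤ (512 : ℕ) * r ∨ ‖e + ‖ξ‖⁻¹ • ξ‖ ≤ (512 : ℕ) * r) := by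
  rw [capKernel, fourier_conv, fourier_dk, fourier_dk, dil_symm_apply] at h
  obtain ⟨h1, h2⟩ := annW_ne_zero (right_ne_zero_of_mul h)
  rw [norm_smul, norm_inv, Real.norm_of_nonneg hR.le, inv_mul_eq_div] at h1 h2
  rw [lt_div_iff₀ hR] at h1
  rw [div_le_iff₀ hR] at h2
  refine ⟨by linarith, h2, ?_⟩
  have hξ : 0 < ‖ξ‖ := lt_trans (by positivity) h1
  have h3 := cut_ne_zero _ (left_ne_zero_of_mul h)
  set z := (box e he R (R * r) hR (mul_pos hR hr)).symm ξ with hz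
  have h4 : boxLin e R (R * r) z = ξ := by
    rw [← box_apply he hR (mul_pos hR hr), hz, ContinuousLinearEquiv.apply_symm_apply]
  have h5 := norm_boxLin_sub_le he (a := R) (b := R * r) z
  rw [h4, abs_of_pos (mul_pos hR hr)] at h5
  have h6 : ‖ξ - (R * inner ℝ e z) • e‖ ≤ R * r * 128 := h5.trans (by gcongr; linarith)
  have h7 : 2 * (R * r * 128) / ‖ξ‖ ≤ (512 : ℕ) * r := by
    rw [div_le_iff₀ hξ]
    push_cast
    nlinarith [mul_le_mul_of_nonneg_left h1.le hr.le]
  rcases direction_near he hξ h6 with h8 | h8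
  · exact Or.inl (h8.trans h7)
  · exact Or.inr (h8.trans h7)

theorem norm_fourier_capKernel_le {e : V} (he : ‖e‖ = 1) {R r : ℝ} (hR : 0 < R) (hr : 0 < r) (ξ : V) :
    ‖𝓕 (capKernel he hR hr) ξ‖ ≤ 1 := by
  rw [capKernel, fourier_conv, fourier_dk, fourier_dk, norm_mul]
  exact mul_le_one₀ (norm_cut_le _ _) (norm_nonneg _) (norm_cut_sub_cut_le _ _ _)

/-- The square function over caps in `L⁴`. -/
theorem exists_cap_sum_estimate : ∃ C : ℝ≥0∞, C ≠ ⊤ ∧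
    ∀ {ι : Type} (E : Finset ι) (θ : ι → V) (hθ : ∀ j, ‖θ j‖ = 1) {r R₀ : ℝ} (hr : 0 < r)
      (hR : ∀ k : ℕ, 0 < R₀ * 2 ^ k), (∀ i ∈ E, ∀ j ∈ E, i ≠ j → r ≤ ‖θ i - θ j‖) →
      ∀ (M : ℕ) (f : 𝓢(V, ℂ)), ∑ p ∈ Finset.range M ×ˢ E,
        ∫⁻ x, ‖conv (capKernel (hθ p.2) (hR p.1) hr) f x‖ₑ ^ 4 ≤ C * ∫⁻ x, ‖f x‖ₑ ^ 4 := by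
  classical
  set D : ℝ≥0∞ := (∫⁻ x, ‖𝓕⁻ (cut V 64 (by norm_num)) x‖ₑ) * ∫⁻ x, ‖𝓕⁻ (annW V) x‖ₑ with hD
  have hDt : D ≠ ⊤ := ENNReal.mul_ne_top (lintegral_enorm_schwartz_ne_top _)
    (lintegral_enorm_schwartz_ne_top _)
  -- `m` bounds the overlap of the cap multipliers: four scales satisfy `Rₖ / 2 < ‖ξ‖ ≤ 8 Rₖ`, and
  -- the other factor counts `r`-separated directions near `±ξ / ‖ξ‖`. `B` is chosen with `B ≥ D`
  -- and `B ^ 2 ≥ m`, as interpolation requires.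
  set m : ℕ := 4 * (2 * (2 * 512 + 1) ^ Module.finrank ℝ V) with hm
  set B : ℝ := D.toReal + m + 1 with hB
  have hD0 : 0 ≤ D.toReal := ENNReal.toReal_nonneg
  have hB0 : 0 < B := by positivity
  refine ⟨ENNReal.ofReal (64 * B ^ 4), ENNReal.ofReal_ne_top, ?_⟩
  intro ι E θ hθ r R₀ hr hR hsep M f
  refine sum_lintegral_conv_pow_four_le (Finset.range M ×ˢ E)
    (fun p => capKernel (hθ p.2) (hR p.1) hr) hB0 (fun p _ => ?_) (fun ξ => ?_) f
  · refine (lintegral_enorm_conv_le _ _).trans ?_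
    rw [lintegral_enorm_dk (selfAdj_box _ _ _), lintegral_enorm_dk (selfAdj_dil _), ← hD,
      ← ENNReal.ofReal_toReal hDt]
    apply ENNReal.ofReal_le_ofReal
    rw [hB]
    have : (0 : ℝ) ≤ m := by positivity
    linarith
  · have hR0 : 0 < R₀ := by simpa using hR 0
    obtain ⟨T, hT, hTm⟩ := exists_finset_scale (c := R₀ / 2) (by positivity) ‖ξ‖ 4
    obtain ⟨t, ht, htm⟩ := exists_finset_near hr E hsep (‖ξ‖⁻¹ • ξ) 512
    have hcard : (T ×ˢ t).card ≤ m := by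
      rw [Finset.card_product]; exact Nat.mul_le_mul hT ht
    rw [← Finset.sum_subset
      (Finset.inter_subset_left : (Finset.range M ×ˢ E) ∩ (T ×ˢ t) ⊆ Finset.range M ×ˢ E)]
    · calc _ ≤ ∑ p ∈ (Finset.range M ×ˢ E) ∩ (T ×ˢ t), (1 : ℝ≥0∞) := by
            refine Finset.sum_le_sum fun p _ => pow_le_one₀ zero_le ?_
            rw [← ofReal_norm]
            exact ENNReal.ofReal_le_one.2 (norm_fourier_capKernel_le _ _ _ _)
        _ ≤ m := by
            rw [Finset.sum_const, nsmul_one]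
            exact_mod_cast (Finset.card_le_card Finset.inter_subset_right).trans hcard
        _ ≤ _ := by
            rw [← ENNReal.ofReal_natCast]
            apply ENNReal.ofReal_le_ofReal
            have h1 : (0 : ℝ) ≤ m := by positivity
            rw [hB]
            nlinarith
    · intro p hp hp'
      by_contra h0
      have h0' : 𝓕 (capKernel (hθ p.2) (hR p.1) hr) ξ ≠ 0 := fun h => h0 (by simp [h])
      obtain ⟨a1, a2, a3⟩ := fourier_capKernel_ne_zero _ _ _ h0'
      apply hp'
      rw [Finset.mem_product] at hp
      rw [Finset.mem_inter, Finset.mem_product, Finset.mem_product]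
      exact ⟨hp, hTm p.1 (by linarith) (by linarith), htm p.2 hp.2 a3⟩

theorem scale_pos {δ : ℝ} (hδ : 0 < δ) (l : ℕ) : 0 < δ * 2 ^ l := by positivity

/-- The contribution of the frequencies `|ξ| ~ δ 2ˡ R` to the square function. -/
theorem exists_high_estimate (N : ℕ) (hN : Module.finrank ℝ V < N) (C₁ : ℝ≥0∞) (hC₁ : C₁ ≠ ⊤) :
    ∃ C : ℝ≥0∞, C ≠ ⊤ ∧
    ∀ {ι : Type} (J : Finset ι) (θ : ι → V) (hθ : ∀ j, ‖θ j‖ = 1) (K : ι → ℕ → 𝓢(V, ℂ)) {δ R₀ : ℝ}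
      (hδ : 0 < δ) (hR : ∀ k : ℕ, 0 < R₀ * 2 ^ k) (l : ℕ), δ * 2 ^ l ≤ 8 → δ ≤ 1 →
      (∀ i ∈ J, ∀ j ∈ J, i ≠ j → δ ≤ ‖θ i - θ j‖) →
      (∀ j ∈ J, ∀ k, ConePiece N C₁ hδ (hR k) (hθ j) (K j k)) → ∀ (M : ℕ) (f : 𝓢(V, ℂ)),
      ∫⁻ x, ‖(∑ k ∈ Finset.range M,
          conv (dk (dil (R₀ * 2 ^ k * (δ * 2 ^ l)) (mul_pos (hR k) (scale_pos hδ l)).ne') (annS V))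
            (∑ j ∈ J, mulConj (conv (K j k) f) (conv (K j k) f))) x‖ₑ ^ 2 ≤
        C * ∫⁻ x, ‖f x‖ₑ ^ 4 := by
  classical
  obtain ⟨C, hC, H⟩ := exists_cap_estimate (V := V) N hN C₁ hC₁
  obtain ⟨C', hC', H'⟩ := exists_cap_sum_estimate (V := V)
  set m : ℕ := 2 * (2 * (2 * 32 + 1) ^ Module.finrank ℝ V) with hm
  refine ⟨m * (C * C'), ENNReal.mul_ne_top (ENNReal.natCast_ne_top _) (ENNReal.mul_ne_top hC hC'), ?_⟩
  intro ι J θ hθ K δ R₀ hδ hR l hl hδ1 hsep hK M f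
  have hR0 : 0 < R₀ := by simpa using hR 0
  set s : ℝ := δ * 2 ^ l with hs_def
  have hs : 0 < s := scale_pos hδ l
  -- With `s r = δ`, a box of length `R s` and width `R δ` has angular width `r`, matching the
  -- separation of the caps.
  set r : ℝ := (2 ^ l)⁻¹ with hr_def
  have hr : 0 < r := by positivity
  have hsr : s * r = δ := by rw [hs_def, hr_def, mul_assoc, mul_inv_cancel₀ (by positivity), mul_one]
  obtain ⟨E, hEJ, hEsep, hEmax⟩ := exists_maximal_separated θ r J
  have hτ : ∀ j, ∃ i, j ∈ J → i ∈ E ∧ ‖θ j - θ i‖ ≤ 2 * r := by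
    intro j
    by_cases hj : j ∈ J
    · by_cases hjE : j ∈ E
      · exact ⟨j, fun _ => ⟨hjE, by rw [sub_self, norm_zero]; positivity⟩⟩
      · obtain ⟨i, hi, hij⟩ := hEmax j hj hjE
        exact ⟨i, fun _ => ⟨hi, by linarith⟩⟩
    · exact ⟨j, fun h => absurd h hj⟩
  choose τ hτ using hτ
  set c : ℕ → 𝓢(V, ℂ) := fun k =>
    dk (dil (R₀ * 2 ^ k * s) (mul_pos (hR k) hs).ne') (annS V) with hc
  set U : ℕ → ι → 𝓢(V, ℂ) := fun k e =>
    ∑ j ∈ J.filter (fun j => τ j = e), mulConj (conv (K j k) f) (conv (K j k) f) with hU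
  have hdecomp : (∑ k ∈ Finset.range M, conv (c k)
      (∑ j ∈ J, mulConj (conv (K j k) f) (conv (K j k) f))) =
      ∑ p ∈ Finset.range M ×ˢ E, conv (c p.1) (U p.1 p.2) := by
    rw [Finset.sum_product]
    refine Finset.sum_congr rfl fun k _ => ?_
    change _ = ∑ e ∈ E, conv (c k) (U k e)
    rw [← conv_sum]
    congr 1
    exact (Finset.sum_fiberwise_of_maps_to (fun j hj => (hτ j hj).1) _).symm
  rw [hdecomp]
  -- The shell determines `k` up to two values, and the box puts `ξ / ‖ξ‖` within `32 r` of plus or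
  -- minus the axis of the cap.
  have hov : ∀ ξ, ∃ t : Finset (ℕ × ι), t.card ≤ m ∧
      ∀ p ∈ Finset.range M ×ˢ E, 𝓕 (conv (c p.1) (U p.1 p.2)) ξ ≠ 0 → p ∈ t := by
    intro ξ
    obtain ⟨T, hT, hTm⟩ := exists_finset_scale (c := R₀ * s) (by positivity) ‖ξ‖ 2
    obtain ⟨t, ht, htm⟩ := exists_finset_near hr E hEsep (‖ξ‖⁻¹ • ξ) 32
    refine ⟨T ×ˢ t, by rw [Finset.card_product]; exact Nat.mul_le_mul hT ht, fun p hp h0 => ?_⟩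
    have hRk := hR p.1
    have hRs := mul_pos hRk hs
    rw [Finset.mem_product] at hp
    rw [fourier_conv] at h0
    have h1 := left_ne_zero_of_mul h0
    have h2 := right_ne_zero_of_mul h0
    rw [hc, fourier_dk, dil_symm_apply] at h1
    obtain ⟨a1, a2⟩ := annS_ne_zero h1
    rw [norm_smul, norm_inv, Real.norm_of_nonneg hRs.le, inv_mul_eq_div] at a1 a2
    rw [lt_div_iff₀ hRs] at a1
    rw [div_lt_iff₀ hRs] at a2
    rw [Finset.mem_product]
    refine ⟨hTm p.1 (by nlinarith) (by nlinarith), htm p.2 hp.2 ?_⟩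
    rw [hU, fourier_sum] at h2
    obtain ⟨j, hj, hj0⟩ := Finset.exists_ne_zero_of_sum_ne_zero h2
    rw [Finset.mem_filter] at hj
    obtain ⟨η, η', hη, hη', rfl⟩ := exists_of_fourier_mulConj_ne_zero hj0
    rw [fourier_conv] at hη hη'
    obtain ⟨-, b2, b3⟩ := (hK j hj.1 p.1).supp η (left_ne_zero_of_mul hη)
    obtain ⟨-, c2, c3⟩ := (hK j hj.1 p.1).supp η' (left_ne_zero_of_mul hη')
    have hclose := (hτ j hj.1).2
    rw [hj.2] at hclose
    have key := norm_sub_sub_smul_le hδ hsr hRk hs hclose b2 b3 c2 c3 a2.le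
    have hξ : 0 < ‖η - η'‖ := lt_trans (by positivity) a1
    have h7 : 2 * (16 * (R₀ * 2 ^ p.1 * δ)) / ‖η - η'‖ ≤ (32 : ℕ) * r := by
      rw [div_le_iff₀ hξ]
      push_cast
      have h8 := mul_le_mul_of_nonneg_left a1.le hr.le
      have h9 : r * (1 * (R₀ * 2 ^ p.1 * s)) = R₀ * 2 ^ p.1 * δ := by rw [← hsr]; ring
      rw [h9] at h8
      linarith
    rcases direction_near (hθ p.2) hξ key with h8 | h8
    · exact Or.inl (h8.trans h7)
    · exact Or.inr (h8.trans h7)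
  refine (lintegral_enorm_sum_sq_le _ _ m hov).trans ?_
  rw [mul_assoc (m : ℝ≥0∞), mul_assoc C]
  refine mul_le_mul' le_rfl (le_trans ?_ (mul_le_mul' le_rfl (H' E θ hθ hr hR hEsep M f)))
  rw [Finset.mul_sum]
  refine Finset.sum_le_sum fun p hp => ?_
  exact H (J.filter (fun j => τ j = p.2)) θ hθ (fun j => K j p.1) hδ (hR p.1) hs hr (θ p.2) (hθ p.2)
    hsr hl hδ1 (fun i hi j hj => hsep i (Finset.mem_filter.1 hi).1 j (Finset.mem_filter.1 hj).1)
    (fun j hj => by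
      have := (hτ j (Finset.mem_filter.1 hj).1).2
      rwa [(Finset.mem_filter.1 hj).2] at this)
    (fun j hj => hK j (Finset.mem_filter.1 hj).1 p.1) f

end HighSum

/-! ### The low part, and assembly of the shells. -/

section PieceSquareFunction

variable {V : Type*} [NormedAddCommGroup V] [InnerProductSpace ℝ V] [FiniteDimensional ℝ V]
  [MeasurableSpace V] [BorelSpace V]

theorem conv_zero (K : 𝓢(V, ℂ)) : conv K 0 = 0 :=
  ext_fourier fun ξ => by rw [fourier_conv, FourierTransform.fourier_zero]; simp

theorem hasCompactSupport_annW : HasCompactSupport (annW V) :=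
  HasCompactSupport.intro (isCompact_closedBall (0 : V) 8) fun x hx => by
    by_contra h
    exact hx (by simpa using (annW_ne_zero h).2)

theorem conv_annW_eq {N : ℕ} {C₁ : ℝ≥0∞} {δ R : ℝ} {hδ : 0 < δ} {hR : 0 < R} {θ : V} {hθ : ‖θ‖ = 1}
    {K : 𝓢(V, ℂ)} (hK : ConePiece N C₁ hδ hR hθ K) (f : 𝓢(V, ℂ)) :
    conv K (conv (dk (dil R hR.ne') (annW V)) f) = conv K f := by
  refine ext_fourier fun ξ => ?_
  rw [fourier_conv, fourier_conv, fourier_conv]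
  by_cases h0 : 𝓕 K ξ = 0
  · rw [h0, zero_mul, zero_mul]
  · obtain ⟨h1, h2, -⟩ := hK.supp ξ h0
    rw [fourier_dk, dil_symm_apply, annW_eq_one, one_mul]
    · rw [norm_smul, norm_inv, Real.norm_of_nonneg hR.le, inv_mul_eq_div, le_div_iff₀ hR]
      linarith
    · rw [norm_smul, norm_inv, Real.norm_of_nonneg hR.le, inv_mul_eq_div, div_le_iff₀ hR]
      linarith

/-- The contribution of the frequencies `|ξ| ≲ δ R` to the square function. -/
theorem exists_low_estimate (N : ℕ) (hN : Module.finrank ℝ V < N) (C₁ : ℝ≥0∞) (hC₁ : C₁ ≠ ⊤) :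
    ∃ C : ℝ≥0∞, C ≠ ⊤ ∧
    ∀ {ι : Type} (J : Finset ι) (θ : ι → V) (hθ : ∀ j, ‖θ j‖ = 1) (K : ι → ℕ → 𝓢(V, ℂ)) {δ R₀ : ℝ}
      (hδ : 0 < δ) (hR : ∀ k : ℕ, 0 < R₀ * 2 ^ k), δ ≤ 1 →
      (∀ i ∈ J, ∀ j ∈ J, i ≠ j → δ ≤ ‖θ i - θ j‖) →
      (∀ j ∈ J, ∀ k, ConePiece N C₁ hδ (hR k) (hθ j) (K j k)) → ∀ (M : ℕ) (f : 𝓢(V, ℂ)),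
      l2 (fun x => ‖(∑ k ∈ Finset.range M,
          conv (dk (dil (R₀ * 2 ^ k * δ) (mul_pos (hR k) hδ).ne') (cut V 1 one_pos))
            (∑ j ∈ J, mulConj (conv (K j k) f) (conv (K j k) f))) x‖ₑ) ≤
        C * l2 (fun x => ‖f x‖ₑ ^ 2) := by
  obtain ⟨C, hC, H⟩ := cone_local_orthogonality (V := V) N C₁ hC₁
  obtain ⟨C', hC', H'⟩ := enorm_dk_le (cut V 1 one_pos) N
  obtain ⟨C₂, hC₂, H₂⟩ := littlewoodPaley (annW V) hasCompactSupport_annW one_half_pos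
    fun ξ hξ => by
      by_contra h
      linarith [(annW_ne_zero h).1]
  refine ⟨C' * C * (2 ^ (N + 2) * wtMass V N * C₂), ENNReal.mul_ne_top (ENNReal.mul_ne_top hC' hC)
    (ENNReal.mul_ne_top (ENNReal.mul_ne_top (ENNReal.pow_ne_top (by norm_num)) (wtMass_ne_top hN)) hC₂),
    ?_⟩
  intro ι J θ hθ K δ R₀ hδ hR hδ1 hsep hK M f
  rcases J.eq_empty_or_nonempty with rfl | ⟨j₀, hj₀⟩
  · have : (fun x : V => ‖(∑ k ∈ Finset.range M,
          conv (dk (dil (R₀ * 2 ^ k * δ) (mul_pos (hR k) hδ).ne') (cut V 1 one_pos))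
            (∑ j ∈ (∅ : Finset ι), mulConj (conv (K j k) f) (conv (K j k) f))) x‖ₑ) = fun _ => 0 := by
      ext x
      simp [conv_zero]
    rw [this]
    simp [l2]
  set g : ℕ → 𝓢(V, ℂ) := fun k => conv (dk (dil (R₀ * 2 ^ k) (hR k).ne') (annW V)) f with hg
  set w : ℕ → V → ℝ≥0∞ := fun k =>
    wt N (dil (R₀ * 2 ^ k * δ) (mul_pos (hR k) hδ).ne') with hw
  have hwm : ∀ k, Measurable (w k) := fun k => measurable_wt _ _
  have hpt : ∀ x, ‖(∑ k ∈ Finset.range M,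
          conv (dk (dil (R₀ * 2 ^ k * δ) (mul_pos (hR k) hδ).ne') (cut V 1 one_pos))
            (∑ j ∈ J, mulConj (conv (K j k) f) (conv (K j k) f))) x‖ₑ ≤
      C' * C * ∑ k ∈ Finset.range M, (w k ⋆ₗ fun y => ‖g k y‖ₑ ^ 2) x := by
    intro x
    rw [sum_schwartz_apply, Finset.mul_sum]
    refine (enorm_sum_le _ _).trans (Finset.sum_le_sum fun k _ => ?_)
    refine (enorm_conv_le _ _ x).trans ?_
    refine (lconv_mono (H' _ (selfAdj_dil _)) (fun _ => le_rfl) x).trans ?_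
    rw [const_mul_lconv _ (hwm k) (measurable_enorm_schwartz _), mul_assoc]
    gcongr
    simp only [enorm_sum_mulConj]
    -- With `s = δ` and `r = 1` the box is a ball of radius `R δ`. Any unit vector serves as axis,
    -- all directions being within distance `2`; one is borrowed from `J`, which is why empty `J`
    -- was treated apart.
    have h1 := H J θ hθ (fun j => K j k) hδ (hR k) hδ (θ j₀) (hθ j₀) (mul_one δ) (by linarith) hδ1 hsep
      (fun j _ => (norm_sub_le _ _).trans (by rw [hθ, hθ]; norm_num)) (fun j hj => hK j hj k) (g k) x
    rw [box_self] at h1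
    refine le_trans (le_of_eq ?_) h1
    congr 1
    ext y
    refine Finset.sum_congr rfl fun j hj => ?_
    rw [hg, conv_annW_eq (hK j hj k)]
  refine (l2_mono hpt).trans ?_
  have hlm : ∀ k, Measurable (w k ⋆ₗ fun y => ‖g k y‖ₑ ^ 2) := fun k =>
    measurable_lconvolution _ (hwm k) (measurable_enorm_sq _)
  rw [l2_const_mul _ (Finset.measurable_fun_sum _ fun k _ => hlm k), mul_assoc (C' * C)]
  gcongr
  refine (l2_sum_wt_dil_lconv_le hN (Finset.range M) (R := fun k => R₀ * 2 ^ k * δ)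
    (fun k => mul_pos (hR k) hδ) (a := fun k y => ‖g k y‖ₑ ^ 2)
    (fun k => measurable_enorm_sq _)).trans ?_
  rw [mul_assoc _ C₂]
  gcongr
  exact H₂ R₀ hR M f

theorem sum_annR_telescope (ρ : ℝ) (Λ : ℕ) (ξ : V) :
    cutR (ρ⁻¹ • ξ) + ∑ l ∈ Finset.range Λ, annR ((ρ * 2 ^ l)⁻¹ • ξ) = cutR ((ρ * 2 ^ Λ)⁻¹ • ξ) := by
  induction Λ with
  | zero => simp
  | succ Λ ih =>
    rw [Finset.sum_range_succ, ← add_assoc, ih, annR, smul_smul, ← mul_inv, pow_succ]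
    have : (2 : ℝ) * (ρ * 2 ^ Λ) = ρ * (2 ^ Λ * 2) := by ring
    rw [this]
    ring

/-- The square function of the frequency localized cone multipliers. -/
theorem exists_piece_estimate (N : ℕ) (hN : Module.finrank ℝ V < N) (C₁ : ℝ≥0∞) (hC₁ : C₁ ≠ ⊤) :
    ∃ C : ℝ≥0∞, C ≠ ⊤ ∧
    ∀ {ι : Type} (J : Finset ι) (θ : ι → V) (hθ : ∀ j, ‖θ j‖ = 1) (K : ι → ℕ → 𝓢(V, ℂ)) {δ R₀ : ℝ}
      (hδ : 0 < δ) (hR : ∀ k : ℕ, 0 < R₀ * 2 ^ k), δ ≤ 1 →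
      (∀ i ∈ J, ∀ j ∈ J, i ≠ j → δ ≤ ‖θ i - θ j‖) →
      (∀ j ∈ J, ∀ k, ConePiece N C₁ hδ (hR k) (hθ j) (K j k)) →
      ∀ Λ : ℕ, (∀ l < Λ, δ * 2 ^ l ≤ 8) → 8 ≤ δ * 2 ^ Λ → ∀ (M : ℕ) (f : 𝓢(V, ℂ)),
      l2 (fun x => ∑ k ∈ Finset.range M, ∑ j ∈ J, ‖conv (K j k) f x‖ₑ ^ 2) ≤
        C * (Λ + 1) * l2 (fun x => ‖f x‖ₑ ^ 2) := by
  obtain ⟨C, hC, H⟩ := exists_low_estimate (V := V) N hN C₁ hC₁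
  obtain ⟨C', hC', H'⟩ := exists_high_estimate (V := V) N hN C₁ hC₁
  refine ⟨C + C' ^ (1 / 2 : ℝ), ENNReal.add_ne_top.2 ⟨hC, ENNReal.rpow_ne_top_of_nonneg (by norm_num) hC'⟩,
    ?_⟩
  intro ι J θ hθ K δ R₀ hδ hR hδ1 hsep hK Λ hΛ hΛ' M f
  set U : ℕ → 𝓢(V, ℂ) := fun k => ∑ j ∈ J, mulConj (conv (K j k) f) (conv (K j k) f) with hU
  set lo : 𝓢(V, ℂ) := ∑ k ∈ Finset.range M,
    conv (dk (dil (R₀ * 2 ^ k * δ) (mul_pos (hR k) hδ).ne') (cut V 1 one_pos)) (U k) with hlo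
  set hi : ℕ → 𝓢(V, ℂ) := fun l => ∑ k ∈ Finset.range M,
    conv (dk (dil (R₀ * 2 ^ k * (δ * 2 ^ l)) (mul_pos (hR k) (scale_pos hδ l)).ne') (annS V)) (U k)
    with hhi
  -- The decomposition is exact: `U k` has spectrum in `‖ξ‖ ≤ 8 R₀ 2ᵏ`, where the cutoffs sum to `1`
  -- because `8 ≤ δ 2^Λ`.
  have hdec : ∑ k ∈ Finset.range M, U k = lo + ∑ l ∈ Finset.range Λ, hi l := by
    have hswap : ∑ l ∈ Finset.range Λ, hi l = ∑ k ∈ Finset.range M, ∑ l ∈ Finset.range Λ,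
        conv (dk (dil (R₀ * 2 ^ k * (δ * 2 ^ l)) (mul_pos (hR k) (scale_pos hδ l)).ne') (annS V)) (U k) :=
      Finset.sum_comm
    rw [hswap, hlo, ← Finset.sum_add_distrib]
    refine Finset.sum_congr rfl fun k _ => ext_fourier fun ξ => ?_
    rw [FourierTransform.fourier_add, add_apply, fourier_sum (Finset.range Λ)]
    simp only [fourier_conv, fourier_dk, dil_symm_apply]
    rw [← Finset.sum_mul, ← add_mul]
    by_cases h0 : 𝓕 (U k) ξ = 0
    · rw [h0, mul_zero]
    have hξ : ‖ξ‖ ≤ 8 * (R₀ * 2 ^ k) := by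
      rw [hU, fourier_sum] at h0
      obtain ⟨j, hj, hj0⟩ := Finset.exists_ne_zero_of_sum_ne_zero h0
      obtain ⟨η, η', hη, hη', rfl⟩ := exists_of_fourier_mulConj_ne_zero hj0
      rw [fourier_conv] at hη hη'
      have h1 := ((hK j hj k).supp η (left_ne_zero_of_mul hη)).2.1
      have h2 := ((hK j hj k).supp η' (left_ne_zero_of_mul hη')).2.1
      exact (norm_sub_le _ _).trans (by linarith)
    have hp : 0 < R₀ * 2 ^ k * δ := mul_pos (hR k) hδ
    have ht := sum_annR_telescope (R₀ * 2 ^ k * δ) Λ ξ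
    rw [cutR_eq_one (ξ := (R₀ * 2 ^ k * δ * 2 ^ Λ)⁻¹ • ξ)] at ht
    · have ht' : cut V 1 one_pos ((R₀ * 2 ^ k * δ)⁻¹ • ξ) + ∑ l ∈ Finset.range Λ,
          annS V ((R₀ * 2 ^ k * (δ * 2 ^ l))⁻¹ • ξ) = 1 := by
        simp only [cut_apply, annS_apply, inv_one, one_smul, ← mul_assoc]
        exact_mod_cast ht
      rw [ht', one_mul]
    · rw [norm_smul, norm_inv, Real.norm_of_nonneg (by positivity), inv_mul_eq_div, div_le_one (by positivity)]
      refine hξ.trans ?_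
      rw [mul_comm 8, mul_assoc (R₀ * 2 ^ k)]
      have := (hR k).le
      gcongr
  have hpt : ∀ x, ∑ k ∈ Finset.range M, ∑ j ∈ J, ‖conv (K j k) f x‖ₑ ^ 2 ≤
      ‖lo x‖ₑ + ∑ l ∈ Finset.range Λ, ‖hi l x‖ₑ := by
    intro x
    have h1 : ∑ k ∈ Finset.range M, ∑ j ∈ J, ‖conv (K j k) f x‖ₑ ^ 2 =
        ‖(∑ k ∈ Finset.range M, U k) x‖ₑ := by
      rw [hU, ← Finset.sum_product', ← Finset.sum_product',
        enorm_sum_mulConj (Finset.range M ×ˢ J) (fun p => conv (K p.2 p.1) f)]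
    rw [h1, hdec, add_apply, sum_schwartz_apply (Finset.range Λ) hi]
    exact (enorm_add_le _ _).trans (add_le_add_right (enorm_sum_le _ _) _)
  refine (l2_mono hpt).trans ?_
  have hm := fun l => measurable_enorm_schwartz (hi l)
  refine (l2_add_le (measurable_enorm_schwartz lo) (Finset.measurable_fun_sum _ fun l _ => hm l)).trans ?_
  have h1 := H J θ hθ K hδ hR hδ1 hsep hK M f
  have h2 : ∀ l ∈ Finset.range Λ, l2 (fun x => ‖hi l x‖ₑ) ≤
      C' ^ (1 / 2 : ℝ) * l2 (fun x => ‖f x‖ₑ ^ 2) := by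
    intro l hl
    have h3 := H' J θ hθ K hδ hR l (hΛ l (Finset.mem_range.1 hl)) hδ1 hsep hK M f
    rw [l2, l2, ← ENNReal.mul_rpow_of_nonneg _ _ (by norm_num)]
    refine ENNReal.rpow_le_rpow ?_ (by norm_num)
    refine h3.trans (le_of_eq ?_)
    congr with x
    ring
  -- This triangle inequality over the `Λ` shells is the source of the logarithm.
  calc _ ≤ C * l2 (fun x => ‖f x‖ₑ ^ 2) +
        ∑ l ∈ Finset.range Λ, C' ^ (1 / 2 : ℝ) * l2 (fun x => ‖f x‖ₑ ^ 2) :=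
        add_le_add h1 ((l2_sum_le _ fun l _ => hm l).trans (Finset.sum_le_sum h2))
    _ = (C + Λ * C' ^ (1 / 2 : ℝ)) * l2 (fun x => ‖f x‖ₑ ^ 2) := by
        rw [Finset.sum_const, Finset.card_range, nsmul_eq_mul]; ring
    _ ≤ _ := by
        gcongr
        rw [mul_add, mul_one, add_mul, add_comm]
        gcongr
        · rw [mul_comm]; exact le_add_self
        · exact le_self_add

end PieceSquareFunction

/-! ### Removing the sum over scales from the square function. -/

section ScaleSum

variable {V : Type*} [NormedAddCommGroup V] [InnerProductSpace ℝ V] [FiniteDimensional ℝ V]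
  [MeasurableSpace V] [BorelSpace V]

theorem two_mul_re_mul_conj_le (a b : ℂ) : 2 * (a * starRingEnd ℂ b).re ≤ ‖a‖ ^ 2 + ‖b‖ ^ 2 := by
  have h1 := Complex.abs_re_le_norm (a * starRingEnd ℂ b)
  rw [norm_mul, RCLike.norm_conj, abs_le] at h1
  nlinarith [sq_nonneg (‖a‖ - ‖b‖), h1.2]

theorem sq_norm_add (a b : ℂ) :
    ‖b + a‖ ^ 2 = ‖b‖ ^ 2 + ‖a‖ ^ 2 + 2 * (a * starRingEnd ℂ b).re := by
  rw [← Complex.normSq_eq_norm_sq, ← Complex.normSq_eq_norm_sq, ← Complex.normSq_eq_norm_sq,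
    Complex.normSq_add, ← Complex.conj_re (b * _)]
  simp [mul_comm]

/-- Expansion of the square of a sum, separating the terms close to the diagonal. -/
theorem sq_norm_sum_le (a : ℕ → ℂ) (M : ℕ) :
    ‖∑ k ∈ Finset.range M, a k‖ ^ 2 ≤ 5 * ∑ k ∈ Finset.range M, ‖a k‖ ^ 2 +
      2 * ∑ k ∈ Finset.range M, (a k * starRingEnd ℂ (∑ i ∈ Finset.range (k - 2), a i)).re := by
  -- A new term `a M` pays `3 ‖a M‖²` for its own square and its half of the cross terms with `a (M
  -- - 1)` and `a (M - 2)`; the other halves are charged to the two shorter sums, so the total is `3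
  -- + 1 + 1 = 5`.
  have key : ‖∑ k ∈ Finset.range M, a k‖ ^ 2 ≤ 3 * ∑ k ∈ Finset.range M, ‖a k‖ ^ 2 +
      ∑ k ∈ Finset.range (M - 1), ‖a k‖ ^ 2 + ∑ k ∈ Finset.range (M - 2), ‖a k‖ ^ 2 +
      2 * ∑ k ∈ Finset.range M, (a k * starRingEnd ℂ (∑ i ∈ Finset.range (k - 2), a i)).re := by
    induction M with
    | zero => simp
    | succ M ih =>
      rw [Finset.sum_range_succ, sq_norm_add, Finset.sum_range_succ (fun k => ‖a k‖ ^ 2) M,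
        Finset.sum_range_succ _ M]
      rcases M with _ | _ | m
      · simp
        nlinarith [sq_nonneg ‖a 0‖]
      · simp at ih ⊢
        have h1 := two_mul_re_mul_conj_le (a 1) (a 0)
        simp at h1
        nlinarith [sq_nonneg ‖a 0‖, sq_nonneg ‖a 1‖]
      · have h1 := two_mul_re_mul_conj_le (a (m + 2)) (a m)
        have h2 := two_mul_re_mul_conj_le (a (m + 2)) (a (m + 1))
        have e : (a (m + 2) * starRingEnd ℂ (∑ k ∈ Finset.range (m + 2), a k)).re =
            (a (m + 2) * starRingEnd ℂ (∑ k ∈ Finset.range m, a k)).re +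
            (a (m + 2) * starRingEnd ℂ (a m)).re + (a (m + 2) * starRingEnd ℂ (a (m + 1))).re := by
          rw [Finset.sum_range_succ, Finset.sum_range_succ, map_add, map_add, mul_add, mul_add,
            Complex.add_re, Complex.add_re]
        have e3 : m + 1 + 1 + 1 - 1 = m + 2 := by omega
        have e4 : m + 1 + 1 + 1 - 2 = m + 1 := by omega
        have e5 : m + 1 + 1 - 1 = m + 1 := by omega
        have e6 : m + 1 + 1 - 2 = m := by omega
        rw [e5, e6] at ih
        rw [e3, e4, e6]
        have s1 := Finset.sum_range_succ (fun k => ‖a k‖ ^ 2) (m + 1)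
        have s2 := Finset.sum_range_succ (fun k => ‖a k‖ ^ 2) m
        simp only [show m + 1 + 1 = m + 2 from rfl] at *
        linarith
  have h1 : ∀ n ≤ M, ∑ k ∈ Finset.range n, ‖a k‖ ^ 2 ≤ ∑ k ∈ Finset.range M, ‖a k‖ ^ 2 := fun n hn =>
    Finset.sum_le_sum_of_subset_of_nonneg (Finset.range_subset_range.2 hn) fun _ _ _ => by positivity
  linarith [h1 (M - 1) (by omega), h1 (M - 2) (by omega)]

theorem enorm_sum_mul_conj_sq_le {ι : Type*} (J : Finset ι) (u v : ι → ℂ) :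
    ‖∑ j ∈ J, u j * starRingEnd ℂ (v j)‖ₑ ^ 2 ≤ (∑ j ∈ J, ‖u j‖ₑ ^ 2) * ∑ j ∈ J, ‖v j‖ₑ ^ 2 := by
  have h1 : ‖∑ j ∈ J, u j * starRingEnd ℂ (v j)‖ ^ 2 ≤ (∑ j ∈ J, ‖u j‖ ^ 2) * ∑ j ∈ J, ‖v j‖ ^ 2 := by
    refine le_trans ?_ (Finset.sum_mul_sq_le_sq_mul_sq J (fun j => ‖u j‖) fun j => ‖v j‖)
    gcongr
    refine (norm_sum_le _ _).trans (le_of_eq ?_)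
    simp
  have h2 := ENNReal.ofReal_le_ofReal h1
  rw [ENNReal.ofReal_mul (Finset.sum_nonneg fun _ _ => by positivity),
    ENNReal.ofReal_sum_of_nonneg fun i _ => by positivity,
    ENNReal.ofReal_sum_of_nonneg fun i _ => by positivity] at h2
  simpa [ENNReal.ofReal_pow, ofReal_norm] using h2

theorem sum_annR_range (R₀ : ℝ) (m : ℕ) (ξ : V) :
    ∑ k ∈ Finset.range m, annR ((R₀ * 2 ^ k)⁻¹ • ξ) = cutR ((R₀ * 2 ^ m)⁻¹ • ξ) - cutR (R₀⁻¹ • ξ) := by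
  rw [← sum_annR_telescope]; ring

theorem annR_ne_zero_scaled {R : ℝ} (hR : 0 < R) {ξ : V} (h : annR (R⁻¹ • ξ) ≠ 0) :
    R ≤ ‖ξ‖ ∧ ‖ξ‖ ≤ 4 * R := by
  have h1 : 1 < ‖R⁻¹ • ξ‖ := not_le.1 fun h' => h (annR_eq_zero_of_le h')
  have h2 : ‖R⁻¹ • ξ‖ < 4 := not_le.1 fun h' => h (annR_eq_zero_of_ge h')
  rw [norm_smul, norm_inv, Real.norm_of_nonneg hR.le, inv_mul_eq_div] at h1 h2
  rw [lt_div_iff₀ hR] at h1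
  rw [div_lt_iff₀ hR] at h2
  constructor <;> linarith

theorem cutR_mul_of_le {a b : ℝ} (ha : 0 < a) (hb : 0 < b) (hab : 2 * a ≤ b) (ξ : V) :
    cutR (b⁻¹ • ξ) * cutR (a⁻¹ • ξ) = cutR (a⁻¹ • ξ) := by
  by_cases h : 2 ≤ ‖a⁻¹ • ξ‖
  · rw [cutR_eq_zero h, mul_zero]
  · rw [cutR_eq_one (ξ := b⁻¹ • ξ), one_mul]
    rw [not_le, norm_smul, norm_inv, Real.norm_of_nonneg ha.le, inv_mul_eq_div, div_lt_iff₀ ha] at h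
    rw [norm_smul, norm_inv, Real.norm_of_nonneg hb.le, inv_mul_eq_div, div_le_one hb]
    linarith

section

variable {ι : Type} (J : Finset ι) (ψ : ι → V → ℂ) (K : ι → ℕ → 𝓢(V, ℂ)) {R₀ : ℝ}

/-- Both sums of annular cutoffs telescope, and the cutoff at `R₀ 2ᵐ` applied to the longer one
reproduces the shorter one. Hence a partial sum is an average of the full sum, whatever the factor
`ψ j`. -/
theorem sum_conv_eq_conv_sum
    (hR : ∀ k : ℕ, 0 < R₀ * 2 ^ k)
    (hK : ∀ j ∈ J, ∀ k ξ, 𝓕 (K j k) ξ = ψ j ξ * (annR ((R₀ * 2 ^ k)⁻¹ • ξ) : ℝ))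
    {j : ι} (hj : j ∈ J) {m M : ℕ} (hm : m ≠ 0) (hmM : m < M)
    (f : 𝓢(V, ℂ)) :
    ∑ i ∈ Finset.range m, conv (K j i) f =
      conv (dk (dil (R₀ * 2 ^ m) (hR m).ne') (cut V 1 one_pos))
        (∑ i ∈ Finset.range M, conv (K j i) f) := by
  have hR0 : 0 < R₀ := by simpa using hR 0
  refine ext_fourier fun ξ => ?_
  rw [fourier_conv, fourier_sum, fourier_sum, fourier_dk, dil_symm_apply, cut_apply, inv_one, one_smul]
  simp only [fourier_conv, hK j hj]
  rw [← Finset.sum_mul, ← Finset.sum_mul, ← Finset.mul_sum, ← Finset.mul_sum, ← Complex.ofReal_sum,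
    ← Complex.ofReal_sum, sum_annR_range R₀, sum_annR_range R₀]
  have h1 : cutR ((R₀ * 2 ^ m)⁻¹ • ξ) * (cutR ((R₀ * 2 ^ M)⁻¹ • ξ) - cutR (R₀⁻¹ • ξ)) =
      cutR ((R₀ * 2 ^ m)⁻¹ • ξ) - cutR (R₀⁻¹ • ξ) := by
    rw [mul_sub, cutR_mul_of_le hR0 (hR m), mul_comm, cutR_mul_of_le (hR m) (hR M)]
    · rw [mul_left_comm, ← pow_succ']
      gcongr
      · norm_num
      · omega
    · rw [mul_comm]
      gcongr
      exact le_self_pow₀ one_le_two hm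
  rw [← h1, Complex.ofReal_mul]
  ring

/-- The frequencies of the off-diagonal terms. -/
theorem fourier_offdiag_ne_zero
    (hR : ∀ k : ℕ, 0 < R₀ * 2 ^ k)
    (hK : ∀ j ∈ J, ∀ k ξ, 𝓕 (K j k) ξ = ψ j ξ * (annR ((R₀ * 2 ^ k)⁻¹ • ξ) : ℝ))
    {k : ℕ} {f : 𝓢(V, ℂ)} {ξ : V}
    (h : 𝓕 (∑ j ∈ J, mulConj (conv (K j k) f) (∑ i ∈ Finset.range (k - 2), conv (K j i) f)) ξ ≠ 0) :
    R₀ / 4 * 2 ^ k < ‖ξ‖ ∧ ‖ξ‖ ≤ R₀ / 4 * 2 ^ k * 2 ^ 5 := by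
  have hR0 : 0 < R₀ := by simpa using hR 0
  rw [fourier_sum] at h
  obtain ⟨j, hj, hj0⟩ := Finset.exists_ne_zero_of_sum_ne_zero h
  obtain ⟨η, η', hη, hη', rfl⟩ := exists_of_fourier_mulConj_ne_zero hj0
  rw [fourier_conv, hK j hj] at hη
  rw [fourier_sum] at hη'
  obtain ⟨i, hi, hi0⟩ := Finset.exists_ne_zero_of_sum_ne_zero hη'
  rw [fourier_conv, hK j hj] at hi0
  have h1 := annR_ne_zero_scaled (hR k)
    (Complex.ofReal_ne_zero.1 (right_ne_zero_of_mul (left_ne_zero_of_mul hη)))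
  have h2 := annR_ne_zero_scaled (hR i)
    (Complex.ofReal_ne_zero.1 (right_ne_zero_of_mul (left_ne_zero_of_mul hi0)))
  rw [Finset.mem_range] at hi
  -- The gap `i ≤ k - 3` forces `‖η'‖ ≤ 4 R₀ 2ⁱ ≤ R₀ 2ᵏ / 2`, so subtracting `η'` cannot destroy the
  -- size of `η`.
  have h3 : R₀ * 2 ^ i * 8 ≤ R₀ * 2 ^ k := by
    rw [mul_assoc]
    gcongr
    calc (2 : ℝ) ^ i * 8 = 2 ^ (i + 3) := by rw [pow_add]; norm_num
      _ ≤ 2 ^ k := pow_le_pow_right₀ one_le_two (by omega)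
  have h4 := norm_sub_norm_le η η'
  have h5 := norm_sub_le η η'
  have h6 := hR k
  constructor <;> linarith

end

theorem ennreal_add_sq_le (a b : ℝ≥0∞) : (a + b) ^ 2 ≤ 4 * (a ^ 2 + b ^ 2) := by
  wlog h : a ≤ b generalizing a b
  · rw [add_comm, add_comm (a ^ 2)]
    exact this b a (le_of_not_ge h)
  · calc (a + b) ^ 2 ≤ (b + b) ^ 2 := by gcongr
      _ = 4 * b ^ 2 := by ring
      _ ≤ _ := by gcongr; exact le_add_self

/-- A square function of sums over dyadic scales is controlled by the square function of the terms. -/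
theorem exists_scale_sum_estimate (V : Type*) [NormedAddCommGroup V] [InnerProductSpace ℝ V]
    [FiniteDimensional ℝ V] [MeasurableSpace V] [BorelSpace V] : ∃ C : ℝ≥0∞, C ≠ ⊤ ∧
    ∀ {ι : Type} (J : Finset ι) (ψ : ι → V → ℂ) (K : ι → ℕ → 𝓢(V, ℂ)) {R₀ : ℝ}
      (_ : ∀ k : ℕ, 0 < R₀ * 2 ^ k),
      (∀ j ∈ J, ∀ k ξ, 𝓕 (K j k) ξ = ψ j ξ * (annR ((R₀ * 2 ^ k)⁻¹ • ξ) : ℝ)) →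
      ∀ (M : ℕ) (f : 𝓢(V, ℂ)),
      l2 (fun x => ∑ j ∈ J, ‖(∑ k ∈ Finset.range M, conv (K j k) f) x‖ₑ ^ 2) ≤
        C * l2 (fun x => ∑ k ∈ Finset.range M, ∑ j ∈ J, ‖conv (K j k) f x‖ₑ ^ 2) := by
  set N := Module.finrank ℝ V + 1 with hN
  have hN' : Module.finrank ℝ V < N := by omega
  obtain ⟨C, hC, H⟩ := enorm_dk_le (cut V 1 one_pos) N
  set D : ℝ≥0∞ := ∫⁻ x, ‖𝓕⁻ (cut V 1 one_pos) x‖ₑ with hD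
  set B : ℝ≥0∞ := 5 * (D * C * (2 ^ (N + 2) * wtMass V N)) with hB
  have hBt : B ≠ ⊤ := ENNReal.mul_ne_top (by norm_num) (ENNReal.mul_ne_top
    (ENNReal.mul_ne_top (lintegral_enorm_schwartz_ne_top _) hC)
    (ENNReal.mul_ne_top (ENNReal.pow_ne_top (by norm_num)) (wtMass_ne_top hN')))
  refine ⟨1 + (100 + 16 * B), by
    refine ENNReal.add_ne_top.2 ⟨by norm_num, ENNReal.add_ne_top.2 ⟨by norm_num, ?_⟩⟩
    exact ENNReal.mul_ne_top (by norm_num) hBt, ?_⟩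
  intro ι J ψ K R₀ hR hK M f
  have hR0 : 0 < R₀ := by simpa using hR 0
  set F : ι → ℕ → 𝓢(V, ℂ) := fun j k => conv (K j k) f with hF
  set S : V → ℝ≥0∞ := fun x => ∑ j ∈ J, ‖(∑ k ∈ Finset.range M, F j k) x‖ₑ ^ 2 with hS
  set Dk : ℕ → V → ℝ≥0∞ := fun k x => ∑ j ∈ J, ‖F j k x‖ₑ ^ 2 with hDk
  have hSm : Measurable S := Finset.measurable_fun_sum _ fun j _ => measurable_enorm_sq _
  have hDm : ∀ k, Measurable (Dk k) := fun k => Finset.measurable_fun_sum _ fun j _ => measurable_enorm_sq _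
  set g : ℕ → 𝓢(V, ℂ) := fun k => ∑ j ∈ J, mulConj (F j k) (∑ i ∈ Finset.range (k - 2), F j i) with hg
  set w : ℕ → V → ℝ≥0∞ := fun k => wt N (dil (R₀ * 2 ^ (k - 2)) (hR (k - 2)).ne') with hw
  have hwm : ∀ k, Measurable (w k) := fun k => measurable_wt _ _
  have hpt : ∀ x, S x ≤ 5 * (∑ k ∈ Finset.range M, Dk k x) +
      2 * ‖(∑ k ∈ Finset.range M, g k) x‖ₑ := by
    intro x
    have h1 : ∑ j ∈ J, ‖(∑ k ∈ Finset.range M, F j k) x‖ ^ 2 ≤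
        5 * (∑ k ∈ Finset.range M, ∑ j ∈ J, ‖F j k x‖ ^ 2) + 2 * ‖(∑ k ∈ Finset.range M, g k) x‖ := by
      have h2 : ∑ j ∈ J, ‖(∑ k ∈ Finset.range M, F j k) x‖ ^ 2 ≤
          ∑ j ∈ J, (5 * ∑ k ∈ Finset.range M, ‖F j k x‖ ^ 2 + 2 * ∑ k ∈ Finset.range M,
            (F j k x * starRingEnd ℂ (∑ i ∈ Finset.range (k - 2), F j i x)).re) := by
        refine Finset.sum_le_sum fun j _ => ?_
        rw [sum_schwartz_apply]
        exact sq_norm_sum_le (fun k => F j k x) M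
      refine h2.trans ?_
      rw [Finset.sum_add_distrib, ← Finset.mul_sum, ← Finset.mul_sum, Finset.sum_comm]
      gcongr
      rw [Finset.sum_comm]
      have h3 : (∑ k ∈ Finset.range M, g k) x = ∑ k ∈ Finset.range M, ∑ j ∈ J,
          F j k x * starRingEnd ℂ (∑ i ∈ Finset.range (k - 2), F j i x) := by
        rw [sum_schwartz_apply]
        refine Finset.sum_congr rfl fun k _ => ?_
        rw [hg, sum_schwartz_apply]
        refine Finset.sum_congr rfl fun j _ => ?_
        rw [mulConj_apply, sum_schwartz_apply]
      rw [h3]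
      refine le_trans (le_of_eq ?_) (Complex.re_le_norm _)
      rw [Complex.re_sum]
      exact Finset.sum_congr rfl fun k _ => by rw [Complex.re_sum]
    have h2 := ENNReal.ofReal_le_ofReal h1
    rw [ENNReal.ofReal_add (by positivity) (by positivity), ENNReal.ofReal_mul (by norm_num),
      ENNReal.ofReal_mul (by norm_num), ENNReal.ofReal_sum_of_nonneg fun _ _ => by positivity,
      ENNReal.ofReal_sum_of_nonneg fun _ _ => by positivity, ofReal_norm] at h2
    have h3 : ∀ k, ENNReal.ofReal (∑ j ∈ J, ‖F j k x‖ ^ 2) = Dk k x := fun k => by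
      rw [ENNReal.ofReal_sum_of_nonneg fun _ _ => by positivity]
      simp only [ENNReal.ofReal_pow (norm_nonneg _), ofReal_norm, hDk]
    simp only [h3, ENNReal.ofReal_pow (norm_nonneg _), ofReal_norm, ENNReal.ofReal_ofNat] at h2
    exact h2
  have hlow : ∀ k ∈ Finset.range M, ∀ x,
      ∑ j ∈ J, ‖(∑ i ∈ Finset.range (k - 2), F j i) x‖ₑ ^ 2 ≤ D * C * (w k ⋆ₗ S) x := by
    intro k hk x
    rw [Finset.mem_range] at hk
    by_cases h0 : k - 2 = 0
    · rw [h0]; simp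
    rw [hS, lconv_sum _ (hwm k) fun j _ => measurable_enorm_sq _, Finset.mul_sum]
    refine Finset.sum_le_sum fun j hj => ?_
    rw [hF, sum_conv_eq_conv_sum J ψ K hR hK hj h0 (show k - 2 < M by omega)]
    refine (enorm_conv_sq_le _ _ x).trans ?_
    rw [lintegral_enorm_dk (selfAdj_dil _), mul_assoc]
    gcongr
    refine (lconv_mono (H _ (selfAdj_dil _)) (fun _ => le_rfl) x).trans (le_of_eq ?_)
    rw [const_mul_lconv _ (hwm k) (measurable_enorm_sq _)]
  -- After Cauchy–Schwarz in `j`, the low factor is bounded by the average `w k ⋆ₗ S`. The weight is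
  -- then moved to `Dk k`, so that only sums of averages over `k` remain and the dual maximal
  -- inequality applies.
  have hgk : ∀ k ∈ Finset.range M, ∫⁻ x, ‖g k x‖ₑ ^ 2 ≤ D * C * ∫⁻ x, (w k ⋆ₗ Dk k) x * S x := by
    intro k hk
    calc _ ≤ ∫⁻ x, D * C * ((w k ⋆ₗ S) x * Dk k x) := by
          refine lintegral_mono fun x => ?_
          have h1 : g k x = ∑ j ∈ J, F j k x * starRingEnd ℂ ((∑ i ∈ Finset.range (k - 2), F j i) x) := by
            rw [hg, sum_schwartz_apply]
            exact Finset.sum_congr rfl fun j _ => mulConj_apply _ _ _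
          rw [h1]
          refine (enorm_sum_mul_conj_sq_le _ _ _).trans ?_
          rw [← mul_assoc, mul_comm]
          exact mul_le_mul' (hlow k hk x) le_rfl
      _ = D * C * ∫⁻ x, (w k ⋆ₗ S) x * Dk k x :=
          lintegral_const_mul _ ((measurable_lconvolution _ (hwm k) hSm).mul (hDm k))
      _ = _ := by
          rw [lintegral_lconv_mul (hwm k) hSm (hDm k) (fun x => wt_neg _ _ x)]
          congr 2
          ext x
          rw [mul_comm]
  have hG : l2 (fun x => ‖(∑ k ∈ Finset.range M, g k) x‖ₑ) ^ 2 ≤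
      B * (l2 S * l2 (fun x => ∑ k ∈ Finset.range M, Dk k x)) := by
    rw [l2_sq]
    refine (lintegral_enorm_sum_sq_le _ g 5 fun ξ => ?_).trans ?_
    · obtain ⟨T, hT, hTm⟩ := exists_finset_scale (c := R₀ / 4) (by positivity) ‖ξ‖ 5
      refine ⟨T, hT, fun k _ h => ?_⟩
      obtain ⟨h1, h2⟩ := fourier_offdiag_ne_zero J ψ K hR hK h
      exact hTm k h1 h2
    · have hwD : ∀ k, Measurable (w k ⋆ₗ Dk k) := fun k => measurable_lconvolution _ (hwm k) (hDm k)
      calc _ ≤ ((5 : ℕ) : ℝ≥0∞) * ∑ k ∈ Finset.range M, D * C * ∫⁻ x, (w k ⋆ₗ Dk k) x * S x := by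
            gcongr with k hk
            exact hgk k hk
        _ = 5 * (D * C) * ∫⁻ x, (∑ k ∈ Finset.range M, (w k ⋆ₗ Dk k) x) * S x := by
            have hm : ∀ k ∈ Finset.range M, Measurable fun x => (w k ⋆ₗ Dk k) x * S x := fun k _ =>
              (hwD k).mul hSm
            rw [← Finset.mul_sum, ← lintegral_finsetSum _ hm, ← mul_assoc]
            simp only [Finset.sum_mul, Nat.cast_ofNat]
        _ ≤ 5 * (D * C) * (l2 (fun x => ∑ k ∈ Finset.range M, (w k ⋆ₗ Dk k) x) * l2 S) := by
            gcongr
            exact lintegral_mul_le_l2 (Finset.measurable_fun_sum _ fun k _ => hwD k) hSm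
        _ ≤ 5 * (D * C) * ((2 ^ (N + 2) * wtMass V N *
              l2 (fun x => ∑ k ∈ Finset.range M, Dk k x)) * l2 S) := by
            gcongr
            exact l2_sum_wt_dil_lconv_le hN' (Finset.range M) (R := fun k => R₀ * 2 ^ (k - 2))
              (fun k => hR (k - 2)) (a := Dk) hDm
        _ = _ := by rw [hB]; ring
  set X := l2 S with hX
  set Y := l2 (fun x => ∑ k ∈ Finset.range M, Dk k x) with hY
  set Z := l2 (fun x => ‖(∑ k ∈ Finset.range M, g k) x‖ₑ) with hZ
  have hXt : X ≠ ⊤ := by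
    refine ne_top_of_le_ne_top ?_ (l2_sum_le J fun j _ => measurable_enorm_sq _)
    exact ENNReal.sum_ne_top.2 fun j _ => l2_enorm_sq_schwartz_ne_top _
  have hXYZ : X ≤ 5 * Y + 2 * Z := by
    refine (l2_mono hpt).trans ?_
    have hYm : Measurable fun x => ∑ k ∈ Finset.range M, Dk k x :=
      Finset.measurable_fun_sum _ fun k _ => hDm k
    refine (l2_add_le (hYm.const_mul _) ((measurable_enorm_schwartz _).const_mul _)).trans ?_
    rw [l2_const_mul _ hYm, l2_const_mul _ (measurable_enorm_schwartz _)]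
  -- Here `X ≤ 5Y + 2Z` and `Z² ≤ B X Y`. If `Y ≤ X`, then `Y² ≤ X Y`, so `X² ≤ (100 + 16 B) X Y`
  -- and one finite factor `X` cancels.
  rcases le_total X Y with h | h
  · exact h.trans (le_mul_of_one_le_left zero_le le_self_add)
  · refine le_trans (le_of_sq_le_mul hXt (Y := (100 + 16 * B) * Y) ?_) (mul_le_mul' le_add_self le_rfl)
    calc X ^ 2 ≤ (5 * Y + 2 * Z) ^ 2 := by gcongr
      _ ≤ 4 * ((5 * Y) ^ 2 + (2 * Z) ^ 2) := ennreal_add_sq_le _ _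
      _ = 100 * (Y * Y) + 16 * Z ^ 2 := by ring
      _ ≤ 100 * (X * Y) + 16 * (B * (X * Y)) := by gcongr
      _ = _ := by ring

end ScaleSum

/-! ### Frequency truncation and its removal. -/

section Limit

open Filter Topology

theorem le_norm_sub_of_disjoint_ball {n : ℕ} {δ : ℝ} (hδ : 0 < δ) {a b : UnitSphere n}
    (h : Disjoint (Metric.ball a δ) (Metric.ball b δ)) :
    δ ≤ ‖(a : Space n) - (b : Space n)‖ := by
  by_contra hlt
  push Not at hlt
  refine Set.disjoint_left.1 h (Metric.mem_ball_self hδ) ?_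
  rwa [Metric.mem_ball, Subtype.dist_eq, dist_eq_norm]

theorem norm_coe_sphere {n : ℕ} (a : UnitSphere n) : ‖(a : Space n)‖ = 1 :=
  mem_sphere_zero_iff_norm.1 a.2

/-- The square function estimate for the frequency-truncated projections of a Schwartz function. -/
theorem exists_truncated_estimate (n : ℕ) (A : ℕ → ℝ) : ∃ C : ℝ≥0∞, C ≠ ⊤ ∧
    ∀ δ : ℝ, 0 < δ → δ ≤ 1 / 2 → ∀ (ι : Type) [Fintype ι] (c : ι → UnitSphere n)
      (φ : ι → UnitSphere n → ℝ),
      Pairwise (fun i j => Disjoint (Metric.ball (c i) δ) (Metric.ball (c j) δ)) →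
      (∀ j, IsBump A δ (c j) (φ j)) → ∀ Λ : ℕ, (∀ l < Λ, δ * 2 ^ l ≤ 8) → 8 ≤ δ * 2 ^ Λ →
      ∀ (R₀ : ℝ), 0 < R₀ → ∀ (M : ℕ) (f : 𝓢(Space n, ℂ)), ∃ F : ι → 𝓢(Space n, ℂ),
        (∀ j ξ, 𝓕 (F j) ξ = (radialExt (φ j) ξ : ℂ) *
          ((cutR ((R₀ * 2 ^ M)⁻¹ • ξ) - cutR (R₀⁻¹ • ξ) : ℝ) : ℂ) * 𝓕 f ξ) ∧
        l2 (fun x => ∑ j, ‖F j x‖ₑ ^ 2) ≤ C * (Λ + 1) * l2 (fun x => ‖f x‖ₑ ^ 2) := by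
  obtain ⟨C₁, hC₁, h₁⟩ := exists_cone_kernel n A (Module.finrank ℝ (Space n) + 1)
  obtain ⟨C₂, hC₂, h₂⟩ := exists_piece_estimate (V := Space n) _ (Nat.lt_succ_self _) C₁ hC₁
  obtain ⟨C₃, hC₃, h₃⟩ := exists_scale_sum_estimate (Space n)
  refine ⟨C₃ * C₂, ENNReal.mul_ne_top hC₃ hC₂, ?_⟩
  intro δ hδ hδ2 ι _ c φ hdisj hφ Λ hΛ hΛ' R₀ hR₀ M f
  have hR : ∀ k : ℕ, 0 < R₀ * 2 ^ k := fun k => by positivity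
  choose K hK hKm using fun j k =>
    h₁ δ hδ hδ2 (c j) (norm_coe_sphere (c j)) (φ j) (hφ j) (R₀ * 2 ^ k) (hR k)
  refine ⟨fun j => ∑ k ∈ Finset.range M, conv (K j k) f, fun j ξ => ?_, ?_⟩
  · rw [fourier_sum]
    simp only [fourier_conv, hK]
    rw [← Finset.sum_mul, ← Finset.mul_sum, ← Complex.ofReal_sum, sum_annR_range R₀]
  · refine (h₃ Finset.univ (fun j ξ => (radialExt (φ j) ξ : ℂ)) K hR
      (fun j _ k ξ => hK j k ξ) M f).trans ?_
    rw [mul_assoc, mul_assoc, ← mul_assoc C₂]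
    gcongr
    refine h₂ Finset.univ (fun j => (c j : Space n)) (fun j => norm_coe_sphere (c j)) K hδ hR
      (by linarith) (fun i _ j _ hij => le_norm_sub_of_disjoint_ball hδ (hdisj hij))
      (fun j _ k => ⟨fun ξ hξ => ?_, hKm j k⟩) Λ hΛ hΛ' M f
    rw [hK] at hξ
    have h0 := left_ne_zero_of_mul hξ
    have h1 := right_ne_zero_of_mul hξ
    rw [Complex.ofReal_ne_zero] at h0 h1
    obtain ⟨h2, h3⟩ := annR_ne_zero_scaled (hR k) h1
    exact ⟨h2, h3, radialExt_ne_zero (hφ j) h0⟩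

theorem measurable_radialExt {n : ℕ} {A : ℕ → ℝ} {δ : ℝ} {θ : UnitSphere n}
    {φ : UnitSphere n → ℝ} (h : IsBump A δ θ φ) : Measurable (radialExt φ) := by
  refine measurable_of_continuousOn_compl_singleton 0 h.smooth.continuousOn

/-- The truncation runs from `R₀ = 2⁻ᵐ` up to `R₀ 2²ᵐ = 2ᵐ`, so at a fixed nonzero `ξ` it equals `1`
for all large `m`. -/
theorem tendsto_cutR_sub (n : ℕ) {ξ : Space n} (hξ : ξ ≠ 0) :
    Tendsto (fun m : ℕ => cutR (((2 ^ m : ℝ)⁻¹ * 2 ^ (2 * m))⁻¹ • ξ) - cutR ((2 ^ m : ℝ)⁻¹⁻¹ • ξ))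
      atTop (𝓝 1) := by
  have hpos : 0 < ‖ξ‖ := norm_pos_iff.2 hξ
  have h1 : ∀ᶠ m : ℕ in atTop, ‖ξ‖ ≤ 2 ^ m :=
    (tendsto_pow_atTop_atTop_of_one_lt (by norm_num : (1 : ℝ) < 2)).eventually_ge_atTop _
  have h2 : ∀ᶠ m : ℕ in atTop, 2 / ‖ξ‖ ≤ 2 ^ m :=
    (tendsto_pow_atTop_atTop_of_one_lt (by norm_num : (1 : ℝ) < 2)).eventually_ge_atTop _
  refine tendsto_const_nhds.congr' ?_
  filter_upwards [h1, h2] with m hm1 hm2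
  have e : ((2 ^ m : ℝ)⁻¹ * 2 ^ (2 * m))⁻¹ = (2 ^ m : ℝ)⁻¹ := by
    rw [two_mul, pow_add]; field_simp
  have hp : (0 : ℝ) < 2 ^ m := by positivity
  rw [e, inv_inv, cutR_eq_one, cutR_eq_zero, sub_zero]
  · rw [norm_smul, Real.norm_of_nonneg hp.le]
    rwa [div_le_iff₀ hpos] at hm2
  · rw [norm_smul, Real.norm_of_nonneg (by positivity), inv_mul_le_iff₀ hp]
    linarith

theorem abs_cutR_sub_le {V : Type*} [NormedAddCommGroup V] [InnerProductSpace ℝ V]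
    [FiniteDimensional ℝ V] [MeasurableSpace V] [BorelSpace V] (ξ η : V) :
    |cutR ξ - cutR η| ≤ 1 := by
  rw [abs_le]
  constructor <;> linarith [cutR_nonneg ξ, cutR_nonneg η, cutR_le_one ξ, cutR_le_one η]

/-- Dominated convergence on the Fourier side; the origin, where the truncations do not tend to `1`,
is harmless because `radialExt φ` is `0` there. -/
theorem tendsto_smoothProj {n : ℕ} {A : ℕ → ℝ} {δ : ℝ} {θ : UnitSphere n}
    {φ : UnitSphere n → ℝ} (h : IsBump A δ θ φ) (f : 𝓢(Space n, ℂ)) {F : ℕ → 𝓢(Space n, ℂ)}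
    (hF : ∀ m ξ, 𝓕 (F m) ξ = (radialExt φ ξ : ℂ) *
      ((cutR (((2 ^ m : ℝ)⁻¹ * 2 ^ (2 * m))⁻¹ • ξ) - cutR ((2 ^ m : ℝ)⁻¹⁻¹ • ξ) : ℝ) : ℂ) * 𝓕 f ξ)
    (x : Space n) : Tendsto (fun m => F m x) atTop (𝓝 (smoothProj φ f x)) := by
  have e : ∀ m, F m x = 𝓕⁻ (⇑(𝓕 (F m) : 𝓢(Space n, ℂ))) x := fun m => by
    rw [← SchwartzMap.fourierInv_coe, FourierTransform.fourierInv_fourier_eq]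
  simp only [e, smoothProj, Real.fourierInv_eq]
  refine tendsto_integral_of_dominated_convergence (fun ξ => max (A 0) 0 * ‖𝓕 f ξ‖) ?_ ?_ ?_ ?_
  · intro m
    exact ((by fun_prop : Continuous fun v : Space n => Real.fourierChar (inner ℝ v x)).smul
      (𝓕 (F m)).continuous).aestronglyMeasurable
  · exact ((𝓕 f).integrable.norm).const_mul _
  · intro m
    refine Eventually.of_forall fun ξ => ?_
    rw [Circle.norm_smul, hF, norm_mul, norm_mul, Complex.norm_real, Complex.norm_real,
      Real.norm_eq_abs, Real.norm_eq_abs]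
    have h1 := enorm_radialExt_le h ξ
    have h2 := abs_cutR_sub_le (((2 ^ m : ℝ)⁻¹ * 2 ^ (2 * m))⁻¹ • ξ) ((2 ^ m : ℝ)⁻¹⁻¹ • ξ)
    gcongr
    calc _ ≤ max (A 0) 0 * 1 := by gcongr
      _ = _ := mul_one _
  · refine Eventually.of_forall fun ξ => ?_
    refine Tendsto.const_smul ?_ _
    simp only [hF, SchwartzMap.fourier_coe]
    refine Tendsto.mul_const _ ?_
    by_cases hξ : ξ = 0
    · have : radialExt φ ξ = 0 := by simp [radialExt, hξ]
      simp [this]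
    · have := (Complex.continuous_ofReal.tendsto 1).comp (tendsto_cutR_sub n hξ)
      simpa [Function.comp_def] using this.const_mul (radialExt φ ξ : ℂ)

end Limit

/-! ### The estimate for Schwartz functions. -/

section Extension

open Filter Topology

theorem integrable_radialExt_mul {n : ℕ} {A : ℕ → ℝ} {δ : ℝ} {θ : UnitSphere n}
    {φ : UnitSphere n → ℝ} (h : IsBump A δ θ φ) (f : 𝓢(Space n, ℂ)) :
    Integrable fun ξ => (radialExt φ ξ : ℂ) * 𝓕 f ξ := by
  refine (𝓕 f).integrable.bdd_mul (c := max (A 0) 0)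
    (Complex.measurable_ofReal.comp (measurable_radialExt h)).aestronglyMeasurable ?_
  refine Eventually.of_forall fun ξ => ?_
  rw [Complex.norm_real, Real.norm_eq_abs]
  exact enorm_radialExt_le h ξ

theorem integrable_fourierChar_smul {n : ℕ} {g : Space n → ℂ} (hg : Integrable g) (x : Space n) :
    Integrable fun ξ => Real.fourierChar (inner ℝ ξ x) • g ξ := by
  refine (integrable_norm_iff ?_).1 (by simpa using hg.norm)
  exact ((by fun_prop : Continuous fun v : Space n =>
    Real.fourierChar (inner ℝ v x)).aestronglyMeasurable).smul hg.1

theorem smoothProj_apply {n : ℕ} (φ : UnitSphere n → ℝ) (f : 𝓢(Space n, ℂ)) (x : Space n) :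
    smoothProj φ f x =
      ∫ ξ, Real.fourierChar (inner ℝ ξ x) • ((radialExt φ ξ : ℂ) * 𝓕 f ξ) := by
  rw [smoothProj, Real.fourierInv_eq, SchwartzMap.fourier_coe]

theorem continuous_smoothProj {n : ℕ} {A : ℕ → ℝ} {δ : ℝ} {θ : UnitSphere n}
    {φ : UnitSphere n → ℝ} (h : IsBump A δ θ φ) (f : 𝓢(Space n, ℂ)) :
    Continuous (smoothProj φ f) := by
  have e : smoothProj φ f = fun x => ∫ ξ, Real.fourierChar (inner ℝ ξ x) •
      ((radialExt φ ξ : ℂ) * 𝓕 f ξ) := funext (smoothProj_apply φ f)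
  rw [e]
  have hi := integrable_radialExt_mul h f
  refine continuous_of_dominated (bound := fun ξ => ‖(radialExt φ ξ : ℂ) * 𝓕 f ξ‖)
    (fun x => (integrable_fourierChar_smul hi x).1) (fun x => ?_) hi.norm ?_
  · exact Eventually.of_forall fun ξ => by rw [Circle.norm_smul]
  · refine Eventually.of_forall fun ξ => ?_
    exact (by fun_prop : Continuous fun v : Space n =>
      Real.fourierChar (inner ℝ ξ v)).smul continuous_const

theorem smoothProj_add {n : ℕ} {A : ℕ → ℝ} {δ : ℝ} {θ : UnitSphere n}
    {φ : UnitSphere n → ℝ} (h : IsBump A δ θ φ) (f g : 𝓢(Space n, ℂ)) (x : Space n) :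
    smoothProj φ (f + g) x = smoothProj φ f x + smoothProj φ g x := by
  simp only [smoothProj_apply]
  rw [← integral_add (integrable_fourierChar_smul (integrable_radialExt_mul h f) x)
    (integrable_fourierChar_smul (integrable_radialExt_mul h g) x)]
  congr with ξ
  rw [← smul_add, ← mul_add, FourierTransform.fourier_add, _root_.add_apply]

theorem smoothProj_smul {n : ℕ} (φ : UnitSphere n → ℝ) (a : ℂ) (f : 𝓢(Space n, ℂ)) (x : Space n) :
    smoothProj φ (a • f) x = a * smoothProj φ f x := by
  simp only [smoothProj_apply]
  rw [← smul_eq_mul, ← integral_smul]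
  congr with ξ
  rw [FourierTransform.fourier_smul, _root_.smul_apply, smul_comm a]
  simp only [smul_eq_mul]
  congr 1
  ring

/-- The square function estimate for the projections of a Schwartz function. -/
theorem exists_smoothProj_estimate (n : ℕ) (A : ℕ → ℝ) : ∃ C : ℝ≥0∞, C ≠ ⊤ ∧
    ∀ δ : ℝ, 0 < δ → δ ≤ 1 / 2 → ∀ (ι : Type) [Fintype ι] (c : ι → UnitSphere n)
      (φ : ι → UnitSphere n → ℝ),
      Pairwise (fun i j => Disjoint (Metric.ball (c i) δ) (Metric.ball (c j) δ)) →
      (∀ j, IsBump A δ (c j) (φ j)) → ∀ Λ : ℕ, (∀ l < Λ, δ * 2 ^ l ≤ 8) → 8 ≤ δ * 2 ^ Λ →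
      ∀ f : 𝓢(Space n, ℂ), l2 (fun x => ∑ j, ‖smoothProj (φ j) f x‖ₑ ^ 2) ≤
        C * (Λ + 1) * l2 (fun x => ‖f x‖ₑ ^ 2) := by
  obtain ⟨C, hC, h⟩ := exists_truncated_estimate n A
  refine ⟨C, hC, ?_⟩
  intro δ hδ hδ2 ι _ c φ hdisj hφ Λ hΛ hΛ' f
  choose F hF hFb using fun m : ℕ => h δ hδ hδ2 ι c φ hdisj hφ Λ hΛ hΛ' ((2 ^ m : ℝ)⁻¹)
    (by positivity) (2 * m) f
  have hlim : ∀ x, Tendsto (fun m => (∑ j, ‖F m j x‖ₑ ^ 2) ^ 2) atTop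
      (𝓝 ((∑ j, ‖smoothProj (φ j) f x‖ₑ ^ 2) ^ 2)) := fun x => by
    refine ENNReal.Tendsto.pow (tendsto_finsetSum _ fun j _ => ENNReal.Tendsto.pow ?_)
    exact (tendsto_smoothProj (hφ j) f (fun m ξ => hF m j ξ) x).enorm
  refine (ENNReal.pow_le_pow_left_iff (n := 2) (by norm_num)).1 ?_
  rw [l2_sq]
  -- Fatou's lemma, the truncated bounds being uniform in `m`.
  calc ∫⁻ x, (∑ j, ‖smoothProj (φ j) f x‖ₑ ^ 2) ^ 2
      = ∫⁻ x, liminf (fun m => (∑ j, ‖F m j x‖ₑ ^ 2) ^ 2) atTop := by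
        congr with x
        exact (hlim x).liminf_eq.symm
    _ ≤ liminf (fun m => ∫⁻ x, (∑ j, ‖F m j x‖ₑ ^ 2) ^ 2) atTop := by
        refine lintegral_liminf_le fun m => ?_
        refine (Finset.measurable_sum _ fun j _ => ?_).pow_const 2
        exact (measurable_enorm_schwartz _).pow_const 2
    _ ≤ _ := by
        refine liminf_le_of_le (by isBoundedDefault) fun b hb => ?_
        obtain ⟨m, hm⟩ := hb.exists
        refine hm.trans ?_
        rw [← l2_sq]
        gcongr
        exact hFb m

/-- The bridge between `L⁴` and `l2`: an `l2` bound for squares is the square of an `L⁴` bound. -/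
theorem eLpNorm_four_sq {α E : Type*} [MeasureSpace α] [NormedAddCommGroup E] (g : α → E) :
    eLpNorm g 4 volume ^ 2 = (∫⁻ x, (‖g x‖ₑ ^ 2) ^ 2) ^ (1 / 2 : ℝ) := by
  rw [eLpNorm_eq_lintegral_rpow_enorm_toReal (by norm_num) (by norm_num), ← ENNReal.rpow_natCast,
    ← ENNReal.rpow_mul]
  simp only [← ENNReal.rpow_natCast]
  norm_num
  simp only [← pow_mul]

end Extension

/-! ### Extension to `L⁴` and the number of dyadic scales. -/

section Operator

open Filter Topology

/-- The vector of all the projections of a Schwartz function. -/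
def smoothProjVec {n : ℕ} {ι : Type} [Fintype ι] (φ : ι → UnitSphere n → ℝ) (f : 𝓢(Space n, ℂ))
    (x : Space n) : EuclideanSpace ℂ ι :=
  WithLp.toLp 2 fun j => smoothProj (φ j) f x

theorem enorm_sq_euclidean {ι : Type} [Fintype ι] (v : EuclideanSpace ℂ ι) :
    ‖v‖ₑ ^ 2 = ∑ j, ‖v j‖ₑ ^ 2 := by
  have h := EuclideanSpace.norm_sq_eq v
  have e : ∀ a : ℝ, 0 ≤ a → ENNReal.ofReal a ^ 2 = ENNReal.ofReal (a ^ 2) :=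
    fun a ha => (ENNReal.ofReal_pow ha 2).symm
  simp only [← ofReal_norm]
  rw [e _ (norm_nonneg _), h, ENNReal.ofReal_sum_of_nonneg fun _ _ => by positivity]
  exact Finset.sum_congr rfl fun j _ => (e _ (norm_nonneg _)).symm

/-- An a priori bound for the square function of the projections of Schwartz functions extends to
`L⁴`. -/
theorem exists_smoothProj_extension {n : ℕ} {A : ℕ → ℝ} {δ : ℝ} {ι : Type} [Fintype ι]
    {c : ι → UnitSphere n} {φ : ι → UnitSphere n → ℝ} (hφ : ∀ j, IsBump A δ (c j) (φ j)) {B : ℝ}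
    (hB : 0 ≤ B) (h : ∀ f : 𝓢(Space n, ℂ),
      eLpNorm (smoothProjVec φ f) 4 volume ≤ ENNReal.ofReal B * eLpNorm f 4 volume) :
    ∃ T : ι → Lp ℂ 4 (volume : Measure (Space n)) →L[ℂ] Lp ℂ 4 (volume : Measure (Space n)),
      (∀ j, IsSmoothProj (φ j) (T j)) ∧ ∀ f : Lp ℂ 4 (volume : Measure (Space n)),
        eLpNorm (fun x => (∑' j, ‖T j f x‖ₑ ^ 2) ^ (1 / 2 : ℝ)) 4 volume ≤
          ENNReal.ofReal B * eLpNorm f 4 volume := by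
  have hmem : ∀ f : 𝓢(Space n, ℂ), MemLp (smoothProjVec φ f) 4 volume := fun f => by
    refine ⟨Continuous.aestronglyMeasurable ?_, ?_⟩
    · exact (PiLp.continuous_toLp 2 _).comp (continuous_pi fun j => continuous_smoothProj (hφ j) f)
    · exact (h f).trans_lt (ENNReal.mul_lt_top ENNReal.ofReal_lt_top (f.eLpNorm_lt_top 4 volume))
  -- All projections are extended together, as one operator with values in `ℓ²`. Its norm bound is
  -- the square function estimate, and the `T j` are its coordinates.
  let S : 𝓢(Space n, ℂ) →ₗ[ℂ] Lp (EuclideanSpace ℂ ι) 4 (volume : Measure (Space n)) :=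
    { toFun := fun f => (hmem f).toLp
      map_add' := fun f g => by
        rw [← MemLp.toLp_add]
        refine MemLp.toLp_congr _ _ (Eventually.of_forall fun x => ?_)
        ext j
        simp [smoothProjVec, smoothProj_add (hφ j)]
      map_smul' := fun a f => by
        rw [RingHom.id_apply, ← MemLp.toLp_const_smul]
        refine MemLp.toLp_congr _ _ (Eventually.of_forall fun x => ?_)
        ext j
        simp [smoothProjVec, smoothProj_smul] }
  let e : 𝓢(Space n, ℂ) →ₗ[ℂ] Lp ℂ 4 (volume : Measure (Space n)) :=
    (SchwartzMap.toLpCLM ℂ ℂ 4 volume).toLinearMap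
  have hdense : DenseRange e :=
    SchwartzMap.denseRange_toLpCLM (F := ℂ) (p := 4) (by norm_num) (μ := (volume : Measure (Space n)))
  have hS : ∀ f, ‖S f‖ ≤ B * ‖e f‖ := fun f => by
    have h1 : ‖S f‖ = (eLpNorm (smoothProjVec φ f) 4 volume).toReal := Lp.norm_toLp _ (hmem f)
    have h2 : ‖e f‖ = (eLpNorm f 4 volume).toReal := Lp.norm_toLp _ (f.memLp 4 volume)
    rw [h1, h2, ← ENNReal.toReal_ofReal hB, ← ENNReal.toReal_mul]
    exact ENNReal.toReal_mono
      (ENNReal.mul_ne_top ENNReal.ofReal_ne_top (f.eLpNorm_lt_top 4 volume).ne) (h f)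
  let 𝒯 := S.extendOfNorm e
  have h𝒯 : ∀ f, 𝒯 (e f) = S f := LinearMap.extendOfNorm_eq hdense ⟨B, hS⟩
  have hbound : ∀ f, ‖𝒯 f‖ ≤ B * ‖f‖ := LinearMap.norm_extendOfNorm_apply_le hdense B hS
  refine ⟨fun j => (EuclideanSpace.proj (𝕜 := ℂ) j : EuclideanSpace ℂ ι →L[ℂ] ℂ).compLpL 4 volume ∘L 𝒯,
    fun j f => ?_, fun f => ?_⟩
  · have h1 := (EuclideanSpace.proj (𝕜 := ℂ) j : EuclideanSpace ℂ ι →L[ℂ] ℂ).coeFn_compLpL (S f)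
    have h2 : S f =ᵐ[volume] smoothProjVec φ f := MemLp.coeFn_toLp (hmem f)
    have h3 : 𝒯 (f.toLp 4 volume) = S f := h𝒯 f
    rw [ContinuousLinearMap.comp_apply, h3]
    filter_upwards [h1, h2] with x hx1 hx2
    rw [hx1, hx2]
    simp [smoothProjVec]
  · have h1 : ∀ᵐ x : Space n, ∀ j, ((EuclideanSpace.proj (𝕜 := ℂ) j :
        EuclideanSpace ℂ ι →L[ℂ] ℂ).compLpL 4 volume (𝒯 f)) x = 𝒯 f x j :=
      ae_all_iff.2 fun j =>
        (EuclideanSpace.proj (𝕜 := ℂ) j : EuclideanSpace ℂ ι →L[ℂ] ℂ).coeFn_compLpL (𝒯 f)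
    calc _ = eLpNorm (𝒯 f) 4 volume := by
          refine eLpNorm_congr_enorm_ae ?_
          filter_upwards [h1] with x hx
          simp only [ContinuousLinearMap.comp_apply, hx, tsum_fintype, ← enorm_sq_euclidean,
            enorm_eq_self]
          rw [← ENNReal.rpow_natCast, ← ENNReal.rpow_mul]
          norm_num
      _ = ENNReal.ofReal ‖𝒯 f‖ := by
          rw [Lp.norm_def, ENNReal.ofReal_toReal (Lp.eLpNorm_ne_top _)]
      _ ≤ ENNReal.ofReal (B * ‖f‖) := ENNReal.ofReal_le_ofReal (hbound f)
      _ = _ := by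
          rw [ENNReal.ofReal_mul hB, Lp.norm_def, ENNReal.ofReal_toReal (Lp.eLpNorm_ne_top _)]

/-- The number of dyadic scales between `δ` and `8` is comparable to `log δ⁻¹`. -/
theorem exists_scale_count {δ : ℝ} (hδ : 0 < δ) (hδ2 : δ ≤ 1 / 2) :
    ∃ Λ : ℕ, (∀ l < Λ, δ * 2 ^ l ≤ 8) ∧ 8 ≤ δ * 2 ^ Λ ∧
      (Λ : ℝ) + 1 ≤ 6 / Real.log 2 * Real.log δ⁻¹ := by
  have hex : ∃ Λ : ℕ, 8 ≤ δ * 2 ^ Λ := by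
    obtain ⟨Λ, hΛ⟩ := pow_unbounded_of_one_lt (8 / δ) (by norm_num : (1 : ℝ) < 2)
    exact ⟨Λ, by rw [div_lt_iff₀ hδ] at hΛ; linarith⟩
  classical
  have hmin : ∀ l < Nat.find hex, δ * 2 ^ l ≤ 8 := fun l hl => (not_le.1 (Nat.find_min hex hl)).le
  refine ⟨Nat.find hex, hmin, Nat.find_spec hex, ?_⟩
  set Λ := Nat.find hex
  have hl2 : 0 < Real.log 2 := Real.log_pos (by norm_num)
  have hlδ : Real.log 2 ≤ Real.log δ⁻¹ := by
    refine Real.log_le_log (by norm_num) ?_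
    rw [le_inv_comm₀ (by norm_num) hδ]
    linarith
  -- Minimality of `Λ` gives `2^Λ ≤ 16 δ⁻¹`. As `log 2 ≤ log δ⁻¹`, the additive constants `4 + 1`
  -- are absorbed, leaving the factor `6`.
  have hΛ : (Λ : ℝ) * Real.log 2 ≤ 4 * Real.log 2 + Real.log δ⁻¹ := by
    rcases Nat.eq_zero_or_pos Λ with h0 | h0
    · rw [h0]
      simp only [Nat.cast_zero, zero_mul]
      linarith
    · have h1 := hmin (Λ - 1) (by omega)
      have h2 : (2 : ℝ) ^ Λ ≤ 2 ^ 4 * δ⁻¹ := by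
        have e : (2 : ℝ) ^ Λ = 2 * 2 ^ (Λ - 1) := by
          rw [← pow_succ']
          congr 1
          omega
        rw [e, ← div_eq_mul_inv, le_div_iff₀ hδ]
        nlinarith
      have h3 := Real.log_le_log (by positivity) h2
      rwa [Real.log_mul (by positivity) (by positivity), Real.log_pow, Real.log_pow] at h3
  rw [div_mul_eq_mul_div, le_div_iff₀ hl2]
  nlinarith

end Operator

end ConeSquareFunction

end

/-! ### The main theorem. -/

theorem theorem1p1 (n : ℕ) (A : ℕ → ℝ) :
    ∃ C : ℝ, 0 < C ∧
      ∀ (δ : ℝ), 0 < δ → δ ≤ 1 / 2 →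
      ∀ (ι : Type) (c : ι → ConeSquareFunction.UnitSphere n)
        (φ : ι → ConeSquareFunction.UnitSphere n → ℝ),
        Pairwise (fun i j => Disjoint (Metric.ball (c i) δ) (Metric.ball (c j) δ)) →
        (∀ j, ConeSquareFunction.IsBump A δ (c j) (φ j)) →
        ∃ T : ι → Lp ℂ 4 (volume : Measure (ConeSquareFunction.Space n)) →L[ℂ]
            Lp ℂ 4 (volume : Measure (ConeSquareFunction.Space n)),
          (∀ j, ConeSquareFunction.IsSmoothProj (φ j) (T j)) ∧
          ∀ f : Lp ℂ 4 (volume : Measure (ConeSquareFunction.Space n)),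
            eLpNorm (fun x => (∑' j, ‖T j f x‖ₑ ^ 2) ^ (1 / 2 : ℝ)) 4 volume ≤
              ENNReal.ofReal (C * (Real.log δ⁻¹) ^ (1 / 2 : ℝ)) * eLpNorm f 4 volume := by
  obtain ⟨C₀, hC₀, h⟩ := ConeSquareFunction.exists_smoothProj_estimate n A
  -- Chosen so that `C₀ (Λ + 1) ≤ b log δ⁻¹`, a bound for the square of the norm; hence the constant
  -- `b ^ (1 / 2)`. The `+ 1` keeps `b` positive.
  set b : ℝ := (C₀.toReal + 1) * (6 / Real.log 2) with hb
  have hl2 : 0 < Real.log 2 := Real.log_pos (by norm_num)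
  have hbpos : 0 < b := by positivity
  refine ⟨b ^ (1 / 2 : ℝ), by positivity, ?_⟩
  intro δ hδ hδ2 ι c φ hdisj hφ
  -- The centres are `δ`-separated points of the unit sphere, so the `tsum` in the conclusion is a
  -- finite sum.
  have : Finite ι := ConeSquareFunction.finite_of_separated (θ := fun j => (c j).1) hδ
    (fun i j hij => ConeSquareFunction.le_norm_sub_of_disjoint_ball hδ (hdisj hij))
    fun j => (ConeSquareFunction.norm_coe_sphere (c j)).le
  have := Fintype.ofFinite ι
  obtain ⟨Λ, hΛ1, hΛ2, hΛ3⟩ := ConeSquareFunction.exists_scale_count hδ hδ2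
  have hlog : 0 ≤ Real.log δ⁻¹ := Real.log_nonneg (by
    rw [one_le_inv₀ hδ]; linarith)
  refine ConeSquareFunction.exists_smoothProj_extension hφ (by positivity) fun f => ?_
  have h1 := h δ hδ hδ2 ι c φ hdisj hφ Λ hΛ1 hΛ2 f
  have hC : C₀ * (Λ + 1) ≤ ENNReal.ofReal (b * Real.log δ⁻¹) := by
    rw [← ENNReal.ofReal_toReal hC₀]
    have e : (Λ : ENNReal) + 1 = ENNReal.ofReal ((Λ : ℝ) + 1) := by
      rw [ENNReal.ofReal_add (by positivity) (by positivity)]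
      simp
    rw [e, ← ENNReal.ofReal_mul ENNReal.toReal_nonneg]
    refine ENNReal.ofReal_le_ofReal ?_
    rw [hb, mul_assoc]
    gcongr
    linarith
  refine (ENNReal.pow_le_pow_left_iff (n := 2) (by norm_num)).1 ?_
  rw [mul_pow, ConeSquareFunction.eLpNorm_four_sq, ConeSquareFunction.eLpNorm_four_sq,
    ← Real.mul_rpow hbpos.le hlog, ← ENNReal.ofReal_pow (by positivity), ← Real.rpow_natCast,
    ← Real.rpow_mul (by positivity)]
  norm_num only [Nat.cast_ofNat, Real.rpow_one]
  simp only [ConeSquareFunction.enorm_sq_euclidean, ConeSquareFunction.smoothProjVec]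
  calc _ ≤ _ := h1
    _ ≤ _ := by
      gcongr
      rfl
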